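/- **Setting.** Let $\Omega\subset\mathbb R^2$ be a bounded polygonal Lipschitz domain whose boundary consists of disjoint parts $\Gamma_D$ (of positive length) and $\Gamma_N$, let $f\in L^2(\Omega)$, $g_N\in L^2(\Gamma_N)$, and let $\Gamma\subset\Omega$ be a simple closed $C^2$ curve that separates $\Omega$ into $\Omega^+$ and $\Omega^-$. Let $\alpha=\alpha^\pm>0$ on $\Omega^\pm$ be piecewise constant, $\rho=\alpha^+/\alpha^-$, and let $u\in H^1_D(\Omega)$ solve $(\alpha\nabla u,\nabla v)=(f,v)-(g_N,v)_{\Gamma_N}$ for all $v\in H^1_D(\Omega)$. Let $\mathcal T$ be a conforming triangulation of $\Omega$, resolving $\Gamma_D$ and $\Gamma_N$, in which every $K$ contains a disc of radius $h_K/\sigma$, $h_K=\operatorname{diam}K$. $\mathcal E_K$ is the set of edges of $K$, $\mathcal E_I$ and $\mathcal E_N$ are the interior edges and the edges on $\Gamma_N$, $h_F$ is the length of an edge $F$, and $\mathcal E^{int}$ is the set of interface edges ($F\cap\Gamma\ne\emptyset$, $F\not\subset\Gamma$). An edge that meets $\Gamma$ more than once lies in $\Gamma$. An interface element ($K\in\mathcal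 T^{int}$) is one whose interior meets $\Gamma$; then $\Gamma\cap K$ is an arc that meets $\partial K$ exactly in its two endpoints, these are not on a common edge, and the chord $\tilde\Gamma_K$ joining them splits $K$ into sub-elements $\tilde K^\pm$ whose vertices off $\Gamma$ lie on the side of $\Omega^\pm$. Put $K^\pm=K\cap\Omega^\pm$, $S_K=(K^+\setminus\tilde K^+)\cup(K^-\setminus\tilde K^-)$ ($S_K=\emptyset$ if $K\notin\mathcal T^{int}$), $\tilde\alpha=\alpha^\pm$ on $\tilde K^\pm$, and $\tilde\alpha=\alpha$ on non-interface elements. For an edge $F$ shared by $K_{F,1},K_{F,2}$ let $\mathbf n_F$ be the unit normal pointing out of $K_{F,1}$, $\mathbf t_F$ the unit tangent, $[v]=v|_{K_{F,1}}-v|_{K_{F,2}}$, $\{v\}$ the average, and $h_F^\pm$ the length of $F\cap\Omega^\pm$. The immersed finite element space consists of the elementwise functions $v$, single-valued at the vertices, with $v|_K\in P_1(K)$ for non-interface elements and, for $K\in\mathcal T^{int}$, $v|_{\tilde K^\pm}\in P_1(\tilde K^\pm)$, $v|_K\in H^1(K)$, $\tilde\alpha\nabla v\in H(\mathrm{div},K)$.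 For $\epsilon\in\{-1,0,1\}$ and $\gamma>0$ let $u_{\mathcal T}$, in the subspace of functions vanishing on $\Gamma_D$, satisfy for all $v$ in that subspace $$\sum_K\int_K\tilde\alpha\nabla u_{\mathcal T}\cdot\nabla v-\sum_{F\in\mathcal E^{int}}\int_F\{\tilde\alpha\nabla u_{\mathcal T}\cdot\mathbf n_F\}[v]+\epsilon\sum_{F\in\mathcal E^{int}}\int_F\{\tilde\alpha\nabla v\cdot\mathbf n_F\}[u_{\mathcal T}]+\sum_{F\in\mathcal E^{int}}\gamma\int_F\frac{\tilde\alpha}{h_F}[u_{\mathcal T}][v]=(f,v)-(g_N,v)_{\Gamma_N}.$$ With $\tilde\alpha_F=\max(\tilde\alpha|_{K_{F,1}},\tilde\alpha|_{K_{F,2}})$ on $F$ (the single trace of $\tilde\alpha$ if $F$ is a boundary edge), $j_{n,F}=[\tilde\alpha\nabla u_{\mathcal T}\cdot\mathbf n_F]$ and $j_{t,F}=[\nabla u_{\mathcal T}\cdot\mathbf t_F]$ on interior edges and $j_{n,F}=\tilde\alpha\nabla u_{\mathcal T}\cdot\mathbf n_F+g_N$ on $F\subset\Gamma_N$, let $$\eta_K^2=\sum_{F\in\mathcal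 E_K\cap\mathcal E^{int}}\frac{h_F}2\Big(\|\tilde\alpha_F^{-1/2}j_{n,F}\|_{0,F}^2+\|\tilde\alpha_F^{1/2}j_{t,F}\|_{0,F}^2\Big)+\|\tilde\alpha^{1/2}\nabla u_{\mathcal T}\|_{0,S_K}^2+\sum_{F\in\mathcal E_K\cap\mathcal E_I\setminus\mathcal E^{int}}\frac{h_F}2\|\tilde\alpha_F^{-1/2}j_{n,F}\|_{0,F}^2+\sum_{F\in\mathcal E_K\cap\mathcal E_N}h_F\|\tilde\alpha_F^{-1/2}j_{n,F}\|_{0,F}^2 .$$ Let $\omega_K$ be the union of the elements sharing a vertex with $K$, $E_K=\|\alpha^{1/2}\nabla(u-u_{\mathcal T})\|_{0,\omega_K}$ (with the elementwise gradient of $u_{\mathcal T}$), $H_{f,K}=h_K\|\alpha^{-1/2}(f-f_K)\|_{0,K}$ with $f_K$ the average of $f$ over $K$, and $$D_K=\sum_{K'\subset\omega_K}\|\tilde\alpha^{1/2}\nabla u_{\mathcal T}\|_{0,S_{K'}}+\sum_{K'\subset\omega_K}H_{f,K'},\qquad s_K=\sum_{F\in\mathcal E_K\cap\mathcal E^{int}}h_F^{1/2}\min\{\sqrt{h_F^-},\sqrt{h_F^+}\}.$$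 **Theorem (local efficiency).** There are positive constants $C_1=C_1(\sigma,\rho,\lambda,\Lambda)$ and $C_2=C_2(\sigma,\rho,\kappa,M)$, depending only on the arguments shown, such that the following holds in every setting as above in which the curvature of $\Gamma$ is at most $\kappa$ and $\|\alpha^{1/2}\nabla u\|_{0,\Omega}\le M$, for every $K\in\mathcal T^{int}$ such that $g_N$ is constant on each edge of $K$ contained in $\Gamma_N$ (if there is such an edge), and for all $\lambda>0$ and $\Lambda$: 1. if $\lambda\le h_F^+/h_F^-\le\Lambda$ for all $F\in\mathcal E_K\cap\mathcal E^{int}$, then $\eta_K\le C_1(E_K+D_K)$; 2. without any assumption on the ratios, $\eta_K\le C_2(E_K+D_K+s_K)$; 3. under the assumption of 1, $\eta_K\le\min\{C_1,C_2\}(E_K+\delta_K)$ with $\delta_K=D_K+\chi(C_2\le C_1)\,s_K$, where $\chi(C_2\le C_1)$ is $1$ if $C_2\le C_1$ and $0$ otherwise. In particular neither constant depends on the mesh size, and $C_2$ does not depend on where the interface cuts the mesh. -/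

import Mathlib

open MeasureTheory Filter Topology Set
open scoped ContDiff InnerProductSpace

noncomputable section

namespace IFEM

open scoped Classical

/-- The Euclidean plane. -/
abbrev Plane := EuclideanSpace ℝ (Fin 2)

/-! ### Sobolev spaces -/

/-- `G` is the weak (distributional) gradient of `v` in the open set `U`. -/
def HasWeakGradient (U : Set Plane) (v : Plane → ℝ) (G : Plane → Plane) : Prop :=
  ∀ φ : Plane → ℝ, ContDiff ℝ ∞ φ → HasCompactSupport φ → tsupport φ ⊆ U →
    ∫ x in U, v x • gradient φ x = - ∫ x in U, φ x • G x

/-- `v` belongs to `H¹(U)` and `G` is its weak gradient. -/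
structure IsH1 (U : Set Plane) (v : Plane → ℝ) (G : Plane → Plane) : Prop where
  memLp : MemLp v 2 (volume.restrict U)
  memLp_grad : MemLp G 2 (volume.restrict U)
  weakGradient : HasWeakGradient U v G

/-- The vector field `q` belongs to `H(div, U)`. -/
def IsHDiv (U : Set Plane) (q : Plane → Plane) : Prop :=
  MemLp q 2 (volume.restrict U) ∧
    ∃ d : Plane → ℝ, MemLp d 2 (volume.restrict U) ∧
      ∀ φ : Plane → ℝ, ContDiff ℝ ∞ φ → HasCompactSupport φ → tsupport φ ⊆ U →
        ∫ x in U, ⟪q x, gradient φ x⟫_ℝ = - ∫ x in U, d x * φ x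

/-- `τ ∈ L²(S)` is the trace on `S ⊆ ∂U` of the `H¹(U)` function `v` with weak gradient `G`:
functions that are smooth up to the boundary converge to `v` in `H¹(U)` and to `τ` in `L²(S)`. -/
def HasTrace (U S : Set Plane) (v : Plane → ℝ) (G : Plane → Plane) (τ : Plane → ℝ) : Prop :=
  MemLp τ 2 (μH[1].restrict S) ∧
    ∃ φ : ℕ → Plane → ℝ, (∀ n, ContDiff ℝ ∞ (φ n)) ∧
      Tendsto (fun n => eLpNorm (φ n - v) 2 (volume.restrict U)) atTop (𝓝 0) ∧
      Tendsto (fun n => eLpNorm (gradient (φ n) - G) 2 (volume.restrict U)) atTop (𝓝 0) ∧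
      Tendsto (fun n => eLpNorm (φ n - τ) 2 (μH[1].restrict S)) atTop (𝓝 0)

/-- Near each boundary point, in suitable Cartesian coordinates, `U` is the region above the
graph of a Lipschitz function. -/
def HasLipschitzBoundary (U : Set Plane) : Prop :=
  ∀ x ∈ frontier U, ∃ (e : Plane ≃ᵃⁱ[ℝ] Plane) (L : NNReal) (g : ℝ → ℝ) (r : ℝ),
    LipschitzWith L g ∧ 0 < r ∧ ∀ y ∈ Metric.ball x r, y ∈ U ↔ g ((e y) 0) < (e y) 1

/-! ### The interface problem -/

/-- The data of the elliptic interface problem. The interface is a simple closed `C²` curve inside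
`Ω`, given by an arclength parametrization `γ` of period `len`. -/
structure InterfaceProblem where
  Ω : Set Plane
  ΓD : Set Plane
  ΓN : Set Plane
  Ωp : Set Plane
  Ωm : Set Plane
  γ : ℝ → Plane
  len : ℝ
  αp : ℝ
  αm : ℝ
  f : Plane → ℝ
  g : Plane → ℝ
  isOpen : IsOpen Ω
  isConnected : IsConnected Ω
  isBounded : Bornology.IsBounded Ω
  lipschitz : HasLipschitzBoundary Ω
  measurableSet_ΓD : MeasurableSet ΓD
  measurableSet_ΓN : MeasurableSet ΓN
  frontier_eq : frontier Ω = closure ΓD ∪ closure ΓN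
  disjoint_boundary : Disjoint ΓD ΓN
  ΓD_pos : 0 < μH[1] ΓD
  len_pos : 0 < len
  γ_contDiff : ContDiff ℝ 2 γ
  γ_unitSpeed : ∀ s, ‖deriv γ s‖ = 1
  γ_periodic : Function.Periodic γ len
  γ_injOn : Set.InjOn γ (Set.Ico 0 len)
  Γ_subset : Set.range γ ⊆ Ω
  isOpen_Ωp : IsOpen Ωp
  isOpen_Ωm : IsOpen Ωm
  isConnected_Ωp : IsConnected Ωp
  isConnected_Ωm : IsConnected Ωm
  disjoint_Ω : Disjoint Ωp Ωm
  union_Ω : Ωp ∪ Ωm = Ω \ Set.range γ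
  αp_pos : 0 < αp
  αm_pos : 0 < αm
  memLp_f : MemLp f 2 (volume.restrict Ω)
  memLp_g : MemLp g 2 (μH[1].restrict ΓN)

namespace InterfaceProblem

variable (P : InterfaceProblem)

/-- The interface. -/
def Γ : Set Plane := Set.range P.γ

/-- The piecewise constant diffusion coefficient. -/
def α (x : Plane) : ℝ := if x ∈ P.Ωp then P.αp else P.αm

/-- The ratio of the coefficient jump. -/
def ρ : ℝ := P.αp / P.αm

/-- `u` lies in `H¹_D(Ω)`, has weak gradient `G`, and solves the variational problem. -/
structure IsSolution (u : Plane → ℝ) (G : Plane → Plane) : Prop where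
  isH1 : IsH1 P.Ω u G
  dirichlet : HasTrace P.Ω P.ΓD u G 0
  weak : ∀ (v : Plane → ℝ) (Gv : Plane → Plane) (τ : Plane → ℝ),
    IsH1 P.Ω v Gv → HasTrace P.Ω P.ΓD v Gv 0 → HasTrace P.Ω P.ΓN v Gv τ →
      ∫ x in P.Ω, P.α x * ⟪G x, Gv x⟫_ℝ =
        (∫ x in P.Ω, P.f x * v x) - ∫ x in P.ΓN, P.g x * τ x ∂μH[1]

end InterfaceProblem

/-! ### The triangulation -/

/-- The closed simplex spanned by a set of vertices. -/
def hull (s : Finset Plane) : Set Plane := convexHull ℝ (s : Set Plane)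

/-- A conforming triangulation of `Ω`, not necessarily fitted to the interface. An element is
the set of its three vertices. -/
structure Mesh (P : InterfaceProblem) where
  elements : Finset (Finset Plane)
  card_eq : ∀ K ∈ elements, K.card = 3
  affineIndependent : ∀ K ∈ elements, AffineIndependent ℝ (fun z : K => (z : Plane))
  conforming : ∀ K ∈ elements, ∀ K' ∈ elements, hull K ∩ hull K' = hull (K ∩ K')
  cover : ⋃ K ∈ elements, hull K = closure P.Ω
  /-- `K₁ F` and `K₂ F` are the elements sharing the edge `F` (only `K₁ F` is relevant for a
  boundary edge), and `n F` is the unit normal of `F` pointing out of `K₁ F`. -/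
  K₁ : Finset Plane → Finset Plane
  K₂ : Finset Plane → Finset Plane
  n : Finset Plane → Plane
  K₁_mem : ∀ F ∈ elements.biUnion (Finset.powersetCard 2), K₁ F ∈ elements ∧ F ⊆ K₁ F
  K₂_mem : ∀ F ∈ elements.biUnion (Finset.powersetCard 2), ¬ hull F ⊆ frontier P.Ω →
    K₂ F ∈ elements ∧ F ⊆ K₂ F ∧ K₂ F ≠ K₁ F
  norm_n : ∀ F ∈ elements.biUnion (Finset.powersetCard 2), ‖n F‖ = 1
  n_normal : ∀ F ∈ elements.biUnion (Finset.powersetCard 2),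
    ∀ a ∈ F, ∀ b ∈ F, ⟪n F, b - a⟫_ℝ = 0
  n_outward : ∀ F ∈ elements.biUnion (Finset.powersetCard 2),
    ∀ a ∈ F, ∀ z ∈ K₁ F, ⟪n F, z - a⟫_ℝ ≤ 0
  /-- The relative interior of a boundary edge lies in `Γ_D` or in `Γ_N`. -/
  boundary_edge : ∀ F ∈ elements.biUnion (Finset.powersetCard 2), hull F ⊆ frontier P.Ω →
    hull F \ F ⊆ P.ΓD ∨ hull F \ F ⊆ P.ΓN

namespace Mesh

variable {P : InterfaceProblem} (T : Mesh P)

/-- The edges of one element. -/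
def edgesOf (K : Finset Plane) : Finset (Finset Plane) := K.powersetCard 2

/-- All edges. -/
def edges : Finset (Finset Plane) := T.elements.biUnion edgesOf

/-- `F` is an interior edge. -/
def IsInterior (F : Finset Plane) : Prop := F ∈ T.edges ∧ ¬ hull F ⊆ frontier P.Ω

/-- `F` is a boundary edge on `Γ_D`. -/
def IsDirichlet (F : Finset Plane) : Prop :=
  F ∈ T.edges ∧ hull F ⊆ frontier P.Ω ∧ hull F \ F ⊆ P.ΓD

/-- `F` is a boundary edge on `Γ_N`. -/
def IsNeumann (F : Finset Plane) : Prop :=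
  F ∈ T.edges ∧ hull F ⊆ frontier P.Ω ∧ hull F \ F ⊆ P.ΓN

/-- `F` is an interface edge. -/
def IsInterfaceEdge (F : Finset Plane) : Prop :=
  F ∈ T.edges ∧ (hull F ∩ P.Γ).Nonempty ∧ ¬ hull F ⊆ P.Γ

/-- `K` is an interface element: its interior is cut through by the interface. -/
def IsInterfaceElement (K : Finset Plane) : Prop :=
  K ∈ T.elements ∧ (interior (hull K) ∩ P.Γ).Nonempty

/-- Every element `K` contains a ball of radius `h_K / σ`. -/
def ShapeRegular (σ : ℝ) : Prop :=
  ∀ K ∈ T.elements, ∃ c, Metric.closedBall c (Metric.diam (hull K) / σ) ⊆ hull K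

/-- The length of an edge. -/
def h (F : Finset Plane) : ℝ := Metric.diam (hull F)

/-- The length of the part `F⁺` of an edge in `Ω⁺`. -/
def hp (_T : Mesh P) (F : Finset Plane) : ℝ := (μH[1] (hull F ∩ P.Ωp)).toReal

/-- The length of the part `F⁻` of an edge in `Ω⁻`. -/
def hm (_T : Mesh P) (F : Finset Plane) : ℝ := (μH[1] (hull F ∩ P.Ωm)).toReal

/-- The unit tangent of an edge. -/
def t (F : Finset Plane) : Plane := !₂[-(T.n F 1), T.n F 0]

/-- The elements sharing at least one vertex with `K`; their union is the patch `ω_K`. -/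
def patch (K : Finset Plane) : Finset (Finset Plane) :=
  T.elements.filter fun K' => (K ∩ K').Nonempty

/-- The sub-element of `K` belonging to the side `S ∈ {Ω⁺, Ω⁻}`: the polygon spanned by the points
where the interface meets `∂K` and by the vertices of `K` on that side. -/
def subElement (_T : Mesh P) (S : Set Plane) (K : Finset Plane) : Set Plane :=
  convexHull ℝ ((P.Γ ∩ frontier (hull K)) ∪ {z | z ∈ K ∧ z ∈ closure S \ P.Γ})

/-- How the interface cuts the triangulation. An edge that meets `Γ` more than once is part of
`Γ`. Within an interface element `K`, `Γ` is an arc from `p` to `q`, these are its only points on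
`∂K`, they are not on one common edge, and the segment from `p` to `q` separates the vertices of `K`
on the side of `Ω⁺` from those on the side of `Ω⁻`. -/
structure RegularCut : Prop where
  edge : ∀ F ∈ T.edges, (hull F ∩ P.Γ).Nontrivial → hull F ⊆ P.Γ
  element : ∀ K, T.IsInterfaceElement K → ∃ s t : ℝ, s < t ∧ t < s + P.len ∧
    P.γ '' Set.Icc s t = P.Γ ∩ hull K ∧
    P.Γ ∩ frontier (hull K) = {P.γ s, P.γ t} ∧
    (∀ F ∈ edgesOf K, ¬ (P.γ s ∈ hull F ∧ P.γ t ∈ hull F)) ∧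
    ∃ ℓ : Plane →ᴬ[ℝ] ℝ, ℓ (P.γ s) = 0 ∧ ℓ (P.γ t) = 0 ∧
      (∀ z ∈ K, z ∈ closure P.Ωp \ P.Γ → 0 < ℓ z) ∧
      (∀ z ∈ K, z ∈ closure P.Ωm \ P.Γ → ℓ z < 0)

/-- The approximate coefficient on the element `K`, up to and including `∂K`. -/
def αt (K : Finset Plane) (x : Plane) : ℝ :=
  if T.IsInterfaceElement K then (if x ∈ T.subElement P.Ωp K then P.αp else P.αm)
  else if interior (hull K) ⊆ P.Ωp then P.αp else P.αm

/-- The region between the interface and its chord in the interface element `K`; it is empty for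
other elements. -/
def S (K : Finset Plane) : Set Plane :=
  if T.IsInterfaceElement K then
    ((hull K ∩ P.Ωp) \ T.subElement P.Ωp K) ∪ ((hull K ∩ P.Ωm) \ T.subElement P.Ωm K)
  else ∅

/-! ### The immersed finite element method -/

/-- An elementwise defined function: `v K` is the function on the closed triangle `K`. -/
abbrev Broken := Finset Plane → Plane → ℝ

/-- The gradient of `v|_K` on the closed triangle `K`. On `∂K` it is the trace of the gradient from
inside `K`. -/
def grad (v : Broken) (K : Finset Plane) (x : Plane) : Plane := gradientWithin (v K) (hull K) x

/-- The local immersed finite element space on an interface element `K`. -/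
def IsLocalIFE (K : Finset Plane) (w : Plane → ℝ) : Prop :=
  (∃ G, IsH1 (interior (hull K)) w G ∧ IsHDiv (interior (hull K)) (fun x => T.αt K x • G x)) ∧
  (∃ p : Plane →ᴬ[ℝ] ℝ, Set.EqOn w p (T.subElement P.Ωp K)) ∧
  (∃ p : Plane →ᴬ[ℝ] ℝ, Set.EqOn w p (T.subElement P.Ωm K))

/-- The global immersed finite element space. -/
structure IsIFE (v : Broken) : Prop where
  interface : ∀ K, T.IsInterfaceElement K → T.IsLocalIFE K (v K)
  nonInterface : ∀ K ∈ T.elements, ¬ T.IsInterfaceElement K →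
    ∃ p : Plane →ᴬ[ℝ] ℝ, Set.EqOn (v K) p (hull K)
  vertex : ∀ K ∈ T.elements, ∀ K' ∈ T.elements, ∀ z ∈ K ∩ K', v K z = v K' z

/-- The subspace of functions that vanish on `Γ_D`. -/
def IsIFED (v : Broken) : Prop :=
  T.IsIFE v ∧ ∀ F, T.IsDirichlet F → ∀ x ∈ hull F, v (T.K₁ F) x = 0

/-- The jump of `v` on an interior edge. -/
def jump (v : Broken) (F : Finset Plane) (x : Plane) : ℝ := v (T.K₁ F) x - v (T.K₂ F) x

/-- The average of the normal flux of `v` on an interior edge. -/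
def avgFlux (v : Broken) (F : Finset Plane) (x : Plane) : ℝ :=
  (⟪T.αt (T.K₁ F) x • grad v (T.K₁ F) x, T.n F⟫_ℝ
    + ⟪T.αt (T.K₂ F) x • grad v (T.K₂ F) x, T.n F⟫_ℝ) / 2

/-- The bilinear form of the partially penalized method. -/
def ah (ε γ : ℝ) (w v : Broken) : ℝ :=
  (∑ K ∈ T.elements, ∫ x in hull K, T.αt K x * ⟪grad w K x, grad v K x⟫_ℝ)
  - (∑ F ∈ T.edges with T.IsInterfaceEdge F, ∫ x in hull F, T.avgFlux w F x * T.jump v F x ∂μH[1])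
  + ε * (∑ F ∈ T.edges with T.IsInterfaceEdge F,
      ∫ x in hull F, T.avgFlux v F x * T.jump w F x ∂μH[1])
  + ∑ F ∈ T.edges with T.IsInterfaceEdge F,
      γ * ∫ x in hull F, P.α x / h F * T.jump w F x * T.jump v F x ∂μH[1]

/-- `uT` is a solution of the partially penalized immersed finite element method. -/
def IsIFESolution (ε γ : ℝ) (uT : Broken) : Prop :=
  T.IsIFED uT ∧ ∀ v, T.IsIFED v →
    T.ah ε γ uT v = (∑ K ∈ T.elements, ∫ x in hull K, P.f x * v K x)
      - ∑ F ∈ T.edges with T.IsNeumann F, ∫ x in hull F, P.g x * v (T.K₁ F) x ∂μH[1]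

/-! ### The error indicator -/

/-- The normal flux jump on an edge. -/
def jn (v : Broken) (F : Finset Plane) (x : Plane) : ℝ :=
  if T.IsInterior F then
    ⟪T.αt (T.K₁ F) x • grad v (T.K₁ F) x, T.n F⟫_ℝ
      - ⟪T.αt (T.K₂ F) x • grad v (T.K₂ F) x, T.n F⟫_ℝ
  else if T.IsNeumann F then
    ⟪T.αt (T.K₁ F) x • grad v (T.K₁ F) x, T.n F⟫_ℝ + P.g x
  else 0

/-- The tangential derivative jump on an edge. -/
def jt (v : Broken) (F : Finset Plane) (x : Plane) : ℝ :=
  if T.IsInterior F then ⟪grad v (T.K₁ F) x, T.t F⟫_ℝ - ⟪grad v (T.K₂ F) x, T.t F⟫_ℝ else 0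

/-- The maximum of the two traces of the approximate coefficient on an edge. -/
def αF (F : Finset Plane) (x : Plane) : ℝ :=
  if T.IsInterior F then max (T.αt (T.K₁ F) x) (T.αt (T.K₂ F) x) else T.αt (T.K₁ F) x

/-- The squared weighted `L²(F)` norm of the normal flux jump. -/
def fluxSq (v : Broken) (F : Finset Plane) : ℝ :=
  ∫ x in hull F, (T.αF F x)⁻¹ * T.jn v F x ^ 2 ∂μH[1]

/-- The squared weighted `L²(F)` norm of the tangential derivative jump. -/
def tangSq (v : Broken) (F : Finset Plane) : ℝ :=
  ∫ x in hull F, T.αF F x * T.jt v F x ^ 2 ∂μH[1]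

/-- The geometric term `‖α̃^{1/2} ∇v‖` on `S_K`. -/
def geo (v : Broken) (K : Finset Plane) : ℝ :=
  √(∫ x in T.S K, T.αt K x * ‖grad v K x‖ ^ 2)

/-- The local error indicator. -/
def η (v : Broken) (K : Finset Plane) : ℝ :=
  √((∑ F ∈ edgesOf K with T.IsInterfaceEdge F,
        (h F / 2 * T.fluxSq v F + h F / 2 * T.tangSq v F))
    + T.geo v K ^ 2
    + (∑ F ∈ edgesOf K with T.IsInterior F ∧ ¬ T.IsInterfaceEdge F, h F / 2 * T.fluxSq v F)
    + ∑ F ∈ edgesOf K with T.IsNeumann F, h F * T.fluxSq v F)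

/-- The oscillation `H_{f,K}` of the right-hand side. -/
def osc (_T : Mesh P) (K : Finset Plane) : ℝ :=
  Metric.diam (hull K) *
    √(∫ x in hull K, (P.α x)⁻¹ * (P.f x - ⨍ y in hull K, P.f y) ^ 2)

/-- The energy error on the patch of `K`; `G` is the weak gradient of the exact solution. -/
def err (G : Plane → Plane) (v : Broken) (K : Finset Plane) : ℝ :=
  √(∑ K' ∈ T.patch K, ∫ x in hull K', P.α x * ‖G x - grad v K' x‖ ^ 2)

/-- The term measuring the smaller parts of the interface edges of `K`. -/
def small (K : Finset Plane) : ℝ :=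
  ∑ F ∈ edgesOf K with T.IsInterfaceEdge F, √(h F) * min √(T.hm F) √(T.hp F)

/-- The term `δ_K`, which depends on the two efficiency constants. -/
def δ (C₁ C₂ : ℝ) (v : Broken) (K : Finset Plane) : ℝ :=
  (∑ K' ∈ T.patch K, T.geo v K') + (if C₂ ≤ C₁ then T.small K else 0)
    + ∑ K' ∈ T.patch K, T.osc K'

/-- The interface edges of `K` are cut in a ratio between `lam` and `Lam`. -/
def RatioBound (lam Lam : ℝ) (K : Finset Plane) : Prop :=
  ∀ F ∈ edgesOf K, T.IsInterfaceEdge F → lam ≤ T.hp F / T.hm F ∧ T.hp F / T.hm F ≤ Lam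

end Mesh

end IFEM

end

noncomputable section

namespace IFEM

open scoped Classical

/-! ### The Euclidean plane -/

/-- Rotation by a right angle. -/
def rot (v : Plane) : Plane := !₂[-(v 1), v 0]

@[simp] lemma rot_apply_zero (v : Plane) : rot v 0 = -(v 1) := rfl

@[simp] lemma rot_apply_one (v : Plane) : rot v 1 = v 0 := rfl

lemma inner_plane (x y : Plane) : ⟪x, y⟫_ℝ = x 0 * y 0 + x 1 * y 1 := by
  simp [PiLp.inner_apply, Fin.sum_univ_two, mul_comm]

lemma norm_sq_plane (x : Plane) : ‖x‖ ^ 2 = x 0 ^ 2 + x 1 ^ 2 := by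
  rw [← real_inner_self_eq_norm_sq, inner_plane]; ring

lemma norm_rot (v : Plane) : ‖rot v‖ = ‖v‖ := by
  have h : ‖rot v‖ ^ 2 = ‖v‖ ^ 2 := by rw [norm_sq_plane, norm_sq_plane]; simp; ring
  exact (pow_left_inj₀ (norm_nonneg _) (norm_nonneg _) two_ne_zero).1 h

lemma inner_rot_left (x y : Plane) : ⟪rot x, y⟫_ℝ = -⟪x, rot y⟫_ℝ := by
  simp [inner_plane]

lemma inner_rot_self (x : Plane) : ⟪x, rot x⟫_ℝ = 0 := by
  simp [inner_plane, mul_comm]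

lemma inner_sq_add_inner_rot_sq {n : Plane} (hn : ‖n‖ = 1) (v : Plane) :
    ⟪v, n⟫_ℝ ^ 2 + ⟪v, rot n⟫_ℝ ^ 2 = ‖v‖ ^ 2 := by
  have h : n 0 ^ 2 + n 1 ^ 2 = 1 := by rw [← norm_sq_plane, hn]; norm_num
  rw [norm_sq_plane]; simp only [inner_plane, rot_apply_zero, rot_apply_one]
  linear_combination (v 0 ^ 2 + v 1 ^ 2) * h

lemma decomp_rot {n : Plane} (hn : ‖n‖ = 1) (v : Plane) :
    v = ⟪v, rot n⟫_ℝ • rot n + ⟪v, n⟫_ℝ • n := by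
  have h : n 0 ^ 2 + n 1 ^ 2 = 1 := by rw [← norm_sq_plane, hn]; norm_num
  ext i; fin_cases i
  · simp [inner_plane]; linear_combination (-v 0) * h
  · simp [inner_plane]; linear_combination (-v 1) * h

lemma orthonormal_rot {n : Plane} (hn : ‖n‖ = 1) : Orthonormal ℝ ![rot n, n] := by
  refine ⟨?_, ?_⟩
  · intro i; fin_cases i
    · simpa [norm_rot] using hn
    · simpa using hn
  · intro i j hij
    fin_cases i <;> fin_cases j
    · exact absurd rfl hij
    · simp [inner_plane]; ring
    · simp [inner_plane]; ring
    · exact absurd rfl hij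

/-- The coordinate system with origin `c` and axes `rot n`, `n`. -/
def frame (c n : Plane) (p : ℝ × ℝ) : Plane := c + (p.1 • rot n + p.2 • n)

lemma exists_frame_equiv (c : Plane) {n : Plane} (hn : ‖n‖ = 1) :
    ∃ e : ℝ × ℝ ≃ᵐ Plane, MeasurePreserving e ∧ ∀ p, e p = frame c n p := by
  let b := (basisOfOrthonormalOfCardEqFinrank (orthonormal_rot hn) (by simp)).toOrthonormalBasis
    (by simpa using orthonormal_rot hn)
  refine ⟨(MeasurableEquiv.finTwoArrow.symm.trans (MeasurableEquiv.toLp 2 (Fin 2 → ℝ))).trans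
    (b.repr.symm.toHomeomorph.toMeasurableEquiv.trans (MeasurableEquiv.addLeft c)), ?_, ?_⟩
  · have h1 : MeasurePreserving (MeasurableEquiv.finTwoArrow.symm : ℝ × ℝ → Fin 2 → ℝ) :=
      (volume_preserving_finTwoArrow ℝ).symm _
    have h2 : MeasurePreserving (MeasurableEquiv.toLp 2 (Fin 2 → ℝ)) :=
      (EuclideanSpace.volume_preserving_symm_measurableEquiv_toLp (Fin 2)).symm _
    have h3 := b.measurePreserving_repr_symm
    have h4 := measurePreserving_add_left (volume : Measure Plane) c
    exact h4.comp (h3.comp (h2.comp h1))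
  · intro p
    have : b.repr.symm (WithLp.toLp 2 ![p.1, p.2]) = p.1 • rot n + p.2 • n := by
      rw [← OrthonormalBasis.sum_repr_symm, Fin.sum_univ_two]
      simp [b]
    exact congrArg (fun z => c + z) this

lemma inner_frame {c n : Plane} (hn : ‖n‖ = 1) (p : ℝ × ℝ) : ⟪n, frame c n p - c⟫_ℝ = p.2 := by
  simp [frame, inner_add_right, inner_smul_right, inner_rot_self, hn]

lemma isometry_line (c : Plane) {n : Plane} (hn : ‖n‖ = 1) :
    Isometry fun s : ℝ => c + s • rot n := by
  refine Isometry.of_dist_eq fun s t => ?_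
  rw [dist_add_left, dist_eq_norm, ← sub_smul, norm_smul, norm_rot, hn, mul_one, Real.dist_eq,
    Real.norm_eq_abs]

lemma frame_zero (c n : Plane) (s : ℝ) : frame c n (s, 0) = c + s • rot n := by simp [frame]

lemma continuous_frame (c n : Plane) : Continuous (frame c n) := by
  unfold frame; fun_prop

lemma volume_line {n : Plane} (hn : ‖n‖ = 1) (c : Plane) :
    volume {x : Plane | ⟪n, x - c⟫_ℝ = 0} = 0 := by
  obtain ⟨e, he, hef⟩ := exists_frame_equiv c hn
  rw [← he.measure_preimage_equiv]
  have : e ⁻¹' {x : Plane | ⟪n, x - c⟫_ℝ = 0} = univ ×ˢ {0} := by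
    ext p; simp [hef, inner_frame hn]
  rw [this, Measure.volume_eq_prod, Measure.prod_prod]; simp

/-- A nontrivial affine function vanishes only on a null set. -/
lemma volume_affine_eq_zero {ν : Plane} {b : ℝ} (h : ν ≠ 0 ∨ b ≠ 0) :
    volume {x : Plane | ⟪ν, x⟫_ℝ + b = 0} = 0 := by
  by_cases hν : ν = 0
  · have hb : b ≠ 0 := by tauto
    simp [hν, hb]
  · have hn : ‖(‖ν‖⁻¹ • ν)‖ = 1 := by
      rw [norm_smul, norm_inv, norm_norm, inv_mul_cancel₀ (norm_ne_zero_iff.2 hν)]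
    have hν2 : ‖ν‖ ^ 2 ≠ 0 := pow_ne_zero _ (norm_ne_zero_iff.2 hν)
    convert volume_line hn (-(b / ‖ν‖ ^ 2) • ν) using 2
    ext x
    have hν1 : ‖ν‖ ≠ 0 := norm_ne_zero_iff.2 hν
    have : ⟪‖ν‖⁻¹ • ν, x - -(b / ‖ν‖ ^ 2) • ν⟫_ℝ = ‖ν‖⁻¹ * (⟪ν, x⟫_ℝ + b) := by
      rw [real_inner_smul_left, inner_sub_right, real_inner_smul_right, real_inner_self_eq_norm_sq]
      field_simp
      ring
    simp only [mem_ofPred_eq, this, mul_eq_zero, inv_eq_zero, hν1, false_or]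

lemma contDiff_one_hasGradientAt {φ : Plane → ℝ} (hφ : ContDiff ℝ 1 φ) (x : Plane) :
    HasGradientAt φ (gradient φ x) x :=
  (hφ.differentiable (by norm_num) x).hasGradientAt

lemma fderiv_apply_eq_inner_gradient (φ : Plane → ℝ) (x v : Plane) :
    fderiv ℝ φ x v = ⟪gradient φ x, v⟫_ℝ := by
  simp [gradient]

lemma continuous_gradient {φ : Plane → ℝ} (hφ : ContDiff ℝ 1 φ) : Continuous (gradient φ) :=
  (InnerProductSpace.toDual ℝ Plane).symm.continuous.comp (hφ.continuous_fderiv (by norm_num))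

lemma tsupport_gradient_subset (φ : Plane → ℝ) : tsupport (gradient φ) ⊆ tsupport φ := by
  refine closure_minimal (fun x hx => ?_) (isClosed_tsupport φ)
  refine tsupport_fderiv_subset ℝ (subset_tsupport _ ?_)
  intro h
  apply hx
  simp [gradient, h]

lemma hasCompactSupport_gradient {φ : Plane → ℝ} (hc : HasCompactSupport φ) :
    HasCompactSupport (gradient φ) :=
  HasCompactSupport.of_support_subset_isCompact hc
    ((subset_tsupport _).trans (tsupport_gradient_subset φ))

/-- The divergence theorem on a half-plane for a constant vector field times a test function. -/
lemma integral_halfPlane_inner_gradient {φ : Plane → ℝ} (hφ : ContDiff ℝ 1 φ)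
    (hc : HasCompactSupport φ) {n : Plane} (hn : ‖n‖ = 1) (c Q : Plane) :
    ∫ x in {x : Plane | ⟪n, x - c⟫_ℝ < 0}, ⟪Q, gradient φ x⟫_ℝ
      = ⟪Q, n⟫_ℝ * ∫ s : ℝ, φ (c + s • rot n) := by
  obtain ⟨e, he, hef⟩ := exists_frame_equiv c hn
  have hpre : e ⁻¹' {x : Plane | ⟪n, x - c⟫_ℝ < 0} = univ ×ˢ Iio 0 := by
    ext p; simp [hef, inner_frame hn]
  rw [← he.setIntegral_preimage_emb e.measurableEmbedding, hpre]
  have hemb : IsClosedEmbedding (frame c n) := by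
    have hinv : Function.LeftInverse (fun x : Plane => (⟪rot n, x - c⟫_ℝ, ⟪n, x - c⟫_ℝ))
        (frame c n) := by
      intro p
      ext
      · simp [frame, inner_add_right, inner_smul_right, norm_rot, hn, real_inner_comm n,
          inner_rot_self]
      · simp [inner_frame hn]
    exact hinv.isClosedEmbedding (by fun_prop) (continuous_frame c n)
  have hG : ∀ v : Plane, Integrable (fun p : ℝ × ℝ => ⟪v, gradient φ (frame c n p)⟫_ℝ) := by
    intro v
    refine Continuous.integrable_of_hasCompactSupport
      (continuous_const.inner ((continuous_gradient hφ).comp (continuous_frame c n))) ?_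
    exact ((hasCompactSupport_gradient hc).comp_isClosedEmbedding hemb).comp_left
      (g := fun w => ⟪v, w⟫_ℝ) (by simp)
  have hds : ∀ s y : ℝ, HasDerivAt (fun s => φ (frame c n (s, y)))
      ⟪rot n, gradient φ (frame c n (s, y))⟫_ℝ s := by
    intro s y
    have h2 : HasDerivAt (fun s : ℝ => frame c n (s, y)) (rot n) s := by
      simpa [frame] using (((hasDerivAt_id s).smul_const (rot n)).add_const (y • n)).const_add c
    have h3 := (contDiff_one_hasGradientAt hφ (frame c n (s, y))).hasFDerivAt.comp_hasDerivAt s h2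
    rw [real_inner_comm]
    exact h3
  have hdy : ∀ s y : ℝ, HasDerivAt (fun y => φ (frame c n (s, y)))
      ⟪n, gradient φ (frame c n (s, y))⟫_ℝ y := by
    intro s y
    have h2 : HasDerivAt (fun y : ℝ => frame c n (s, y)) n y := by
      simpa [frame] using (((hasDerivAt_id y).smul_const n).const_add (s • rot n)).const_add c
    have h3 := (contDiff_one_hasGradientAt hφ (frame c n (s, y))).hasFDerivAt.comp_hasDerivAt y h2
    rw [real_inner_comm]
    exact h3
  have hl : ∀ y : ℝ, IsClosedEmbedding fun s : ℝ => (s, y) := fun y =>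
    Function.LeftInverse.isClosedEmbedding (f := Prod.fst) (fun _ => rfl) continuous_fst
      (by fun_prop)
  have hr : ∀ s : ℝ, IsClosedEmbedding fun y : ℝ => (s, y) := fun s =>
    Function.LeftInverse.isClosedEmbedding (f := Prod.snd) (fun _ => rfl) continuous_snd
      (by fun_prop)
  have hcs : ∀ y : ℝ, HasCompactSupport fun s => φ (frame c n (s, y)) := fun y =>
    (hc.comp_isClosedEmbedding hemb).comp_isClosedEmbedding (hl y)
  have hcy : ∀ s : ℝ, HasCompactSupport fun y => φ (frame c n (s, y)) := fun s =>
    (hc.comp_isClosedEmbedding hemb).comp_isClosedEmbedding (hr s)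
  have hvol : (volume : Measure (ℝ × ℝ)).restrict (univ ×ˢ Iio 0)
      = (volume : Measure ℝ).prod ((volume : Measure ℝ).restrict (Iio 0)) := by
    rw [Measure.volume_eq_prod, ← Measure.prod_restrict, Measure.restrict_univ]
  have hdec : ∀ p : ℝ × ℝ, ⟪Q, gradient φ (e p)⟫_ℝ
      = ⟪Q, rot n⟫_ℝ * ⟪rot n, gradient φ (frame c n p)⟫_ℝ
        + ⟪Q, n⟫_ℝ * ⟪n, gradient φ (frame c n p)⟫_ℝ := by
    intro p
    rw [hef]
    conv_lhs => rw [decomp_rot hn Q]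
    rw [inner_add_left, real_inner_smul_left, real_inner_smul_left]
  simp_rw [hdec]
  rw [integral_add ((hG _).integrableOn.const_mul _) ((hG _).integrableOn.const_mul _),
    integral_const_mul, integral_const_mul]
  have h1 : ∫ p in univ ×ˢ Iio 0, ⟪rot n, gradient φ (frame c n p)⟫_ℝ = 0 := by
    have hi := (hG (rot n)).integrableOn (s := univ ×ˢ Iio 0)
    rw [IntegrableOn, hvol] at hi
    rw [hvol, integral_prod_symm _ hi]
    refine integral_eq_zero_of_ae (Eventually.of_forall fun y => ?_)
    have hcont : Continuous fun s : ℝ => φ (frame c n (s, y)) :=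
      hφ.continuous.comp ((continuous_frame c n).comp (by fun_prop))
    refine integral_eq_zero_of_hasDerivAt_of_integrable (fun s => hds s y) ?_
      (hcont.integrable_of_hasCompactSupport (hcs y))
    refine Continuous.integrable_of_hasCompactSupport (continuous_const.inner
      ((continuous_gradient hφ).comp ((continuous_frame c n).comp (by fun_prop)))) ?_
    exact (((hasCompactSupport_gradient hc).comp_isClosedEmbedding hemb).comp_isClosedEmbedding
      (hl y)).comp_left (g := fun w => ⟪rot n, w⟫_ℝ) (by simp)
  have h2 : ∫ p in univ ×ˢ Iio 0, ⟪n, gradient φ (frame c n p)⟫_ℝ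
      = ∫ s : ℝ, φ (c + s • rot n) := by
    have hi := (hG n).integrableOn (s := univ ×ˢ Iio 0)
    rw [IntegrableOn, hvol] at hi
    rw [hvol, integral_prod _ hi]
    refine integral_congr_ae (Eventually.of_forall fun s => ?_)
    have hcd : ContDiff ℝ 1 fun y : ℝ => φ (frame c n (s, y)) := by
      refine hφ.comp ?_
      unfold frame; fun_prop
    have := (hcy s).integral_Iic_deriv_eq hcd 0
    simp only [← frame_zero]
    rw [← this, integral_Iic_eq_integral_Iio]
    refine integral_congr_ae (Eventually.of_forall fun y => ?_)
    exact ((hdy s y).deriv).symm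
  rw [h1, h2]; ring

/-- The function that equals `u` where `⟪ν, x⟫ + b > 0` and `v` elsewhere. -/
def twoPhase {X : Type*} (ν : Plane) (b : ℝ) (u v : X) (x : Plane) : X :=
  if 0 < ⟪ν, x⟫_ℝ + b then u else v

lemma measurableSet_pos (ν : Plane) (b : ℝ) : MeasurableSet {x : Plane | 0 < ⟪ν, x⟫_ℝ + b} :=
  (isOpen_lt continuous_const (by fun_prop)).measurableSet

lemma measurable_twoPhase {X : Type*} [MeasurableSpace X] (ν : Plane) (b : ℝ) (u v : X) :
    Measurable (twoPhase ν b u v) :=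
  Measurable.ite (measurableSet_pos ν b) measurable_const measurable_const

lemma inner_twoPhase (ν : Plane) (b : ℝ) (Qp Qm w x : Plane) :
    ⟪twoPhase ν b Qp Qm x, w⟫_ℝ
      = ⟪Qm, w⟫_ℝ + twoPhase ν b 1 0 x * ⟪Qp - Qm, w⟫_ℝ := by
  unfold twoPhase; split_ifs <;> simp [inner_sub_left]

lemma tendsto_smoothTransition (ν : Plane) (b : ℝ) (x : Plane) :
    Tendsto (fun k : ℕ => Real.smoothTransition (k * (⟪ν, x⟫_ℝ + b))) atTop
      (𝓝 (twoPhase ν b 1 0 x)) := by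
  unfold twoPhase
  split_ifs with h
  · refine tendsto_const_nhds.congr' ?_
    obtain ⟨N, hN⟩ := exists_nat_gt (1 / (⟪ν, x⟫_ℝ + b))
    filter_upwards [eventually_ge_atTop N] with k hk
    refine (Real.smoothTransition.one_of_one_le ?_).symm
    rw [div_lt_iff₀ h] at hN
    have : (N : ℝ) ≤ k := by exact_mod_cast hk
    nlinarith
  · refine tendsto_const_nhds.congr fun k => ?_
    refine (Real.smoothTransition.zero_of_nonpos ?_).symm
    exact mul_nonpos_of_nonneg_of_nonpos (Nat.cast_nonneg _) (not_lt.1 h)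

/-- The divergence theorem on a half-plane for a piecewise constant field with continuous
normal component across the phase boundary. -/
lemma integral_halfPlane_twoPhase {φ : Plane → ℝ} (hφ : ContDiff ℝ 1 φ)
    (hc : HasCompactSupport φ) {n : Plane} (hn : ‖n‖ = 1) (c : Plane) {ν : Plane} {b : ℝ}
    {Qp Qm : Plane} (hQ : ⟪Qp - Qm, ν⟫_ℝ = 0) :
    ∫ x in {x : Plane | ⟪n, x - c⟫_ℝ < 0}, ⟪twoPhase ν b Qp Qm x, gradient φ x⟫_ℝ
      = ⟪Qm, n⟫_ℝ * (∫ s : ℝ, φ (c + s • rot n)) + ⟪Qp - Qm, n⟫_ℝ *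
        ∫ s : ℝ, twoPhase ν b 1 0 (c + s • rot n) * φ (c + s • rot n) := by
  set D := Qp - Qm with hD
  set H := {x : Plane | ⟪n, x - c⟫_ℝ < 0}
  have hint : ∀ v : Plane, Integrable (fun x => ⟪v, gradient φ x⟫_ℝ) := fun v =>
    (continuous_const.inner (continuous_gradient hφ)).integrable_of_hasCompactSupport
      ((hasCompactSupport_gradient hc).comp_left (g := fun w => ⟪v, w⟫_ℝ) (by simp))
  have hlc : IsClosedEmbedding fun s : ℝ => c + s • rot n := (isometry_line c hn).isClosedEmbedding
  have hlint : Integrable fun s : ℝ => φ (c + s • rot n) :=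
    (hφ.continuous.comp hlc.continuous).integrable_of_hasCompactSupport
      (hc.comp_isClosedEmbedding hlc)
  let θ : ℕ → Plane → ℝ := fun k x => Real.smoothTransition (k * (⟪ν, x⟫_ℝ + b))
  have hθ : ∀ k, ContDiff ℝ 1 (θ k) := fun k => by
    exact Real.smoothTransition.contDiff.comp
      (contDiff_const.mul ((contDiff_const.inner ℝ contDiff_id).add contDiff_const))
  have hθ1 : ∀ k x, ‖θ k x‖ ≤ 1 := fun k x => by
    rw [Real.norm_of_nonneg (Real.smoothTransition.nonneg _)]
    exact Real.smoothTransition.le_one _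
  have hgrad : ∀ k x, ⟪D, gradient (φ * θ k) x⟫_ℝ = θ k x * ⟪D, gradient φ x⟫_ℝ := by
    intro k x
    have h1 := hφ.differentiable (by norm_num) x
    have h2 := (hθ k).differentiable (by norm_num) x
    rw [real_inner_comm, ← fderiv_apply_eq_inner_gradient, fderiv_mul h1 h2]
    have h3 : fderiv ℝ (θ k) x D = 0 := by
      rw [← h2.lineDeriv_eq_fderiv, lineDeriv]
      have : (fun t : ℝ => θ k (x + t • D)) = fun _ => θ k x := by
        funext t
        simp only [θ, inner_add_right, real_inner_smul_right, real_inner_comm D ν, hQ, mul_zero,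
          add_zero]
      rw [this, deriv_const]
    simp [h3]
  have hk : ∀ k, ∫ x in H, θ k x * ⟪D, gradient φ x⟫_ℝ
      = ⟪D, n⟫_ℝ * ∫ s : ℝ, θ k (c + s • rot n) * φ (c + s • rot n) := by
    intro k
    have := integral_halfPlane_inner_gradient (hφ.mul (hθ k)) (hc.mul_right) hn c D
    rw [show (fun x => φ x * θ k x) = φ * θ k from rfl] at this
    simp only [hgrad] at this
    rw [this]
    congr 2; funext s; simp [mul_comm]
  have hlim1 : Tendsto (fun k => ∫ x in H, θ k x * ⟪D, gradient φ x⟫_ℝ) atTop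
      (𝓝 (∫ x in H, twoPhase ν b 1 0 x * ⟪D, gradient φ x⟫_ℝ)) := by
    refine tendsto_integral_of_dominated_convergence (fun x => ‖⟪D, gradient φ x⟫_ℝ‖)
      (fun k => ((hθ k).continuous.mul (continuous_const.inner
        (continuous_gradient hφ))).aestronglyMeasurable) (hint D).norm.integrableOn
      (fun k => Eventually.of_forall fun x => ?_)
      (Eventually.of_forall fun x => (tendsto_smoothTransition ν b x).mul_const _)
    rw [norm_mul]
    exact mul_le_of_le_one_left (norm_nonneg _) (hθ1 k x)
  have hlim2 : Tendsto (fun k => ∫ s : ℝ, θ k (c + s • rot n) * φ (c + s • rot n)) atTop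
      (𝓝 (∫ s : ℝ, twoPhase ν b 1 0 (c + s • rot n) * φ (c + s • rot n))) := by
    refine tendsto_integral_of_dominated_convergence (fun s => ‖φ (c + s • rot n)‖)
      (fun k => (((hθ k).continuous.comp hlc.continuous).mul
        (hφ.continuous.comp hlc.continuous)).aestronglyMeasurable) hlint.norm
      (fun k => Eventually.of_forall fun s => ?_)
      (Eventually.of_forall fun s => (tendsto_smoothTransition ν b _).mul_const _)
    rw [norm_mul]
    exact mul_le_of_le_one_left (norm_nonneg _) (hθ1 k _)
  have heq := tendsto_nhds_unique hlim1 ((hlim2.const_mul ⟪D, n⟫_ℝ).congr fun k => (hk k).symm)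
  simp_rw [inner_twoPhase]
  rw [integral_add (hint Qm).integrableOn, integral_halfPlane_inner_gradient hφ hc hn, heq]
  refine Integrable.mono (hint D).integrableOn
    (((measurable_twoPhase ν b 1 0).aestronglyMeasurable).mul
      (hint D).integrableOn.aestronglyMeasurable) (Eventually.of_forall fun x => ?_)
  rw [norm_mul]
  refine mul_le_of_le_one_left (norm_nonneg _) ?_
  unfold twoPhase; split_ifs <;> simp

/-- If the test function lives in one phase on the line, only that phase contributes. -/
lemma integral_halfPlane_twoPhase_pos {φ : Plane → ℝ} (hφ : ContDiff ℝ 1 φ)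
    (hc : HasCompactSupport φ) {n : Plane} (hn : ‖n‖ = 1) (c : Plane) {ν : Plane} {b : ℝ}
    {Qp Qm : Plane} (hQ : ⟪Qp - Qm, ν⟫_ℝ = 0)
    (hs : ∀ s : ℝ, φ (c + s • rot n) ≠ 0 → 0 < ⟪ν, c + s • rot n⟫_ℝ + b) :
    ∫ x in {x : Plane | ⟪n, x - c⟫_ℝ < 0}, ⟪twoPhase ν b Qp Qm x, gradient φ x⟫_ℝ
      = ⟪Qp, n⟫_ℝ * ∫ s : ℝ, φ (c + s • rot n) := by
  rw [integral_halfPlane_twoPhase hφ hc hn c hQ]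
  have : ∀ s : ℝ, twoPhase ν b 1 0 (c + s • rot n) * φ (c + s • rot n) = φ (c + s • rot n) := by
    intro s
    by_cases h : φ (c + s • rot n) = 0
    · simp [h]
    · rw [twoPhase, if_pos (hs s h), one_mul]
  simp_rw [this, inner_sub_left]; ring

lemma integral_halfPlane_twoPhase_neg {φ : Plane → ℝ} (hφ : ContDiff ℝ 1 φ)
    (hc : HasCompactSupport φ) {n : Plane} (hn : ‖n‖ = 1) (c : Plane) {ν : Plane} {b : ℝ}
    {Qp Qm : Plane} (hQ : ⟪Qp - Qm, ν⟫_ℝ = 0)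
    (hs : ∀ s : ℝ, φ (c + s • rot n) ≠ 0 → ⟪ν, c + s • rot n⟫_ℝ + b < 0) :
    ∫ x in {x : Plane | ⟪n, x - c⟫_ℝ < 0}, ⟪twoPhase ν b Qp Qm x, gradient φ x⟫_ℝ
      = ⟪Qm, n⟫_ℝ * ∫ s : ℝ, φ (c + s • rot n) := by
  rw [integral_halfPlane_twoPhase hφ hc hn c hQ]
  have : ∀ s : ℝ, twoPhase ν b 1 0 (c + s • rot n) * φ (c + s • rot n) = 0 := by
    intro s
    by_cases h : φ (c + s • rot n) = 0
    · simp [h]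
    · rw [twoPhase, if_neg (hs s h).not_gt, zero_mul]
  simp_rw [this]; simp

/-- A two-phase field is divergence free in the whole plane. -/
lemma integral_twoPhase_inner_gradient {φ : Plane → ℝ} (hφ : ContDiff ℝ 1 φ)
    (hc : HasCompactSupport φ) {ν : Plane} {b : ℝ}
    {Qp Qm : Plane} (hQ : ⟪Qp - Qm, ν⟫_ℝ = 0) :
    ∫ x, ⟪twoPhase ν b Qp Qm x, gradient φ x⟫_ℝ = 0 := by
  obtain ⟨R, hR⟩ := hc.isBounded.subset_ball 0
  let n : Plane := !₂[1, 0]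
  have hn : ‖n‖ = 1 := by
    have : ‖n‖ ^ 2 = 1 := by rw [norm_sq_plane]; simp [n]
    nlinarith [norm_nonneg n]
  have hz : ∀ x : Plane, R ≤ ⟪n, x⟫_ℝ → x ∉ tsupport φ := by
    intro x hx hx'
    have h1 := mem_ball_zero_iff.1 (hR hx')
    have h2 := real_inner_le_norm n x
    rw [hn] at h2; linarith
  have h := integral_halfPlane_twoPhase_pos (b := b) hφ hc hn (R • n) hQ (fun s hs => by
    refine absurd (subset_tsupport _ hs) (hz _ ?_)
    rw [inner_add_right, real_inner_smul_right, real_inner_smul_right, inner_rot_self,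
      real_inner_self_eq_norm_sq, hn]
    simp)
  rw [setIntegral_eq_integral_of_forall_compl_eq_zero] at h
  · rw [h]
    have : ∀ s : ℝ, φ (R • n + s • rot n) = 0 := fun s =>
      image_eq_zero_of_notMem_tsupport (hz _ (by
        rw [inner_add_right, real_inner_smul_right, real_inner_smul_right, inner_rot_self,
          real_inner_self_eq_norm_sq, hn]
        simp))
    simp [this]
  · intro x hx
    have : x ∉ tsupport φ := hz x (by
      simp only [mem_ofPred_eq, not_lt, inner_sub_right, real_inner_smul_right,
        real_inner_self_eq_norm_sq, hn] at hx
      linarith)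
    rw [image_eq_zero_of_notMem_tsupport fun h => this (tsupport_gradient_subset φ h),
      inner_zero_right]

/-! ### Bump functions with scaled gradient bounds -/

/-- `φ` is a smooth bump on the disc of centre `c` and radius `r` with gradient bound `A / r`. -/
structure IsBump (A : ℝ) (c : Plane) (r : ℝ) (φ : Plane → ℝ) : Prop where
  contDiff : ContDiff ℝ ∞ φ
  tsupport_subset : tsupport φ ⊆ Metric.closedBall c r
  nonneg : ∀ x, 0 ≤ φ x
  le_one : ∀ x, φ x ≤ 1
  one : ∀ x ∈ Metric.closedBall c (r / 2), φ x = 1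
  norm_gradient_le : ∀ x, ‖gradient φ x‖ ≤ A / r

lemma exists_bump : ∃ A : ℝ, 0 < A ∧ ∀ (c : Plane) (r : ℝ), 0 < r → ∃ φ, IsBump A c r φ := by
  let f : ContDiffBump (0 : Plane) := ⟨1 / 2, 1, by norm_num, by norm_num⟩
  have hf : ContDiff ℝ ∞ f := f.contDiff
  have hcont := hf.continuous_fderiv (by simp)
  obtain ⟨C, hC⟩ := hcont.bounded_above_of_compact_support (f.hasCompactSupport.fderiv ℝ)
  refine ⟨max C 1, by positivity, fun c r hr => ⟨fun x => f (r⁻¹ • (x - c)), ?_, ?_, ?_, ?_, ?_, ?_⟩⟩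
  · exact hf.comp (by fun_prop)
  · refine closure_minimal (fun x hx => ?_) Metric.isClosed_closedBall
    have : r⁻¹ • (x - c) ∈ Function.support f := hx
    rw [f.support_eq, mem_ball_zero_iff, norm_smul, norm_inv, Real.norm_of_nonneg hr.le] at this
    rw [mem_closedBall_iff_norm]
    have h2 : r⁻¹ * ‖x - c‖ < 1 := this
    rw [inv_mul_lt_iff₀ hr] at h2
    linarith
  · exact fun x => f.nonneg
  · exact fun x => f.le_one
  · intro x hx
    refine f.one_of_mem_closedBall ?_
    rw [mem_closedBall_iff_norm] at hx
    rw [mem_closedBall_zero_iff, norm_smul, norm_inv, Real.norm_of_nonneg hr.le,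
      inv_mul_le_iff₀ hr]
    show ‖x - c‖ ≤ r * (1 / 2)
    linarith
  · intro x
    have h1 : HasFDerivAt (fun x : Plane => r⁻¹ • (x - c)) (r⁻¹ • ContinuousLinearMap.id ℝ Plane) x :=
      ((hasFDerivAt_id x).sub_const c).const_smul r⁻¹
    have h2 := ((hf.differentiable (by simp) (r⁻¹ • (x - c))).hasFDerivAt).comp x h1
    rw [gradient, LinearIsometryEquiv.norm_map]
    have h3 : fderiv ℝ (fun x => f (r⁻¹ • (x - c))) x = r⁻¹ • fderiv ℝ f (r⁻¹ • (x - c)) := by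
      rw [show (fun x => f (r⁻¹ • (x - c))) = f ∘ fun x : Plane => r⁻¹ • (x - c) from rfl, h2.fderiv]
      ext v; simp
    rw [h3, norm_smul, norm_inv, Real.norm_of_nonneg hr.le, inv_mul_eq_div]
    gcongr
    exact (hC _).trans (le_max_left _ _)

namespace IsBump

variable {A : ℝ} {c : Plane} {r : ℝ} {φ : Plane → ℝ}

lemma hasCompactSupport (h : IsBump A c r φ) : HasCompactSupport φ :=
  (isCompact_closedBall c r).of_isClosed_subset (isClosed_tsupport φ) h.tsupport_subset

lemma contDiff_one (h : IsBump A c r φ) : ContDiff ℝ 1 φ := h.contDiff.of_le (by simp)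

lemma eq_zero (h : IsBump A c r φ) {x : Plane} (hx : x ∉ Metric.closedBall c r) : φ x = 0 :=
  image_eq_zero_of_notMem_tsupport fun hx' => hx (h.tsupport_subset hx')

lemma gradient_eq_zero (h : IsBump A c r φ) {x : Plane} (hx : x ∉ Metric.closedBall c r) :
    gradient φ x = 0 :=
  image_eq_zero_of_notMem_tsupport fun hx' =>
    hx (h.tsupport_subset (tsupport_gradient_subset φ hx'))

lemma le_integral_line (h : IsBump A c r φ) (hr : 0 < r) {n : Plane} (hn : ‖n‖ = 1) :
    r ≤ ∫ s : ℝ, φ (c + s • rot n) := by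
  have hlc : IsClosedEmbedding fun s : ℝ => c + s • rot n := (isometry_line c hn).isClosedEmbedding
  have hint : Integrable fun s : ℝ => φ (c + s • rot n) :=
    (h.contDiff.continuous.comp hlc.continuous).integrable_of_hasCompactSupport
      (h.hasCompactSupport.comp_isClosedEmbedding hlc)
  have h1 : ∫ s in Icc (-(r / 2)) (r / 2), φ (c + s • rot n) = r := by
    have : ∀ s ∈ Icc (-(r / 2)) (r / 2), φ (c + s • rot n) = 1 := fun s hs => by
      refine h.one _ ?_
      rw [mem_closedBall_iff_norm, add_sub_cancel_left, norm_smul, norm_rot, hn, mul_one,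
        Real.norm_eq_abs, abs_le]
      exact hs
    rw [setIntegral_congr_fun measurableSet_Icc this]
    simp only [integral_const, MeasurableSet.univ, measureReal_restrict_apply, univ_inter,
      Real.volume_real_Icc, smul_eq_mul, mul_one]
    rw [max_eq_left (by linarith)]; ring
  calc r = _ := h1.symm
    _ ≤ _ := setIntegral_le_integral hint (Eventually.of_forall fun s => h.nonneg _)

end IsBump

/-! ### `L²` estimates -/

lemma integral_mul_le_sqrt_mul_sqrt {X : Type*} [MeasurableSpace X] {μ : Measure X} {f g : X → ℝ}
    (hf : MemLp f 2 μ) (hg : MemLp g 2 μ) (hf0 : ∀ x, 0 ≤ f x) (hg0 : ∀ x, 0 ≤ g x) :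
    ∫ x, f x * g x ∂μ ≤ √(∫ x, f x ^ 2 ∂μ) * √(∫ x, g x ^ 2 ∂μ) := by
  have h := integral_mul_le_Lp_mul_Lq_of_nonneg (p := 2) (q := 2) (μ := μ) (f := f) (g := g)
    Real.HolderConjugate.two_two (Eventually.of_forall hf0) (Eventually.of_forall hg0)
    (by simpa using hf) (by simpa using hg)
  simpa [Real.sqrt_eq_rpow] using h

lemma volume_closedBall_le (c : Plane) {r : ℝ} (hr : 0 ≤ r) :
    (volume (Metric.closedBall c r)).toReal ≤ 4 * r ^ 2 := by
  rw [EuclideanSpace.volume_closedBall_fin_two]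
  simp only [ENNReal.toReal_mul, ENNReal.toReal_pow, ENNReal.toReal_ofReal hr,
    ENNReal.toReal_ofReal Real.pi_pos.le]
  nlinarith [Real.pi_le_four, sq_nonneg r]

lemma le_volume_closedBall (c : Plane) {r : ℝ} (hr : 0 ≤ r) :
    r ^ 2 ≤ (volume (Metric.closedBall c r)).toReal := by
  rw [EuclideanSpace.volume_closedBall_fin_two]
  simp only [ENNReal.toReal_mul, ENNReal.toReal_pow, ENNReal.toReal_ofReal hr,
    ENNReal.toReal_ofReal Real.pi_pos.le]
  nlinarith [Real.pi_gt_three, sq_nonneg r]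

/-- Cauchy-Schwarz for an integrand supported in a disc. -/
lemma abs_setIntegral_le_of_supported {E : Type*} [NormedAddCommGroup E] {s : Set Plane}
    {w : Plane → E} (hw : MemLp w 2 (volume.restrict s)) {F : Plane → ℝ}
    {B : ℝ} (hB : 0 ≤ B) (hF : ∀ x, |F x| ≤ B * ‖w x‖) {c : Plane} {r : ℝ} (hr : 0 ≤ r)
    (h0 : ∀ x ∉ Metric.closedBall c r, F x = 0) :
    |∫ x in s, F x| ≤ 2 * r * B * √(∫ x in s, ‖w x‖ ^ 2) := by
  set D := Metric.closedBall c r with hD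
  have hDm : MeasurableSet D := Metric.isClosed_closedBall.measurableSet
  have hfin : volume D ≠ ⊤ := (isCompact_closedBall c r).measure_lt_top.ne
  have hind : MemLp (D.indicator fun _ => (1 : ℝ)) 2 (volume.restrict s) :=
    memLp_indicator_const 2 hDm 1 (Or.inr ((Measure.restrict_apply_le _ _).trans_lt
      hfin.lt_top).ne)
  have h1 : |∫ x in s, F x| ≤ ∫ x in s, B * (D.indicator (fun _ => (1 : ℝ)) x * ‖w x‖) := by
    rw [← Real.norm_eq_abs]
    refine norm_integral_le_of_norm_le ((hind.integrable_mul hw.norm).const_mul B)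
      (Eventually.of_forall fun x => ?_)
    by_cases hx : x ∈ D
    · simpa [hx] using hF x
    · simp [hx, h0 x hx]
  have h2 := integral_mul_le_sqrt_mul_sqrt hind hw.norm
    (fun x => indicator_nonneg (fun _ _ => zero_le_one) x) (fun x => norm_nonneg _)
  have h3 : √(∫ x in s, (D.indicator (fun _ => (1 : ℝ)) x) ^ 2) ≤ 2 * r := by
    rw [Real.sqrt_le_left (by positivity)]
    have : ∀ x, (D.indicator (fun _ => (1 : ℝ)) x) ^ 2 = D.indicator (fun _ => (1 : ℝ)) x := by
      intro x; by_cases hx : x ∈ D <;> simp [hx]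
    simp_rw [this]
    rw [integral_indicator_const _ hDm, smul_eq_mul, mul_one, measureReal_restrict_apply hDm]
    calc (volume (D ∩ s)).toReal ≤ (volume D).toReal :=
          ENNReal.toReal_mono hfin (measure_mono inter_subset_left)
      _ ≤ 4 * r ^ 2 := volume_closedBall_le c hr
      _ = (2 * r) ^ 2 := by ring
  rw [integral_const_mul] at h1
  calc _ ≤ _ := h1
    _ ≤ B * (2 * r * √(∫ x in s, ‖w x‖ ^ 2)) := by gcongr; exact h2.trans (by gcongr)
    _ = _ := by ring

lemma sqrt_integral_norm_add_sq_le {X E : Type*} [MeasurableSpace X] [NormedAddCommGroup E]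
    {μ : Measure X} {u v w : X → E} (hu : MemLp u 2 μ) (hv : MemLp v 2 μ) (hw : ∀ᵐ x ∂μ, ‖w x‖ ≤ ‖u x‖ + ‖v x‖) :
    √(∫ x, ‖w x‖ ^ 2 ∂μ) ≤ 2 * (√(∫ x, ‖u x‖ ^ 2 ∂μ) + √(∫ x, ‖v x‖ ^ 2 ∂μ)) := by
  have hu2 : Integrable (fun x => ‖u x‖ ^ 2) μ := hu.integrable_norm_pow (by norm_num)
  have hv2 : Integrable (fun x => ‖v x‖ ^ 2) μ := hv.integrable_norm_pow (by norm_num)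
  have h1 : ∫ x, ‖w x‖ ^ 2 ∂μ ≤ ∫ x, (2 * ‖u x‖ ^ 2 + 2 * ‖v x‖ ^ 2) ∂μ := by
    refine integral_mono_of_nonneg (Eventually.of_forall fun x => by positivity)
      ((hu2.const_mul 2).add (hv2.const_mul 2)) ?_
    filter_upwards [hw] with x hx
    nlinarith [sq_nonneg (‖u x‖ - ‖v x‖), norm_nonneg (w x), norm_nonneg (u x), norm_nonneg (v x)]
  rw [integral_add (hu2.const_mul 2) (hv2.const_mul 2), integral_const_mul, integral_const_mul]
    at h1
  have ha : 0 ≤ ∫ x, ‖u x‖ ^ 2 ∂μ := integral_nonneg fun x => by positivity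
  have hb : 0 ≤ ∫ x, ‖v x‖ ^ 2 ∂μ := integral_nonneg fun x => by positivity
  rw [Real.sqrt_le_left (by positivity)]
  nlinarith [Real.sq_sqrt ha, Real.sq_sqrt hb, Real.sqrt_nonneg (∫ x, ‖u x‖ ^ 2 ∂μ),
    Real.sqrt_nonneg (∫ x, ‖v x‖ ^ 2 ∂μ), mul_nonneg (Real.sqrt_nonneg (∫ x, ‖u x‖ ^ 2 ∂μ))
      (Real.sqrt_nonneg (∫ x, ‖v x‖ ^ 2 ∂μ))]

lemma setIntegral_hausdorff_eq_integral_line {φ : Plane → ℝ} {n : Plane} (hn : ‖n‖ = 1)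
    (c : Plane) {s : Set Plane} (hsl : ∀ x ∈ s, ⟪n, x - c⟫_ℝ = 0)
    (h0 : ∀ t : ℝ, c + t • rot n ∉ s → φ (c + t • rot n) = 0) :
    ∫ x in s, φ x ∂μH[1] = ∫ t : ℝ, φ (c + t • rot n) := by
  have hi := isometry_line c hn
  have hm := hi.map_hausdorffMeasure (d := 1) (Or.inl zero_le_one)
  rw [hausdorffMeasure_real] at hm
  have hsub : s ⊆ range fun t : ℝ => c + t • rot n := by
    intro x hx
    refine ⟨⟪x - c, rot n⟫_ℝ, ?_⟩
    have := decomp_rot hn (x - c)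
    rw [real_inner_comm n, hsl x hx, zero_smul, add_zero] at this
    simp only [← this]; abel
  have h1 : ∫ x in range fun t : ℝ => c + t • rot n, φ x ∂μH[1] = ∫ t : ℝ, φ (c + t • rot n) := by
    rw [← hm, hi.isClosedEmbedding.measurableEmbedding.integral_map]
  rw [← h1]
  refine (setIntegral_eq_of_subset_of_forall_sdiff_eq_zero
    hi.isClosedEmbedding.isClosed_range.measurableSet hsub ?_).symm
  rintro x ⟨⟨t, rfl⟩, hx⟩
  exact h0 t hx

/-! ### Triangles -/

/-- `lam z` is the barycentric coordinate of the triangle `K` that belongs to the vertex `z`. -/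
structure IsBary (K : Finset Plane) (lam : Plane → Plane →ᵃ[ℝ] ℝ) : Prop where
  self : ∀ z ∈ K, lam z z = 1
  ne : ∀ z ∈ K, ∀ w ∈ K, z ≠ w → lam z w = 0
  sum_eq_one : ∀ x, ∑ z ∈ K, lam z x = 1
  comb : ∀ x, ∑ z ∈ K, lam z x • z = x
  mem_hull_iff : ∀ x, x ∈ hull K ↔ ∀ z ∈ K, 0 ≤ lam z x
  mem_interior_iff : ∀ x, x ∈ interior (hull K) ↔ ∀ z ∈ K, 0 < lam z x

lemma exists_isBary {K : Finset Plane} (hK : K.card = 3)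
    (hi : AffineIndependent ℝ (fun z : K => (z : Plane))) : ∃ lam, IsBary K lam := by
  have htop : affineSpan ℝ (range fun z : K => (z : Plane)) = ⊤ := by
    rw [hi.affineSpan_eq_top_iff_card_eq_finrank_add_one]
    simp [hK]
  let b : AffineBasis K ℝ Plane := ⟨fun z : K => (z : Plane), hi, htop⟩
  have hr : range b = (K : Set Plane) := Subtype.range_coe
  have hbe : ∀ z : K, b z = z := fun z => rfl
  let lam : Plane → Plane →ᵃ[ℝ] ℝ := fun z => if h : z ∈ K then b.coord ⟨z, h⟩ else 0
  have hlam : ∀ z (h : z ∈ K), lam z = b.coord ⟨z, h⟩ := fun z h => dif_pos h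
  have hlam' : ∀ z : K, lam z = b.coord z := fun z => hlam z z.2
  refine ⟨lam, ⟨fun z hz => ?_, fun z hz w hw hzw => ?_, fun x => ?_, fun x => ?_, fun x => ?_,
    fun x => ?_⟩⟩
  · rw [hlam z hz]; exact b.coord_apply_eq ⟨z, hz⟩
  · rw [hlam z hz]
    exact b.coord_apply_ne (i := ⟨z, hz⟩) (j := ⟨w, hw⟩) (by simpa using hzw)
  · rw [← Finset.sum_coe_sort]
    simp_rw [hlam']
    exact b.sum_coord_apply_eq_one x
  · rw [← Finset.sum_coe_sort]
    simp_rw [hlam']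
    exact b.linear_combination_coord_eq_self x
  · rw [hull, ← hr, b.convexHull_eq_nonneg_coord]
    simp only [mem_ofPred_eq]
    exact ⟨fun h z hz => by rw [hlam z hz]; exact h _, fun h z => by rw [← hlam']; exact h z z.2⟩
  · rw [hull, ← hr, b.interior_convexHull]
    simp only [mem_ofPred_eq]
    exact ⟨fun h z hz => by rw [hlam z hz]; exact h _, fun h z => by rw [← hlam']; exact h z z.2⟩

lemma isCompact_hull (s : Finset Plane) : IsCompact (hull s) :=
  s.finite_toSet.isCompact_convexHull ℝ

lemma isClosed_hull (s : Finset Plane) : IsClosed (hull s) := (isCompact_hull s).isClosed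

lemma convex_hull (s : Finset Plane) : Convex ℝ (hull s) := convex_convexHull ℝ _

lemma subset_hull {s : Finset Plane} {z : Plane} (hz : z ∈ s) : z ∈ hull s :=
  subset_convexHull ℝ _ hz

lemma hull_mono {s t : Finset Plane} (h : s ⊆ t) : hull s ⊆ hull t :=
  convexHull_mono (by exact_mod_cast h)

lemma affine_combo {f : Plane →ᵃ[ℝ] ℝ} (x y : Plane) (a b : ℝ) (h : a + b = 1) :
    f (a • x + b • y) = a * f x + b * f y := by
  have := Convex.combo_affine_apply (f := f) (x := x) (y := y) h
  simpa using this

lemma affine_continuous (f : Plane →ᵃ[ℝ] ℝ) : Continuous f := f.continuous_of_finiteDimensional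

namespace IsBary

variable {K : Finset Plane} {lam : Plane → Plane →ᵃ[ℝ] ℝ}

lemma mem_hull_subset_iff (h : IsBary K lam) {F : Finset Plane} (hF : F ⊆ K) (x : Plane) :
    x ∈ hull F ↔ x ∈ hull K ∧ ∀ z ∈ K, z ∉ F → lam z x = 0 := by
  constructor
  · intro hx
    refine ⟨hull_mono hF hx, fun z hz hzF => ?_⟩
    have hc : Convex ℝ {y | lam z y = 0} := by
      intro y hy w hw a b _ _ hab
      simp only [mem_ofPred_eq] at hy hw ⊢
      rw [affine_combo _ _ _ _ hab, hy, hw]; simp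
    refine convexHull_min ?_ hc hx
    intro w hw
    exact h.ne z hz w (hF hw) (by rintro rfl; exact hzF hw)
  · rintro ⟨hx, h0⟩
    have hs := h.comb x
    have h1 := h.sum_eq_one x
    rw [← Finset.sum_subset hF (fun z hz hzF => by rw [h0 z hz hzF])] at h1
    rw [← Finset.sum_subset hF (fun z hz hzF => by rw [h0 z hz hzF, zero_smul])] at hs
    rw [← hs]
    exact (convex_hull F).sum_mem (fun z hz => (h.mem_hull_iff x).1 hx z (hF hz)) h1
      fun z hz => subset_hull hz

lemma mem_frontier_iff (h : IsBary K lam) (x : Plane) :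
    x ∈ frontier (hull K) ↔ x ∈ hull K ∧ ∃ z ∈ K, lam z x = 0 := by
  rw [(isClosed_hull K).frontier_eq, Set.mem_sdiff, h.mem_interior_iff]
  constructor
  · rintro ⟨h1, h2⟩
    push Not at h2
    obtain ⟨z, hz, hz'⟩ := h2
    exact ⟨h1, z, hz, le_antisymm hz' ((h.mem_hull_iff x).1 h1 z hz)⟩
  · rintro ⟨h1, z, hz, hz'⟩
    exact ⟨h1, fun h2 => (h2 z hz).ne' hz'⟩

lemma le_one (h : IsBary K lam) {x z : Plane} (hx : x ∈ hull K) (hz : z ∈ K) : lam z x ≤ 1 := by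
  rw [← h.sum_eq_one x]
  exact Finset.single_le_sum (f := fun z => lam z x)
    (fun w hw => (h.mem_hull_iff x).1 hx w hw) hz

lemma isPreconnected_interior (K : Finset Plane) : IsPreconnected (interior (hull K)) :=
  (convex_hull K).interior.isPreconnected

lemma hull_subset_closure_interior (h : IsBary K lam) (hne : K.Nonempty) :
    hull K ⊆ closure (interior (hull K)) := by
  have hint : (interior (hull K)).Nonempty := by
    refine ⟨∑ z ∈ K, (K.card : ℝ)⁻¹ • z, (h.mem_interior_iff _).2 fun z hz => ?_⟩
    have hc : (0 : ℝ) < K.card := by exact_mod_cast hne.card_pos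
    have h1 : ∑ z ∈ K, (K.card : ℝ)⁻¹ = 1 := by
      rw [Finset.sum_const, nsmul_eq_mul, mul_inv_cancel₀ hc.ne']
    have h2 := Finset.map_affineCombination K (id : Plane → Plane) (fun _ => (K.card : ℝ)⁻¹) h1
      (lam z)
    rw [Finset.affineCombination_eq_linear_combination _ _ _ h1,
      Finset.affineCombination_eq_linear_combination _ _ _ h1] at h2
    simp only [id, Function.comp] at h2
    rw [h2, Finset.sum_eq_single z (fun w hw hwz => by simp [h.ne z hz w hw hwz.symm])
      (fun hz' => absurd hz hz'), h.self z hz]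
    simpa using hc
  rw [(convex_hull K).closure_interior_eq_closure_of_nonempty_interior hint]
  exact subset_closure

/-- A barycentric coordinate is Lipschitz, with a constant given by the radius of a disc inside
the triangle. -/
lemma abs_sub_le (h : IsBary K lam) {c : Plane} {R : ℝ} (hR : 0 < R)
    (hb : Metric.closedBall c R ⊆ hull K) {z : Plane} (hz : z ∈ K) (x y : Plane) :
    |lam z x - lam z y| ≤ ‖x - y‖ / (2 * R) := by
  by_cases hxy : x = y
  · simp [hxy]
  have hd : 0 < ‖x - y‖ := norm_pos_iff.2 (sub_ne_zero.2 hxy)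
  set w : Plane := (R / ‖x - y‖) • (x - y) with hw
  have hwn : ‖w‖ = R := by
    rw [hw, norm_smul, Real.norm_of_nonneg (by positivity)]; field_simp
  have hlin : ∀ u v : Plane, lam z (u + v) = lam z u + (lam z).linear v := by
    intro u v
    have := (lam z).map_vadd u v
    simp only [vadd_eq_add] at this
    rw [add_comm u v, this, add_comm]
  have h1 : c + w ∈ hull K := hb (by simp [hwn])
  have h2 : c - w ∈ hull K := hb (by simp [hwn])
  have e1 : lam z (c + w) = lam z c + R / ‖x - y‖ * (lam z x - lam z y) := by
    rw [hlin, hw, map_smul, smul_eq_mul]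
    congr 2
    have := hlin y (x - y)
    rw [add_sub_cancel] at this; linarith
  have e2 : lam z (c - w) = lam z c - R / ‖x - y‖ * (lam z x - lam z y) := by
    rw [sub_eq_add_neg, hlin, map_neg, hw, map_smul, smul_eq_mul, ← sub_eq_add_neg]
    congr 2
    have := hlin y (x - y)
    rw [add_sub_cancel] at this; linarith
  have a1 := h.le_one h1 hz
  have a2 := h.le_one h2 hz
  have b1 := (h.mem_hull_iff _).1 h1 z hz
  have b2 := (h.mem_hull_iff _).1 h2 z hz
  rw [e1] at a1 b1
  rw [e2] at a2 b2
  have key : |R / ‖x - y‖ * (lam z x - lam z y)| ≤ 1 / 2 := by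
    rw [abs_le]; constructor <;> linarith
  rw [abs_mul, abs_of_pos (by positivity), div_mul_eq_mul_div, div_le_iff₀ hd] at key
  rw [le_div_iff₀ (by positivity)]
  linarith

/-- The coordinate of the vertex `c` as a signed distance from the edge through `a` and `b`. -/
lemma inner_sub_eq {a b c : Plane} (h : IsBary {a, b, c} lam) (hab : a ≠ b) (hac : a ≠ c)
    (hbc : b ≠ c) {n : Plane} (hn : ⟪n, b - a⟫_ℝ = 0) (x : Plane) :
    ⟪n, x - a⟫_ℝ = lam c x * ⟪n, c - a⟫_ℝ := by
  have h1 := h.sum_eq_one x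
  have h2 := h.comb x
  rw [Finset.sum_insert (by simp [hab, hac]), Finset.sum_insert (by simp [hbc]),
    Finset.sum_singleton] at h1 h2
  have : x - a = lam b x • (b - a) + lam c x • (c - a) := by
    conv_lhs => rw [← h2]
    have h3 : lam a x = 1 - lam b x - lam c x := by linarith
    rw [h3]; module
  rw [this, inner_add_right, real_inner_smul_right, real_inner_smul_right, hn]; ring

lemma inner_ne_zero {a b c : Plane} (h : IsBary {a, b, c} lam) (hab : a ≠ b) (hac : a ≠ c)
    (hbc : b ≠ c) {n : Plane} (hn1 : ‖n‖ = 1) (hn : ⟪n, b - a⟫_ℝ = 0) : ⟪n, c - a⟫_ℝ ≠ 0 := by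
  intro h0
  have h1 := h.inner_sub_eq hab hac hbc hn (a + n)
  rw [h0, mul_zero, add_sub_cancel_left, real_inner_self_eq_norm_sq, hn1] at h1
  norm_num at h1

end IsBary

lemma exists_vertices {K F : Finset Plane} (hK : K.card = 3) (hF : F ∈ K.powersetCard 2) :
    ∃ a b c, a ≠ b ∧ a ≠ c ∧ b ≠ c ∧ F = {a, b} ∧ K = {a, b, c} := by
  rw [Finset.mem_powersetCard] at hF
  obtain ⟨a, b, hab, rfl⟩ := Finset.card_eq_two.1 hF.2
  have : (K \ {a, b}).card = 1 := by rw [Finset.card_sdiff_of_subset hF.1, hK, hF.2]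
  obtain ⟨c, hc⟩ := Finset.card_eq_one.1 this
  have hcm : c ∈ K \ {a, b} := by rw [hc]; simp
  simp only [Finset.mem_sdiff, Finset.mem_insert, Finset.mem_singleton, not_or] at hcm
  refine ⟨a, b, c, hab, fun h => hcm.2.1 h.symm, fun h => hcm.2.2 h.symm, rfl, ?_⟩
  have := Finset.sdiff_union_of_subset hF.1
  rw [← this, hc]
  ext x; simp; tauto

lemma third_vertex {K : Finset Plane} {a b : Plane} (hK : K.card = 3) (hab : a ≠ b)
    (hF : ({a, b} : Finset Plane) ⊆ K) : ∃ c, a ≠ c ∧ b ≠ c ∧ K = {a, b, c} := by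
  have : (K \ {a, b}).card = 1 := by
    rw [Finset.card_sdiff_of_subset hF, hK, Finset.card_pair hab]
  obtain ⟨c, hc⟩ := Finset.card_eq_one.1 this
  have hcm : c ∈ K \ {a, b} := by rw [hc]; simp
  simp only [Finset.mem_sdiff, Finset.mem_insert, Finset.mem_singleton, not_or] at hcm
  refine ⟨c, fun h => hcm.2.1 h.symm, fun h => hcm.2.2 h.symm, ?_⟩
  have := Finset.sdiff_union_of_subset hF
  rw [← this, hc]
  ext x; simp; tauto

lemma hull_pair (a b : Plane) : hull {a, b} = segment ℝ a b := by
  simp [hull, convexHull_pair]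

/-- Where an edge point has distance from the two ends of the edge, the triangle is locally a
half-plane. -/
lemma IsBary.mem_hull_iff_of_mem_ball {lam : Plane → Plane →ᵃ[ℝ] ℝ} {a b c : Plane}
    (h : IsBary {a, b, c} lam) (hab : a ≠ b) (hac : a ≠ c) (hbc : b ≠ c) {n : Plane}
    (hn1 : ‖n‖ = 1) (hn : ⟪n, b - a⟫_ℝ = 0) (hnc : ⟪n, c - a⟫_ℝ ≤ 0) {x₀ : Plane}
    (hx₀ : lam c x₀ = 0) {d : Plane} {R θ : ℝ} (hR : 0 < R)
    (hd : Metric.closedBall d R ⊆ hull {a, b, c}) (ha : θ ≤ lam a x₀) (hb : θ ≤ lam b x₀)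
    {x : Plane} (hx : ‖x - x₀‖ < 2 * R * θ) :
    0 < lam a x ∧ 0 < lam b x ∧ (x ∈ hull {a, b, c} ↔ ⟪n, x - x₀⟫_ℝ ≤ 0) := by
  have hlt : ‖x - x₀‖ / (2 * R) < θ := by rw [div_lt_iff₀ (by positivity)]; linarith
  have h1 := abs_le.1 (h.abs_sub_le hR hd (z := a) (by simp) x x₀)
  have h2 := abs_le.1 (h.abs_sub_le hR hd (z := b) (by simp) x x₀)
  have ha' : 0 < lam a x := by linarith [h1.1]
  have hb' : 0 < lam b x := by linarith [h2.1]
  refine ⟨ha', hb', ?_⟩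
  have hneg : ⟪n, c - a⟫_ℝ < 0 := lt_of_le_of_ne hnc (h.inner_ne_zero hab hac hbc hn1 hn)
  have e : ⟪n, x - x₀⟫_ℝ = lam c x * ⟪n, c - a⟫_ℝ := by
    have e1 := h.inner_sub_eq hab hac hbc hn x
    have e2 := h.inner_sub_eq hab hac hbc hn x₀
    rw [hx₀, zero_mul] at e2
    rw [← e1, ← sub_add_sub_cancel x x₀ a, inner_add_right, e2, add_zero]
  rw [h.mem_hull_iff, e]
  constructor
  · intro hh
    exact mul_nonpos_of_nonneg_of_nonpos (hh c (by simp)) hneg.le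
  · intro hh z hz
    simp only [Finset.mem_insert, Finset.mem_singleton] at hz
    rcases hz with rfl | rfl | rfl
    · exact ha'.le
    · exact hb'.le
    · by_contra hcon
      push Not at hcon
      nlinarith [mul_pos_of_neg_of_neg hcon hneg]

lemma norm_sub_le_diam {s : Finset Plane} {x y : Plane} (hx : x ∈ hull s) (hy : y ∈ hull s) :
    ‖x - y‖ ≤ Metric.diam (hull s) := by
  rw [← dist_eq_norm]
  exact Metric.dist_le_diam_of_mem (isCompact_hull s).isBounded hx hy

lemma diam_hull_pair (a b : Plane) : Metric.diam (hull {a, b}) = ‖a - b‖ := by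
  rw [hull, convexHull_diam]
  simp [Metric.diam_pair, dist_eq_norm]

/-- The edges of a triangle are at least as long as the diameter of an inner disc. -/
lemma IsBary.two_mul_le_norm {lam : Plane → Plane →ᵃ[ℝ] ℝ} {K : Finset Plane}
    (h : IsBary K lam) {a b d : Plane} (hab : a ≠ b) (ha : a ∈ K) (hb : b ∈ K) {R : ℝ}
    (hR : 0 < R) (hd : Metric.closedBall d R ⊆ hull K) : 2 * R ≤ ‖a - b‖ := by
  have := h.abs_sub_le hR hd ha a b
  rw [h.self a ha, h.ne a ha b hb hab, sub_zero, abs_one, le_div_iff₀ (by positivity)] at this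
  linarith

/-! ### Topology of the interface problem -/

lemma HasLipschitzBoundary.interior_closure_subset {U : Set Plane} (hU : HasLipschitzBoundary U) :
    interior (closure U) ⊆ U := by
  intro x hx
  by_contra hxU
  have hxf : x ∈ frontier U :=
    ⟨interior_subset hx, fun h => hxU (interior_subset h)⟩
  obtain ⟨e, L, g, r, hg, hr, hgr⟩ := hU x hxf
  have hx1 : (e x) 1 ≤ g ((e x) 0) := by
    by_contra hcon
    exact hxU ((hgr x (Metric.mem_ball_self hr)).2 (not_le.1 hcon))
  obtain ⟨ε, hε, hball⟩ := Metric.isOpen_iff.1 isOpen_interior x hx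
  let v : Plane := !₂[0, 1]
  have hv : ‖v‖ = 1 := by
    have : ‖v‖ ^ 2 = 1 := by rw [norm_sq_plane]; simp [v]
    nlinarith [norm_nonneg v]
  set δ := min ε r / 2 with hδ
  have hδ0 : 0 < δ := by positivity
  have hδε : δ < ε := by
    have := min_le_left ε r; rw [hδ]; linarith
  have hδr : δ < r := by
    have := min_le_right ε r; rw [hδ]; linarith
  let y := e.symm (e x - δ • v)
  have hey : e y = e x - δ • v := e.apply_symm_apply _
  have hdist : dist y x = δ := by
    rw [← e.dist_map, hey, dist_eq_norm, sub_sub_cancel_left, norm_neg, norm_smul, hv,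
      Real.norm_of_nonneg hδ0.le, mul_one]
  have hyc : y ∈ closure U := interior_subset (hball (by rw [Metric.mem_ball, hdist]; exact hδε))
  let V := Metric.ball x r ∩ {z | (e z) 1 < g ((e z) 0)}
  have he : Continuous e := e.continuous
  have hV : IsOpen V := by
    refine Metric.isOpen_ball.inter (isOpen_lt ?_ (hg.continuous.comp ?_)) <;> fun_prop
  have hyV : y ∈ V := by
    refine ⟨by rw [Metric.mem_ball, hdist]; exact hδr, ?_⟩
    simp only [mem_ofPred_eq, hey]
    simp [v]
    linarith
  obtain ⟨z, hzV, hzU⟩ := mem_closure_iff.1 hyc V hV hyV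
  have := (hgr z hzV.1).1 hzU
  have h2 : (e z) 1 < g ((e z) 0) := hzV.2
  linarith

namespace InterfaceProblem

variable (P : InterfaceProblem)

lemma interior_closure_subset : interior (closure P.Ω) ⊆ P.Ω := P.lipschitz.interior_closure_subset

lemma measurableSet_Ω : MeasurableSet P.Ω := P.isOpen.measurableSet

lemma notMem_Γ_of_mem_Ωp {x : Plane} (hx : x ∈ P.Ωp) : x ∉ P.Γ :=
  (P.union_Ω.subset (Or.inl hx)).2

lemma notMem_Γ_of_mem_Ωm {x : Plane} (hx : x ∈ P.Ωm) : x ∉ P.Γ :=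
  (P.union_Ω.subset (Or.inr hx)).2

lemma mem_side {x : Plane} (hx : x ∈ P.Ω) (hΓ : x ∉ P.Γ) : x ∈ P.Ωp ∨ x ∈ P.Ωm :=
  P.union_Ω.superset ⟨hx, hΓ⟩

lemma subset_side {s : Set Plane} (hs : IsPreconnected s) (hΩ : s ⊆ P.Ω) (hΓ : ∀ x ∈ s, x ∉ P.Γ) :
    s ⊆ P.Ωp ∨ s ⊆ P.Ωm :=
  hs.subset_or_subset P.isOpen_Ωp P.isOpen_Ωm P.disjoint_Ω
    (fun x hx => P.mem_side (hΩ hx) (hΓ x hx))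

lemma isCompact_Γ : IsCompact P.Γ := by
  have : P.Γ = P.γ '' Icc 0 (0 + P.len) := by
    rw [P.γ_periodic.image_Icc P.len_pos]; rfl
  rw [this]
  exact isCompact_Icc.image P.γ_contDiff.continuous

lemma mem_closure_side {x : Plane} (hx : x ∈ closure P.Ω) (hΓ : x ∉ P.Γ) :
    x ∈ closure P.Ωp ∨ x ∈ closure P.Ωm := by
  have h1 : P.Ω ⊆ (P.Ωp ∪ P.Ωm) ∪ P.Γ := by
    intro y hy
    by_cases h : y ∈ P.Γ
    · exact Or.inr h
    · exact Or.inl (P.mem_side hy h)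
  have h2 := closure_mono h1 hx
  rw [closure_union, closure_union, P.isCompact_Γ.isClosed.closure_eq] at h2
  exact h2.resolve_right hΓ

lemma notMem_Γ_of_mem_frontier {x : Plane} (hx : x ∈ frontier P.Ω) : x ∉ P.Γ := fun h =>
  (P.isOpen.inter_frontier_eq.subset ⟨P.Γ_subset h, hx⟩)

lemma volume_Γ : volume P.Γ = 0 := by
  have h1 : dimH P.Γ ≤ 1 := by
    have := (P.γ_contDiff.of_le one_le_two).dimH_range_le
    simpa [Γ] using this
  have h2 : (μH[(Module.finrank ℝ Plane : ℝ)] : Measure Plane) P.Γ = 0 := by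
    have := hausdorffMeasure_of_dimH_lt (s := P.Γ) (d := 2) (h1.trans_lt (by norm_num))
    simpa using this
  exact Measure.absolutelyContinuous_isAddHaarMeasure volume
    (μH[(Module.finrank ℝ Plane : ℝ)] : Measure Plane) h2

lemma α_pos (x : Plane) : 0 < P.α x := by
  unfold α; split_ifs
  exacts [P.αp_pos, P.αm_pos]

lemma α_of_mem_Ωp {x : Plane} (hx : x ∈ P.Ωp) : P.α x = P.αp := if_pos hx

lemma α_of_mem_Ωm {x : Plane} (hx : x ∈ P.Ωm) : P.α x = P.αm :=
  if_neg fun h => (P.disjoint_Ω.le_bot ⟨h, hx⟩)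

lemma measurable_α : Measurable P.α :=
  Measurable.ite P.isOpen_Ωp.measurableSet measurable_const measurable_const

end InterfaceProblem

/-! ### Elements and edges of the mesh -/

namespace Mesh

variable {P : InterfaceProblem} (T : Mesh P)

lemma exists_isBary {K : Finset Plane} (hK : K ∈ T.elements) : ∃ lam, IsBary K lam :=
  IFEM.exists_isBary (T.card_eq K hK) (T.affineIndependent K hK)

lemma nonempty_of_mem {K : Finset Plane} (hK : K ∈ T.elements) : K.Nonempty :=
  Finset.card_pos.1 (by rw [T.card_eq K hK]; norm_num)

lemma hull_subset_closure {K : Finset Plane} (hK : K ∈ T.elements) : hull K ⊆ closure P.Ω := by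
  rw [← T.cover]
  exact subset_biUnion_of_mem (u := hull) hK

lemma interior_hull_subset {K : Finset Plane} (hK : K ∈ T.elements) : interior (hull K) ⊆ P.Ω :=
  (interior_mono (T.hull_subset_closure hK)).trans P.interior_closure_subset

lemma volume_frontier_hull (K : Finset Plane) : volume (frontier (hull K)) = 0 :=
  (convex_hull K).addHaar_frontier volume

lemma ae_mem_interior (K : Finset Plane) :
    ∀ᵐ x ∂(volume.restrict (hull K)), x ∈ interior (hull K) := by
  rw [ae_restrict_iff' (isClosed_hull K).measurableSet]
  have h := compl_mem_ae_iff.2 (volume_frontier_hull K)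
  filter_upwards [h] with x hx hxK
  by_contra hcon
  exact hx ⟨subset_closure hxK, hcon⟩

lemma mem_elements_of_mem_patch {K K' : Finset Plane} (h : K' ∈ T.patch K) : K' ∈ T.elements :=
  (Finset.mem_filter.1 h).1

lemma diam_pos {K : Finset Plane} (hK : K ∈ T.elements) : 0 < Metric.diam (hull K) := by
  obtain ⟨a, b, ha, hb, hab⟩ := Finset.one_lt_card_iff.1
    (show 1 < K.card by rw [T.card_eq K hK]; norm_num)
  exact (norm_pos_iff.2 (sub_ne_zero.2 hab)).trans_le
    (norm_sub_le_diam (subset_hull ha) (subset_hull hb))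

/-- The ends of an edge and its normal. -/
lemma exists_ends {F : Finset Plane} (hF : F ∈ T.edges) :
    ∃ a b, a ≠ b ∧ F = {a, b} ∧ h F = ‖a - b‖ ∧ ‖T.n F‖ = 1 ∧ ⟪T.n F, b - a⟫_ℝ = 0 := by
  obtain ⟨K, hK, hFK⟩ := Finset.mem_biUnion.1 hF
  obtain ⟨a, b, hab, rfl⟩ := Finset.card_eq_two.1 (Finset.mem_powersetCard.1 hFK).2
  exact ⟨a, b, hab, rfl, diam_hull_pair a b, T.norm_n _ hF,
    T.n_normal _ hF a (by simp) b (by simp)⟩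

lemma h_pos {F : Finset Plane} (hF : F ∈ T.edges) : 0 < h F := by
  obtain ⟨a, b, hab, -, hh, -⟩ := T.exists_ends hF
  rw [hh]; exact norm_pos_iff.2 (sub_ne_zero.2 hab)

/-- Near the inner points of an edge an element is a half-plane. -/
lemma mem_hull_iff_near_edge {σ : ℝ} (hσ : 0 < σ) (hT : T.ShapeRegular σ) {K : Finset Plane}
    (hK : K ∈ T.elements) {a b : Plane} (hab : a ≠ b) (hF : ({a, b} : Finset Plane) ⊆ K)
    {n : Plane} (hn1 : ‖n‖ = 1) (hn : ⟪n, b - a⟫_ℝ = 0) (hout : ∀ z ∈ K, ⟪n, z - a⟫_ℝ ≤ 0)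
    {τ θ : ℝ} (h1 : θ ≤ τ) (h2 : τ ≤ 1 - θ) {x : Plane}
    (hx : ‖x - ((1 - τ) • a + τ • b)‖ < 2 * (‖a - b‖ / σ) * θ) :
    (x ∈ hull K ↔ ⟪n, x - ((1 - τ) • a + τ • b)⟫_ℝ ≤ 0) := by
  obtain ⟨lam, hl⟩ := T.exists_isBary hK
  obtain ⟨d, hd⟩ := hT K hK
  obtain ⟨c, hac, hbc, hKe⟩ := third_vertex (T.card_eq K hK) hab hF
  have hd' : Metric.closedBall d (‖a - b‖ / σ) ⊆ hull K := by
    refine (Metric.closedBall_subset_closedBall ?_).trans hd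
    gcongr
    exact norm_sub_le_diam (subset_hull (hF (by simp))) (subset_hull (hF (by simp)))
  subst hKe
  have hR : 0 < ‖a - b‖ / σ := div_pos (norm_pos_iff.2 (sub_ne_zero.2 hab)) hσ
  have e : ∀ z, lam z ((1 - τ) • a + τ • b) = (1 - τ) * lam z a + τ * lam z b := fun z =>
    affine_combo _ _ _ _ (by ring)
  refine (hl.mem_hull_iff_of_mem_ball hab hac hbc hn1 hn (hout c (by simp)) (θ := θ) ?_ hR hd'
    ?_ ?_ hx).2.2
  · rw [e, hl.ne c (by simp) a (by simp) hac.symm, hl.ne c (by simp) b (by simp) hbc.symm]; simp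
  · rw [e, hl.self a (by simp), hl.ne a (by simp) b (by simp) hab]; linarith
  · rw [e, hl.self b (by simp), hl.ne b (by simp) a (by simp) hab.symm]; linarith

/-- Two elements with a common edge lie on different sides of it. -/
lemma opposite_side {σ : ℝ} (hσ : 0 < σ) (hT : T.ShapeRegular σ) {K₁ K₂ : Finset Plane}
    (hK1 : K₁ ∈ T.elements) (hK2 : K₂ ∈ T.elements) (hne : K₂ ≠ K₁) {a b : Plane} (hab : a ≠ b)
    (hF1 : ({a, b} : Finset Plane) ⊆ K₁) (hF2 : ({a, b} : Finset Plane) ⊆ K₂) {n : Plane}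
    (hn1 : ‖n‖ = 1) (hn : ⟪n, b - a⟫_ℝ = 0) (hout : ∀ z ∈ K₁, ⟪n, z - a⟫_ℝ ≤ 0) :
    ∀ z ∈ K₂, ⟪-n, z - a⟫_ℝ ≤ 0 := by
  obtain ⟨lam1, hl1⟩ := T.exists_isBary hK1
  obtain ⟨lam2, hl2⟩ := T.exists_isBary hK2
  obtain ⟨c1, hac1, hbc1, hK1e⟩ := third_vertex (T.card_eq _ hK1) hab hF1
  obtain ⟨c2, hac2, hbc2, hK2e⟩ := third_vertex (T.card_eq _ hK2) hab hF2
  have hside : 0 ≤ ⟪n, c2 - a⟫_ℝ := by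
    by_contra hneg
    push Not at hneg
    have hout2 : ∀ z ∈ K₂, ⟪n, z - a⟫_ℝ ≤ 0 := by
      intro z hz
      rw [hK2e] at hz
      simp only [Finset.mem_insert, Finset.mem_singleton] at hz
      rcases hz with rfl | rfl | rfl
      · simp
      · exact hn.le
      · exact hneg.le
    have hd : 0 < ‖a - b‖ := norm_pos_iff.2 (sub_ne_zero.2 hab)
    set x0 : Plane := (1 - (1 / 2 : ℝ)) • a + (1 / 2 : ℝ) • b with hx0
    set δ := ‖a - b‖ / σ / 2 with hδ
    have hδ0 : 0 < δ := by positivity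
    have hsm : ‖(x0 - δ • n) - x0‖ < 2 * (‖a - b‖ / σ) * (1 / 2) := by
      rw [sub_sub_cancel_left, norm_neg, norm_smul, hn1, Real.norm_of_nonneg hδ0.le, hδ]
      have : 0 < ‖a - b‖ / σ := by positivity
      linarith
    have hin : ⟪n, (x0 - δ • n) - x0⟫_ℝ = -δ := by
      rw [sub_sub_cancel_left, inner_neg_right, real_inner_smul_right, real_inner_self_eq_norm_sq,
        hn1]; simp
    have m1 := (T.mem_hull_iff_near_edge hσ hT hK1 hab hF1 hn1 hn hout
      (θ := 1 / 2) le_rfl (by norm_num) hsm).2 (by rw [hin]; linarith)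
    have m2 := (T.mem_hull_iff_near_edge hσ hT hK2 hab hF2 hn1 hn hout2
      (θ := 1 / 2) le_rfl (by norm_num) hsm).2 (by rw [hin]; linarith)
    have m3 : x0 - δ • n ∈ hull (K₁ ∩ K₂) := by
      rw [← T.conforming _ hK1 _ hK2]; exact ⟨m1, m2⟩
    have hc1 : c1 ∉ K₁ ∩ K₂ := by
      intro hc
      apply hne
      refine (Finset.eq_of_subset_of_card_le ?_ ?_).symm
      · rw [hK1e]
        intro z hz
        simp only [Finset.mem_insert, Finset.mem_singleton] at hz
        rcases hz with rfl | rfl | rfl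
        · exact hF2 (by simp)
        · exact hF2 (by simp)
        · exact (Finset.mem_inter.1 hc).2
      · rw [T.card_eq _ hK1, T.card_eq _ hK2]
    have m4 := ((hl1.mem_hull_subset_iff Finset.inter_subset_left _).1 m3).2 c1
      (by rw [hK1e]; simp) hc1
    rw [hK1e] at hl1
    have m5 := hl1.inner_sub_eq hab hac1 hbc1 hn (x0 - δ • n)
    rw [m4, zero_mul] at m5
    have m6 : ⟪n, x0 - a⟫_ℝ = 0 := by
      have : x0 - a = (1 / 2 : ℝ) • (b - a) := by rw [hx0]; module
      rw [this, real_inner_smul_right, hn, mul_zero]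
    have : ⟪n, x0 - δ • n - a⟫_ℝ = ⟪n, (x0 - δ • n) - x0⟫_ℝ + ⟪n, x0 - a⟫_ℝ := by
      rw [← inner_add_right]; congr 1; abel
    rw [m5, hin, m6] at this
    linarith
  intro z hz
  rw [hK2e] at hz
  simp only [Finset.mem_insert, Finset.mem_singleton] at hz
  rw [inner_neg_left]
  rcases hz with rfl | rfl | rfl
  · simp
  · rw [hn]; simp
  · linarith

lemma K₂_side {σ : ℝ} (hσ : 0 < σ) (hT : T.ShapeRegular σ) {F : Finset Plane}
    (hF : T.IsInterior F) {a : Plane} (ha : a ∈ F) : ∀ z ∈ T.K₂ F, ⟪-T.n F, z - a⟫_ℝ ≤ 0 := by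
  obtain ⟨hK1, hF1⟩ := T.K₁_mem F hF.1
  obtain ⟨hK2, hF2, hne⟩ := T.K₂_mem F hF.1 hF.2
  have hnn := T.n_normal F hF.1
  obtain ⟨x, y, hxy, rfl, -⟩ := T.exists_ends hF.1
  have hout := T.n_outward _ hF.1 a ha
  simp only [Finset.mem_insert, Finset.mem_singleton] at ha
  rcases ha with rfl | rfl
  · exact T.opposite_side hσ hT hK1 hK2 hne hxy hF1 hF2 (T.norm_n _ hF.1)
      (hnn _ (by simp) _ (by simp)) hout
  · rw [Finset.pair_comm] at hF1 hF2
    rw [Finset.pair_comm x] at *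
    exact T.opposite_side hσ hT hK1 hK2 hne hxy.symm hF1 hF2 (T.norm_n _ hF.1)
      (hnn _ (by simp) _ (by simp)) hout

lemma mem_sdiff_pair {a b : Plane} {x : Plane} (hx : x ∈ hull {a, b} \ ({a, b} : Finset Plane)) :
    ∃ τ : ℝ, 0 < τ ∧ τ < 1 ∧ x = (1 - τ) • a + τ • b := by
  obtain ⟨hx1, hx2⟩ := hx
  rw [hull_pair, segment_eq_image] at hx1
  obtain ⟨τ, ⟨h0, h1⟩, rfl⟩ := hx1
  refine ⟨τ, lt_of_le_of_ne h0 ?_, lt_of_le_of_ne h1 ?_, rfl⟩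
  · rintro rfl; apply hx2; simp
  · rintro rfl; apply hx2; simp

lemma mem_hull_iff_near_interior_edge {σ : ℝ} (hσ : 0 < σ) (hT : T.ShapeRegular σ) {F : Finset Plane}
    (hF : T.IsInterior F) {a b : Plane} (hab : a ≠ b) (hFe : F = {a, b}) {τ θ : ℝ}
    (h1 : θ ≤ τ) (h2 : τ ≤ 1 - θ) {x : Plane}
    (hx : ‖x - ((1 - τ) • a + τ • b)‖ < 2 * (h F / σ) * θ) :
    (x ∈ hull (T.K₁ F) ↔ ⟪T.n F, x - ((1 - τ) • a + τ • b)⟫_ℝ ≤ 0) ∧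
      (x ∈ hull (T.K₂ F) ↔ ⟪-T.n F, x - ((1 - τ) • a + τ • b)⟫_ℝ ≤ 0) := by
  obtain ⟨hK1, hF1⟩ := T.K₁_mem F hF.1
  obtain ⟨hK2, hF2, -⟩ := T.K₂_mem F hF.1 hF.2
  have hn1 := T.norm_n F hF.1
  have haF : a ∈ F := by rw [hFe]; simp
  have hbF : b ∈ F := by rw [hFe]; simp
  have hn := T.n_normal F hF.1 a haF b hbF
  have hh : h F = ‖a - b‖ := by rw [hFe]; exact diam_hull_pair a b
  rw [hh] at hx
  constructor
  · exact T.mem_hull_iff_near_edge hσ hT hK1 hab (hFe ▸ hF1) hn1 hn (T.n_outward F hF.1 a haF)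
      h1 h2 hx
  · exact T.mem_hull_iff_near_edge hσ hT hK2 hab (hFe ▸ hF2) (by rw [norm_neg, hn1])
      (by rw [inner_neg_left, hn, neg_zero]) (T.K₂_side hσ hT hF haF) h1 h2 hx

/-- A disc around an inner point of an interior edge lies in `Ω`. -/
lemma ball_subset {σ : ℝ} (hσ : 0 < σ) (hT : T.ShapeRegular σ) {F : Finset Plane}
    (hF : T.IsInterior F) {a b : Plane} (hab : a ≠ b) (hFe : F = {a, b}) {τ θ : ℝ}
    (h1 : θ ≤ τ) (h2 : τ ≤ 1 - θ) :
    Metric.ball ((1 - τ) • a + τ • b) (2 * (h F / σ) * θ) ⊆ P.Ω := by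
  refine Subset.trans (interior_maximal ?_ Metric.isOpen_ball) P.interior_closure_subset
  intro x hx
  rw [mem_ball_iff_norm] at hx
  obtain ⟨e1, e2⟩ := T.mem_hull_iff_near_interior_edge hσ hT hF hab hFe h1 h2 hx
  rw [inner_neg_left] at e2
  rcases le_total ⟪T.n F, x - ((1 - τ) • a + τ • b)⟫_ℝ 0 with h | h
  · exact T.hull_subset_closure (T.K₁_mem F hF.1).1 (e1.2 h)
  · exact T.hull_subset_closure (T.K₂_mem F hF.1 hF.2).1 (e2.2 (by linarith))

/-- The relative interior of an interior edge lies in `Ω`. -/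
lemma sdiff_subset {σ : ℝ} (hσ : 0 < σ) (hT : T.ShapeRegular σ) {F : Finset Plane}
    (hF : T.IsInterior F) : hull F \ F ⊆ P.Ω := by
  obtain ⟨a, b, hab, hFe, -⟩ := T.exists_ends hF.1
  intro x hx
  rw [hFe] at hx
  obtain ⟨τ, h0, h1, rfl⟩ := mem_sdiff_pair hx
  refine T.ball_subset hσ hT hF hab hFe (θ := min τ (1 - τ)) (min_le_left _ _)
    (by linarith [min_le_right τ (1 - τ)]) (Metric.mem_ball_self ?_)
  have := T.h_pos hF.1
  have : 0 < min τ (1 - τ) := lt_min h0 (by linarith)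
  positivity

end Mesh

/-! ### Weak gradients of piecewise affine functions -/

/-- Integration by parts against a test function. -/
lemma integral_smul_gradient {f φ : Plane → ℝ} (hf : ContDiff ℝ 1 f) (hφ : ContDiff ℝ 1 φ)
    (hc : HasCompactSupport φ) :
    ∫ x, f x • gradient φ x = - ∫ x, φ x • gradient f x := by
  have hi1 : Integrable fun x => f x • gradient φ x :=
    (hf.continuous.smul (continuous_gradient hφ)).integrable_of_hasCompactSupport
      (hasCompactSupport_gradient hc).smul_left
  have hi2 : Integrable fun x => φ x • gradient f x :=
    (hφ.continuous.smul (continuous_gradient hf)).integrable_of_hasCompactSupport hc.smul_right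
  refine ext_inner_left ℝ fun v => ?_
  rw [inner_neg_right, ← integral_inner hi1, ← integral_inner hi2]
  have e1 : ∀ x, ⟪v, f x • gradient φ x⟫_ℝ = f x * fderiv ℝ φ x v := fun x => by
    rw [real_inner_smul_right, fderiv_apply_eq_inner_gradient, real_inner_comm]
  have e2 : ∀ x, ⟪v, φ x • gradient f x⟫_ℝ = fderiv ℝ f x v * φ x := fun x => by
    rw [real_inner_smul_right, fderiv_apply_eq_inner_gradient, real_inner_comm, mul_comm]
  simp_rw [e1, e2]
  refine integral_mul_fderiv_eq_neg_fderiv_mul_of_integrable ?_ ?_ ?_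
    (fun x _ => hf.differentiable (by norm_num) x) (fun x _ => hφ.differentiable (by norm_num) x)
  · simpa only [e2] using hi2.const_inner (𝕜 := ℝ) v
  · simpa only [e1] using hi1.const_inner (𝕜 := ℝ) v
  · exact (hf.continuous.mul hφ.continuous).integrable_of_hasCompactSupport hc.mul_left

/-- The gradient of a continuous affine function. -/
def affGrad (f : Plane →ᴬ[ℝ] ℝ) : Plane := (InnerProductSpace.toDual ℝ Plane).symm f.contLinear

lemma aff_sub (f : Plane →ᴬ[ℝ] ℝ) (x y : Plane) : f x - f y = ⟪affGrad f, x - y⟫_ℝ := by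
  have := f.contLinear_map_vsub x y
  simp only [vsub_eq_sub] at this
  simp [affGrad, this]

lemma hasFDerivAt_aff (f : Plane →ᴬ[ℝ] ℝ) (x : Plane) : HasFDerivAt f f.contLinear x := by
  have h : (f : Plane → ℝ) = fun y => f.contLinear y + f 0 := by
    funext y
    have := f.contLinear_map_vsub y 0
    simp only [vsub_eq_sub, sub_zero] at this
    rw [this]; ring
  rw [h]
  exact f.contLinear.hasFDerivAt.add_const _

lemma gradient_aff (f : Plane →ᴬ[ℝ] ℝ) (x : Plane) : gradient f x = affGrad f := by
  rw [gradient, (hasFDerivAt_aff f x).fderiv, affGrad]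

lemma contDiff_aff (f : Plane →ᴬ[ℝ] ℝ) : ContDiff ℝ 1 f := f.contDiff

lemma gradientWithin_eq_affGrad {s : Set Plane} (hs : Convex ℝ s) (hi : (interior s).Nonempty)
    {x : Plane} (hx : x ∈ s) {w : Plane → ℝ} {f : Plane →ᴬ[ℝ] ℝ} (hw : w =ᶠ[𝓝[s] x] f) :
    gradientWithin w s x = affGrad f := by
  rw [gradientWithin, affGrad, hw.fderivWithin_eq (hw.self_of_nhdsWithin hx),
    (hasFDerivAt_aff f x).hasFDerivWithinAt.fderivWithin
      (uniqueDiffWithinAt_convex hs hi (subset_closure hx))]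

/-- Where an `H¹` function is affine its weak gradient is the classical one. -/
lemma IsH1.ae_eq_affGrad {U V : Set Plane} {w : Plane → ℝ} {G : Plane → Plane} (h : IsH1 U w G)
    (hV : IsOpen V) (hVU : V ⊆ U) {f : Plane →ᴬ[ℝ] ℝ} (hw : ∀ x ∈ V, w x = f x) :
    ∀ᵐ x, x ∈ V → G x = affGrad f := by
  have hGV : MemLp G 2 (volume.restrict V) := h.memLp_grad.mono_measure (Measure.restrict_mono_set _ hVU)
  have hloc : LocallyIntegrableOn (fun x => G x - affGrad f) V := by
    rw [locallyIntegrableOn_iff hV.isLocallyClosed]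
    intro k hk hkc
    have hk2 : MemLp G 2 (volume.restrict k) := hGV.mono_measure (Measure.restrict_mono_set _ hk)
    have : IsFiniteMeasure (volume.restrict k) := ⟨by simpa using hkc.measure_lt_top⟩
    exact (hk2.integrable (by norm_num)).sub (integrable_const _)
  have key := hV.ae_eq_zero_of_integral_contDiff_smul_eq_zero hloc ?_
  · filter_upwards [key] with x hx hxV
    exact sub_eq_zero.1 (hx hxV)
  intro φ hφ hc hsupp
  have h1 := h.weakGradient φ hφ hc (hsupp.trans hVU)
  have hφ1 : ContDiff ℝ 1 φ := hφ.of_le (by simp)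
  have h2 := integral_smul_gradient (contDiff_aff f) hφ1 hc
  have z1 : ∀ x ∉ V, φ x = 0 := fun x hx => image_eq_zero_of_notMem_tsupport fun h => hx (hsupp h)
  have z2 : ∀ x ∉ V, gradient φ x = 0 := fun x hx =>
    image_eq_zero_of_notMem_tsupport fun h => hx (hsupp (tsupport_gradient_subset φ h))
  rw [setIntegral_eq_integral_of_forall_compl_eq_zero
      (fun x hx => by rw [z2 x fun h => hx (hVU h), smul_zero]),
    setIntegral_eq_integral_of_forall_compl_eq_zero
      (fun x hx => by rw [z1 x fun h => hx (hVU h), zero_smul])] at h1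
  have h3 : ∀ x, w x • gradient φ x = f x • gradient φ x := fun x => by
    by_cases hx : x ∈ V
    · rw [hw x hx]
    · rw [z2 x hx, smul_zero, smul_zero]
  simp_rw [h3, h2, gradient_aff] at h1
  have hi1 : Integrable fun x => φ x • affGrad f :=
    (hφ1.continuous.smul continuous_const).integrable_of_hasCompactSupport hc.smul_right
  have hi2 : Integrable fun x => φ x • G x := by
    have hm : MemLp φ 2 (volume.restrict V) :=
      (hφ1.continuous.memLp_of_hasCompactSupport hc).restrict V
    have : IntegrableOn (fun x => φ x • G x) V :=
      memLp_one_iff_integrable.1 (hGV.smul hm)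
    exact (integrableOn_iff_integrable_of_support_subset (fun x hx => by
      by_contra hxV; exact hx (by simp [z1 x hxV]))).1 this
  simp_rw [smul_sub]
  rw [integral_sub hi2 hi1, sub_eq_zero]
  exact (neg_injective h1).symm

/-- The normal flux of a piecewise affine function with flux in `H(div)` is continuous across the
phase boundary. -/
lemma flux_eq_of_isHDiv {U : Set Plane} (hU : IsOpen U) {ν : Plane} {b : ℝ} (hν : ν ≠ 0)
    {m : Plane} (hm : m ∈ U) (hm0 : ⟪ν, m⟫_ℝ + b = 0) {w : Plane → ℝ} {G : Plane → Plane}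
    (hG : IsH1 U w G) {a : Plane → ℝ} {ap am : ℝ}
    (hap : ∀ x ∈ U, 0 < ⟪ν, x⟫_ℝ + b → a x = ap) (ham : ∀ x ∈ U, ⟪ν, x⟫_ℝ + b < 0 → a x = am)
    (hdiv : IsHDiv U fun x => a x • G x) {fp fm : Plane →ᴬ[ℝ] ℝ}
    (hwp : ∀ x ∈ U, 0 < ⟪ν, x⟫_ℝ + b → w x = fp x)
    (hwm : ∀ x ∈ U, ⟪ν, x⟫_ℝ + b < 0 → w x = fm x) :
    ap * ⟪affGrad fp, ν⟫_ℝ = am * ⟪affGrad fm, ν⟫_ℝ := by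
  obtain ⟨-, d, hd, hdφ⟩ := hdiv
  have hℓ : Continuous fun x : Plane => ⟪ν, x⟫_ℝ + b := by fun_prop
  have oP : IsOpen (U ∩ {x | 0 < ⟪ν, x⟫_ℝ + b}) := hU.inter (isOpen_lt continuous_const hℓ)
  have oM : IsOpen (U ∩ {x | ⟪ν, x⟫_ℝ + b < 0}) := hU.inter (isOpen_lt hℓ continuous_const)
  have gP := hG.ae_eq_affGrad oP inter_subset_left fun x hx => hwp x hx.1 hx.2
  have gM := hG.ae_eq_affGrad oM inter_subset_left fun x hx => hwm x hx.1 hx.2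
  have hdV : ∀ V : Set Plane, IsOpen V → V ⊆ U → ∀ q : Plane,
      (∀ᵐ x, x ∈ V → a x • G x = q) → ∀ᵐ x, x ∈ V → d x = 0 := by
    intro V hV hVU q hq
    have hloc : LocallyIntegrableOn d V := by
      rw [locallyIntegrableOn_iff hV.isLocallyClosed]
      intro k hk hkc
      have hk2 : MemLp d 2 (volume.restrict k) :=
        hd.mono_measure (Measure.restrict_mono_set _ (hk.trans hVU))
      have : IsFiniteMeasure (volume.restrict k) := ⟨by simpa using hkc.measure_lt_top⟩
      exact hk2.integrable (by norm_num)
    refine hV.ae_eq_zero_of_integral_contDiff_smul_eq_zero hloc fun φ hφ hc hsupp => ?_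
    have h1 := hdφ φ hφ hc (hsupp.trans hVU)
    have hφ1 : ContDiff ℝ 1 φ := hφ.of_le (by simp)
    have z1 : ∀ x ∉ V, φ x = 0 := fun x hx =>
      image_eq_zero_of_notMem_tsupport fun h => hx (hsupp h)
    have z2 : ∀ x ∉ V, gradient φ x = 0 := fun x hx =>
      image_eq_zero_of_notMem_tsupport fun h => hx (hsupp (tsupport_gradient_subset φ h))
    rw [setIntegral_eq_integral_of_forall_compl_eq_zero
        (fun x hx => by rw [z2 x fun h => hx (hVU h), inner_zero_right]),
      setIntegral_eq_integral_of_forall_compl_eq_zero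
        (fun x hx => by rw [z1 x fun h => hx (hVU h), mul_zero])] at h1
    have h2 : ∫ x, ⟪a x • G x, gradient φ x⟫_ℝ = ∫ x, ⟪twoPhase 0 0 q q x, gradient φ x⟫_ℝ := by
      refine integral_congr_ae ?_
      filter_upwards [hq] with x hx
      by_cases hxV : x ∈ V
      · rw [hx hxV]; simp [twoPhase]
      · rw [z2 x hxV, inner_zero_right, inner_zero_right]
    rw [h2, integral_twoPhase_inner_gradient hφ1 hc (by simp)] at h1
    simp_rw [smul_eq_mul, mul_comm (φ _)]
    linarith
  have dP := hdV _ oP inter_subset_left (ap • affGrad fp) (by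
    filter_upwards [gP] with x hx hxV
    rw [hx hxV, hap x hxV.1 hxV.2])
  have dM := hdV _ oM inter_subset_left (am • affGrad fm) (by
    filter_upwards [gM] with x hx hxV
    rw [hx hxV, ham x hxV.1 hxV.2])
  have hline : ∀ᵐ x : Plane, ⟪ν, x⟫_ℝ + b ≠ 0 :=
    compl_mem_ae_iff.2 (volume_affine_eq_zero (Or.inl hν))
  obtain ⟨A, hA, hbump⟩ := exists_bump
  obtain ⟨r, hr, hball⟩ := Metric.isOpen_iff.1 hU m hm
  obtain ⟨φ, hφ⟩ := hbump m (r / 2) (by positivity)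
  have hsupp : tsupport φ ⊆ U := hφ.tsupport_subset.trans
    ((Metric.closedBall_subset_ball (by linarith)).trans hball)
  have h1 := hdφ φ hφ.contDiff hφ.hasCompactSupport hsupp
  have z1 : ∀ x ∉ U, φ x = 0 := fun x hx => image_eq_zero_of_notMem_tsupport fun h => hx (hsupp h)
  have z2 : ∀ x ∉ U, gradient φ x = 0 := fun x hx =>
    image_eq_zero_of_notMem_tsupport fun h => hx (hsupp (tsupport_gradient_subset φ h))
  rw [setIntegral_eq_integral_of_forall_compl_eq_zero
      (fun x hx => by rw [z2 x hx, inner_zero_right]),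
    setIntegral_eq_integral_of_forall_compl_eq_zero
      (fun x hx => by rw [z1 x hx, mul_zero])] at h1
  set D : Plane := ap • affGrad fp - am • affGrad fm with hD
  have hd0 : ∫ x, d x * φ x = 0 := by
    refine integral_eq_zero_of_ae ?_
    filter_upwards [dP, dM, hline] with x h1 h2 h3
    by_cases hxU : x ∈ U
    · rcases lt_or_gt_of_ne h3 with h | h
      · simp [h2 ⟨hxU, h⟩]
      · simp [h1 ⟨hxU, h⟩]
    · simp [z1 x hxU]
  rw [hd0, neg_zero] at h1
  have hν0 : 0 < ‖ν‖ := norm_pos_iff.2 hν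
  set n : Plane := -(‖ν‖⁻¹ • ν) with hn
  have hn1 : ‖n‖ = 1 := by
    rw [hn, norm_neg, norm_smul, norm_inv, norm_norm, inv_mul_cancel₀ hν0.ne']
  have hH : {x : Plane | ⟪n, x - m⟫_ℝ < 0} = {x | 0 < ⟪ν, x⟫_ℝ + b} := by
    ext x
    have : ⟪n, x - m⟫_ℝ = -(‖ν‖⁻¹ * (⟪ν, x⟫_ℝ + b)) := by
      rw [hn, inner_neg_left, real_inner_smul_left, inner_sub_right]
      have : ⟪ν, m⟫_ℝ = -b := by linarith
      rw [this]; ring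
    simp only [mem_ofPred_eq, this, Left.neg_neg_iff]
    constructor
    · intro h; exact (mul_pos_iff_of_pos_left (inv_pos.2 hν0)).1 h
    · intro h; positivity
  have hint : ∀ v : Plane, Integrable (fun x => ⟪v, gradient φ x⟫_ℝ) := fun v =>
    (continuous_const.inner (continuous_gradient hφ.contDiff_one)).integrable_of_hasCompactSupport
      ((hasCompactSupport_gradient hφ.hasCompactSupport).comp_left (g := fun w => ⟪v, w⟫_ℝ)
        (by simp))
  have h2 : ∫ x, ⟪a x • G x, gradient φ x⟫_ℝ = ∫ x, (⟪am • affGrad fm, gradient φ x⟫_ℝ +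
      {x | 0 < ⟪ν, x⟫_ℝ + b}.indicator (fun x => ⟪D, gradient φ x⟫_ℝ) x) := by
    refine integral_congr_ae ?_
    filter_upwards [gP, gM, hline] with x h1 h2 h3
    by_cases hxU : x ∈ U
    · rcases lt_or_gt_of_ne h3 with h | h
      · rw [indicator_of_notMem (by simp only [mem_ofPred_eq]; exact h.not_gt), h2 ⟨hxU, h⟩,
          ham x hxU h, add_zero]
      · rw [indicator_of_mem (by exact h), h1 ⟨hxU, h⟩, hap x hxU h, ← inner_add_left, hD,
          add_sub_cancel]
    · simp only [z2 x hxU, inner_zero_right]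
      simp [indicator, z2 x hxU]
  have h3 : ∫ x, ⟪am • affGrad fm, gradient φ x⟫_ℝ = 0 := by
    have := integral_twoPhase_inner_gradient (ν := 0) (b := 0) (Qp := am • affGrad fm)
      (Qm := am • affGrad fm) hφ.contDiff_one hφ.hasCompactSupport (by simp)
    simpa [twoPhase] using this
  rw [h2, integral_add (hint _) ((hint D).indicator (measurableSet_pos ν b)), h3, zero_add,
    integral_indicator (measurableSet_pos ν b), ← hH,
    integral_halfPlane_inner_gradient hφ.contDiff_one hφ.hasCompactSupport hn1] at h1
  have hpos := hφ.le_integral_line (by positivity) hn1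
  have h4 : ⟪D, n⟫_ℝ = 0 := by
    rcases mul_eq_zero.1 h1 with h | h
    · exact h
    · linarith
  rw [hn, inner_neg_right, real_inner_smul_right, neg_eq_zero, mul_eq_zero] at h4
  have h5 := h4.resolve_left (inv_ne_zero hν0.ne')
  rw [hD, inner_sub_left, real_inner_smul_left, real_inner_smul_left] at h5
  linarith

/-! ### A triangle cut by a chord -/

lemma affine_eq_inner (f : Plane →ᴬ[ℝ] ℝ) (x : Plane) : f x = ⟪affGrad f, x⟫_ℝ + f 0 := by
  have := aff_sub f x 0
  rw [sub_zero] at this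
  linarith

lemma level_combo (ν : Plane) (b : ℝ) (x y : Plane) {s t : ℝ} (h : s + t = 1) :
    ⟪ν, s • x + t • y⟫_ℝ + b = s * (⟪ν, x⟫_ℝ + b) + t * (⟪ν, y⟫_ℝ + b) := by
  rw [inner_add_right, real_inner_smul_right, real_inner_smul_right]
  linear_combination (-b) * h

lemma convex_level_nonneg (ν : Plane) (b : ℝ) : Convex ℝ {x : Plane | 0 ≤ ⟪ν, x⟫_ℝ + b} := by
  intro x hx y hy s t hs ht hst
  simp only [mem_ofPred_eq] at hx hy ⊢
  rw [level_combo ν b x y hst]; positivity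

/-- Vectors orthogonal to a nonzero vector of the plane are parallel. -/
lemma eq_smul_of_inner_eq_zero {ν v w : Plane} (hν : ν ≠ 0) (hw : w ≠ 0) (hv0 : ⟪ν, v⟫_ℝ = 0)
    (hw0 : ⟪ν, w⟫_ℝ = 0) : ∃ t : ℝ, v = t • w := by
  have hw' : 0 < ‖w‖ ^ 2 := by positivity
  have hν' : 0 < ‖ν‖ ^ 2 := by positivity
  refine ⟨⟪v, w⟫_ℝ / ‖w‖ ^ 2, ?_⟩
  rw [inner_plane] at hv0 hw0
  rw [norm_sq_plane] at hw' hν'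
  have hdet : v 0 * w 1 - v 1 * w 0 = 0 := by
    have h0 : ν 0 * (v 0 * w 1 - v 1 * w 0) = 0 := by
      linear_combination w 1 * hv0 - v 1 * hw0
    have h1 : ν 1 * (v 0 * w 1 - v 1 * w 0) = 0 := by
      linear_combination -w 0 * hv0 + v 0 * hw0
    by_contra hne
    have e0 := (mul_eq_zero.1 h0).resolve_right hne
    have e1 := (mul_eq_zero.1 h1).resolve_right hne
    rw [e0, e1] at hν'; norm_num at hν'
  rw [inner_plane, norm_sq_plane]
  ext i; fin_cases i
  · simp; field_simp; linear_combination w 1 * hdet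
  · simp; field_simp; linear_combination -w 0 * hdet

/-- The chord from `p` to `q` cuts the triangle `K` along the line `⟪ν, x⟫ + b = 0`. -/
structure IsChord (K : Finset Plane) (lam : Plane → Plane →ᵃ[ℝ] ℝ) (ν : Plane) (b : ℝ)
    (p q : Plane) : Prop where
  bary : IsBary K lam
  ne_zero : ν ≠ 0
  p_mem : p ∈ hull K
  q_mem : q ∈ hull K
  p_zero : ∃ z ∈ K, lam z p = 0
  q_zero : ∃ z ∈ K, lam z q = 0
  p_level : ⟪ν, p⟫_ℝ + b = 0
  q_level : ⟪ν, q⟫_ℝ + b = 0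
  no_common : ∀ z ∈ K, ¬ (lam z p = 0 ∧ lam z q = 0)

namespace IsChord

variable {K : Finset Plane} {lam : Plane → Plane →ᵃ[ℝ] ℝ} {ν : Plane} {b : ℝ} {p q : Plane}

lemma ne (h : IsChord K lam ν b p q) : p ≠ q := by
  rintro rfl
  obtain ⟨z, hz, h0⟩ := h.p_zero
  exact h.no_common z hz ⟨h0, h0⟩

lemma neg (h : IsChord K lam ν b p q) : IsChord K lam (-ν) (-b) p q where
  __ := h
  ne_zero := neg_ne_zero.2 h.ne_zero
  p_level := by rw [inner_neg_left]; linarith [h.p_level]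
  q_level := by rw [inner_neg_left]; linarith [h.q_level]

lemma inner_sub (h : IsChord K lam ν b p q) : ⟪ν, q - p⟫_ℝ = 0 := by
  rw [inner_sub_right]; linarith [h.p_level, h.q_level]

lemma midpoint_mem (h : IsChord K lam ν b p q) :
    (1 / 2 : ℝ) • p + (1 / 2 : ℝ) • q ∈ interior (hull K) := by
  rw [h.bary.mem_interior_iff]
  intro z hz
  rw [affine_combo _ _ _ _ (by norm_num)]
  have h1 := (h.bary.mem_hull_iff p).1 h.p_mem z hz
  have h2 := (h.bary.mem_hull_iff q).1 h.q_mem z hz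
  rcases h1.eq_or_lt with e1 | e1
  · rcases h2.eq_or_lt with e2 | e2
    · exact absurd ⟨e1.symm, e2.symm⟩ (h.no_common z hz)
    · linarith
  · linarith

lemma mem_segment (h : IsChord K lam ν b p q) {x : Plane} (hx : x ∈ hull K)
    (hx0 : ⟪ν, x⟫_ℝ + b = 0) : x ∈ segment ℝ p q := by
  obtain ⟨t, ht⟩ := eq_smul_of_inner_eq_zero h.ne_zero (sub_ne_zero.2 h.ne.symm)
    (v := x - p) (by rw [inner_sub_right]; linarith [h.p_level]) h.inner_sub
  have hxe : x = (1 - t) • p + t • q := by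
    rw [← sub_add_cancel x p, ht]; module
  have hl : ∀ z, lam z x = (1 - t) * lam z p + t * lam z q := fun z => by
    rw [hxe, affine_combo _ _ _ _ (by ring)]
  have hx' := (h.bary.mem_hull_iff x).1 hx
  have hp' := (h.bary.mem_hull_iff p).1 h.p_mem
  have hq' := (h.bary.mem_hull_iff q).1 h.q_mem
  have t0 : 0 ≤ t := by
    by_contra hneg
    push Not at hneg
    obtain ⟨z, hz, h0⟩ := h.p_zero
    have h1 := hx' z hz
    rw [hl, h0] at h1
    have h2 : lam z q = 0 := by
      have := hq' z hz
      nlinarith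
    exact h.no_common z hz ⟨h0, h2⟩
  have t1 : t ≤ 1 := by
    by_contra hneg
    push Not at hneg
    obtain ⟨z, hz, h0⟩ := h.q_zero
    have h1 := hx' z hz
    rw [hl, h0] at h1
    have h2 : lam z p = 0 := by
      have := hp' z hz
      nlinarith
    exact h.no_common z hz ⟨h2, h0⟩
  exact ⟨1 - t, t, by linarith, t0, by ring, hxe.symm⟩

/-- The part of the triangle on the nonnegative side of the chord is spanned by the end points of
the chord and the vertices on that side. -/
lemma convexHull_eq (h : IsChord K lam ν b p q) {A V W : Set Plane} (hA : A = {p, q})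
    (hV : V ⊆ K) (hW : W ⊆ K) (hK : ∀ z ∈ K, z ∈ V ∨ z ∈ W ∨ z ∈ A)
    (hVp : ∀ z ∈ V, 0 < ⟪ν, z⟫_ℝ + b) (hWm : ∀ z ∈ W, ⟪ν, z⟫_ℝ + b < 0) :
    convexHull ℝ (A ∪ V) = {x | x ∈ hull K ∧ 0 ≤ ⟪ν, x⟫_ℝ + b} := by
  subst hA
  have hsubK : ∀ X : Set Plane, X ⊆ K → convexHull ℝ ({p, q} ∪ X) ⊆ hull K := by
    intro X hX
    refine convexHull_min ?_ (convex_hull K)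
    rintro x ((rfl | rfl) | hx)
    · exact h.p_mem
    · exact h.q_mem
    · exact subset_hull (hX hx)
  have hsubP : convexHull ℝ ({p, q} ∪ V) ⊆ {x | 0 ≤ ⟪ν, x⟫_ℝ + b} := by
    refine convexHull_min ?_ (convex_level_nonneg ν b)
    rintro x ((rfl | rfl) | hx)
    · exact h.p_level.ge
    · exact h.q_level.ge
    · exact (hVp x hx).le
  have hsubM : convexHull ℝ ({p, q} ∪ W) ⊆ {x | 0 ≤ ⟪-ν, x⟫_ℝ + -b} := by
    refine convexHull_min ?_ (convex_level_nonneg (-ν) (-b))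
    rintro x ((rfl | rfl) | hx)
    · exact h.neg.p_level.ge
    · exact h.neg.q_level.ge
    · have := hWm x hx
      simp only [mem_ofPred_eq, inner_neg_left]; linarith
  refine Subset.antisymm (fun x hx => ⟨hsubK V hV hx, hsubP hx⟩) ?_
  rintro x ⟨hxK, hx0⟩
  set S := convexHull ℝ ({p, q} ∪ V) with hS
  set S' := convexHull ℝ ({p, q} ∪ W) with hS'
  have hseg : segment ℝ p q ⊆ S := by
    rw [← convexHull_pair]
    exact convexHull_mono subset_union_left
  have hcov : hull K ⊆ convexJoin ℝ S S' := by
    have hpS : S.Nonempty := ⟨p, subset_convexHull ℝ _ (by simp)⟩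
    have hpS' : S'.Nonempty := ⟨p, subset_convexHull ℝ _ (by simp)⟩
    rw [← Convex.convexHull_union (convex_convexHull ℝ _) (convex_convexHull ℝ _) hpS hpS']
    refine convexHull_mono fun z hz => ?_
    rcases hK z hz with h1 | h1 | h1
    · exact Or.inl (subset_convexHull ℝ _ (Or.inr h1))
    · exact Or.inr (subset_convexHull ℝ _ (Or.inr h1))
    · exact Or.inl (subset_convexHull ℝ _ (Or.inl h1))
  obtain ⟨y, hy, y', hy', hxy⟩ := mem_convexJoin.1 (hcov hxK)
  have hy0 : 0 ≤ ⟪ν, y⟫_ℝ + b := hsubP hy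
  have hy'0 : ⟪ν, y'⟫_ℝ + b ≤ 0 := by
    have : 0 ≤ ⟪-ν, y'⟫_ℝ + -b := hsubM hy'
    rw [inner_neg_left] at this; linarith
  obtain ⟨s, t, hs, ht, hst, rfl⟩ := hxy
  rcases hx0.eq_or_lt with hx0 | hx0
  · exact hseg (h.mem_segment hxK hx0.symm)
  rw [level_combo ν b y y' hst] at hx0
  set u := ⟪ν, y⟫_ℝ + b with hu
  set u' := ⟪ν, y'⟫_ℝ + b with hu'
  have hupos : 0 < u := by
    by_contra hcon
    have : u = 0 := le_antisymm (not_lt.1 hcon) hy0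
    rw [this] at hx0; nlinarith
  have hden : 0 < u - u' := by linarith
  set μ := u / (u - u') with hμ
  have hμ0 : 0 < μ := by positivity
  have hμ1 : μ ≤ 1 := by rw [hμ, div_le_one hden]; linarith
  set m := (1 - μ) • y + μ • y' with hm
  have hmK : m ∈ hull K := convex_hull K (hsubK V hV hy) (hsubK W hW hy') (by linarith) hμ0.le
    (by ring)
  have hm0 : ⟪ν, m⟫_ℝ + b = 0 := by
    rw [hm, level_combo ν b y y' (by ring), hμ]
    field_simp; ring
  have hmS : m ∈ S := hseg (h.mem_segment hmK hm0)
  have htμ : t ≤ μ := by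
    rw [hμ, le_div_iff₀ hden]
    have : s = 1 - t := by linarith
    rw [this] at hx0; nlinarith
  have hxe : s • y + t • y' = (1 - t / μ) • y + (t / μ) • m := by
    have : s = 1 - t := by linarith
    rw [hm, this, smul_add, smul_smul, smul_smul, ← add_assoc, ← add_smul]
    congr 2
    · field_simp; ring
    · field_simp
  rw [hxe]
  exact convex_convexHull ℝ _ hy hmS (by rw [sub_nonneg, div_le_one hμ0]; exact htμ)
    (by positivity) (by ring)

end IsChord

namespace Mesh

variable {P : InterfaceProblem} (T : Mesh P)

/-- The data of an interface element. -/
structure IsCut (K : Finset Plane) (lam : Plane → Plane →ᵃ[ℝ] ℝ) (ν : Plane) (b s t : ℝ) :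
    Prop where
  chord : IsChord K lam ν b (P.γ s) (P.γ t)
  lt : s < t
  lt' : t < s + P.len
  image : P.γ '' Icc s t = P.Γ ∩ hull K
  frontier : P.Γ ∩ frontier (hull K) = {P.γ s, P.γ t}
  pos : ∀ z ∈ K, z ∈ closure P.Ωp \ P.Γ → 0 < ⟪ν, z⟫_ℝ + b
  neg : ∀ z ∈ K, z ∈ closure P.Ωm \ P.Γ → ⟪ν, z⟫_ℝ + b < 0

lemma exists_isCut (hcut : T.RegularCut) {K : Finset Plane} (hK : T.IsInterfaceElement K) :
    ∃ lam ν b s t, IsCut (P := P) K lam ν b s t := by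
  obtain ⟨s, t, hst, hts, himg, hfr, hne, ℓ, hs0, ht0, hp, hm⟩ := hcut.element K hK
  obtain ⟨lam, hl⟩ := T.exists_isBary hK.1
  rw [affine_eq_inner] at hs0 ht0
  have hsf : P.γ s ∈ P.Γ ∩ frontier (hull K) := by rw [hfr]; simp
  have htf : P.γ t ∈ P.Γ ∩ frontier (hull K) := by rw [hfr]; simp
  have hsf' := (hl.mem_frontier_iff _).1 hsf.2
  have htf' := (hl.mem_frontier_iff _).1 htf.2
  refine ⟨lam, affGrad ℓ, ℓ 0, s, t, ⟨⟨hl, ?_, hsf'.1, htf'.1, hsf'.2, htf'.2, hs0, ht0, ?_⟩, hst,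
    hts, himg, hfr, fun z hz hz' => by rw [← affine_eq_inner]; exact hp z hz hz',
    fun z hz hz' => by rw [← affine_eq_inner]; exact hm z hz hz'⟩⟩
  · intro h0
    have hb : ∀ z, ℓ z = 0 := by
      intro z
      rw [affine_eq_inner, h0, inner_zero_left]
      rw [h0, inner_zero_left] at hs0; exact hs0
    have hsub : K ⊆ {P.γ s, P.γ t} := by
      intro z hz
      have hzf : z ∈ IFEM.hull K := subset_hull hz
      have hzc := T.hull_subset_closure hK.1 hzf
      by_cases hzΓ : z ∈ P.Γ
      · have : z ∈ P.Γ ∩ _root_.frontier (hull K) := by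
          refine ⟨hzΓ, (hl.mem_frontier_iff z).2 ⟨hzf, ?_⟩⟩
          obtain ⟨w, hw, hwz⟩ := Finset.exists_mem_ne
            (show 1 < K.card by rw [T.card_eq K hK.1]; norm_num) z
          exact ⟨w, hw, hl.ne w hw z hz hwz⟩
        rw [hfr] at this
        simpa using this
      · rcases P.mem_closure_side hzc hzΓ with h | h
        · exact absurd (hb z) (hp z hz ⟨h, hzΓ⟩).ne'
        · exact absurd (hb z) (hm z hz ⟨h, hzΓ⟩).ne
    have h1 := Finset.card_le_card hsub
    have h2 := Finset.card_le_two (a := P.γ s) (b := P.γ t)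
    rw [T.card_eq K hK.1] at h1
    omega
  · rintro z hz ⟨h1, h2⟩
    have hmem : ∀ x, x ∈ hull K → lam z x = 0 → x ∈ hull (K.erase z) := by
      intro x hx hx0
      rw [hl.mem_hull_subset_iff (Finset.erase_subset _ _)]
      refine ⟨hx, fun w hw hwz => ?_⟩
      have : w = z := by
        by_contra hcon
        exact hwz (Finset.mem_erase.2 ⟨hcon, hw⟩)
      rw [this]; exact hx0
    refine hne (K.erase z) ?_ ⟨hmem _ hsf'.1 h1, hmem _ htf'.1 h2⟩
    rw [edgesOf, Finset.mem_powersetCard]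
    exact ⟨Finset.erase_subset _ _, by rw [Finset.card_erase_of_mem hz, T.card_eq K hK.1]⟩

namespace IsCut

variable {T}
variable {K : Finset Plane} {lam : Plane → Plane →ᵃ[ℝ] ℝ} {ν : Plane} {b s t : ℝ}

lemma level_eq_zero (h : IsCut (P := P) K lam ν b s t) {x : Plane}
    (hx : x ∈ P.Γ ∩ _root_.frontier (hull K)) : ⟪ν, x⟫_ℝ + b = 0 := by
  rw [h.frontier] at hx
  rcases hx with rfl | rfl
  · exact h.chord.p_level
  · exact h.chord.q_level

lemma vertex_cases (h : IsCut (P := P) K lam ν b s t) (hK : K ∈ T.elements) {z : Plane}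
    (hz : z ∈ K) : z ∈ {z | z ∈ K ∧ z ∈ closure P.Ωp \ P.Γ} ∨
      z ∈ {z | z ∈ K ∧ z ∈ closure P.Ωm \ P.Γ} ∨ z ∈ P.Γ ∩ _root_.frontier (hull K) := by
  have hzf : z ∈ IFEM.hull K := subset_hull hz
  by_cases hzΓ : z ∈ P.Γ
  · refine Or.inr (Or.inr ⟨hzΓ, (h.chord.bary.mem_frontier_iff z).2 ⟨hzf, ?_⟩⟩)
    obtain ⟨w, hw, hwz⟩ := Finset.exists_mem_ne
      (show 1 < K.card by rw [T.card_eq K hK]; norm_num) z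
    exact ⟨w, hw, h.chord.bary.ne w hw z hz hwz⟩
  · rcases P.mem_closure_side (T.hull_subset_closure hK hzf) hzΓ with hc | hc
    · exact Or.inl ⟨hz, hc, hzΓ⟩
    · exact Or.inr (Or.inl ⟨hz, hc, hzΓ⟩)

lemma subElement_pos (h : IsCut (P := P) K lam ν b s t) (hK : K ∈ T.elements) :
    T.subElement P.Ωp K = {x | x ∈ hull K ∧ 0 ≤ ⟪ν, x⟫_ℝ + b} :=
  h.chord.convexHull_eq h.frontier (fun _ hz => hz.1) (fun _ hz => hz.1)
    (fun _ hz => h.vertex_cases hK hz) (fun z hz => h.pos z hz.1 hz.2)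
    (fun z hz => h.neg z hz.1 hz.2)

lemma subElement_neg (h : IsCut (P := P) K lam ν b s t) (hK : K ∈ T.elements) :
    T.subElement P.Ωm K = {x | x ∈ hull K ∧ ⟪ν, x⟫_ℝ + b ≤ 0} := by
  have := h.chord.neg.convexHull_eq (V := {z | z ∈ K ∧ z ∈ closure P.Ωm \ P.Γ})
    (W := {z | z ∈ K ∧ z ∈ closure P.Ωp \ P.Γ}) h.frontier (fun _ hz => hz.1) (fun _ hz => hz.1)
    (fun z hz => by have := h.vertex_cases hK hz; tauto)
    (fun z hz => by rw [inner_neg_left]; linarith [h.neg z hz.1 hz.2])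
    (fun z hz => by rw [inner_neg_left]; linarith [h.pos z hz.1 hz.2])
  rw [subElement, this]
  ext x
  simp only [mem_ofPred_eq, inner_neg_left]
  constructor <;> rintro ⟨h1, h2⟩ <;> exact ⟨h1, by linarith⟩

lemma αt_pos (h : IsCut (P := P) K lam ν b s t) (hK : T.IsInterfaceElement K) {x : Plane}
    (hx : x ∈ hull K) (hx0 : 0 < ⟪ν, x⟫_ℝ + b) : T.αt K x = P.αp := by
  rw [αt, if_pos hK, if_pos]
  rw [h.subElement_pos hK.1]; exact ⟨hx, hx0.le⟩

lemma αt_neg (h : IsCut (P := P) K lam ν b s t) (hK : T.IsInterfaceElement K) {x : Plane}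
    (hx0 : ⟪ν, x⟫_ℝ + b < 0) : T.αt K x = P.αm := by
  rw [αt, if_pos hK, if_neg]
  rw [h.subElement_pos hK.1]
  rintro ⟨-, h2⟩
  linarith

lemma ae_αt_eq (h : IsCut (P := P) K lam ν b s t) (hK : T.IsInterfaceElement K) :
    ∀ᵐ x ∂(volume.restrict (hull K)), x ∉ T.S K → T.αt K x = P.α x := by
  have hline : ∀ᵐ x : Plane, ⟪ν, x⟫_ℝ + b ≠ 0 :=
    compl_mem_ae_iff.2 (volume_affine_eq_zero (Or.inl h.chord.ne_zero))
  have hΓ : ∀ᵐ x : Plane, x ∉ P.Γ := compl_mem_ae_iff.2 P.volume_Γ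
  filter_upwards [ae_mem_interior K, ae_restrict_of_ae hline, ae_restrict_of_ae hΓ]
    with x hx h1 h2 hxS
  have hxK := interior_subset hx
  rw [S, if_pos hK] at hxS
  rcases P.mem_side (T.interior_hull_subset hK.1 hx) h2 with hp | hm
  · rw [P.α_of_mem_Ωp hp]
    have : x ∈ T.subElement P.Ωp K := by
      by_contra hcon
      exact hxS (Or.inl ⟨⟨hxK, hp⟩, hcon⟩)
    rw [αt, if_pos hK, if_pos this]
  · rw [P.α_of_mem_Ωm hm]
    have : x ∈ T.subElement P.Ωm K := by
      by_contra hcon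
      exact hxS (Or.inr ⟨⟨hxK, hm⟩, hcon⟩)
    rw [h.subElement_neg hK.1] at this
    exact h.αt_neg hK (lt_of_le_of_ne this.2 h1)

end IsCut

end Mesh

/-! ### Signs of the cut line on the edges -/

lemma combo_mem_segment {a b : Plane} {t : ℝ} (h0 : 0 ≤ t) (h1 : t ≤ 1) :
    (1 - t) • a + t • b ∈ segment ℝ a b := ⟨1 - t, t, by linarith, h0, by ring, rfl⟩

lemma left_mem_closure_sdiff_segment {a x : Plane} (h : a ≠ x) :
    a ∈ closure (segment ℝ a x \ {a}) := by
  have h1 : openSegment ℝ a x ⊆ segment ℝ a x \ {a} := fun y hy =>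
    ⟨openSegment_subset_segment ℝ a x hy, fun hya => by
      rw [mem_singleton_iff] at hya
      subst hya
      exact h (left_mem_openSegment_iff.1 hy)⟩
  exact closure_mono h1 (by rw [closure_openSegment]; exact left_mem_segment ℝ a x)

lemma convex_segment_sdiff_left (a x : Plane) : Convex ℝ (segment ℝ a x \ {a}) := by
  by_cases hax : a = x
  · subst hax; simp [convex_empty]
  have : segment ℝ a x \ {a} = (fun t : ℝ => (1 - t) • a + t • x) '' Ioc 0 1 := by
    ext y
    constructor
    · rintro ⟨hy, hya⟩
      rw [segment_eq_image] at hy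
      obtain ⟨t, ⟨h0, h1⟩, rfl⟩ := hy
      refine ⟨t, ⟨lt_of_le_of_ne h0 ?_, h1⟩, rfl⟩
      rintro rfl; simp at hya
    · rintro ⟨t, ⟨h0, h1⟩, rfl⟩
      refine ⟨combo_mem_segment h0.le h1, ?_⟩
      intro h
      simp only [mem_singleton_iff] at h
      have : t • (x - a) = 0 := by
        have h2 : (1 - t) • a + t • x - a = t • (x - a) := by module
        rw [← h2, h, sub_self]
      rcases smul_eq_zero.1 this with h | h
      · exact h0.ne' h
      · exact hax (sub_eq_zero.1 h).symm
  rw [this]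
  intro y hy z hz r s hr hs hrs
  obtain ⟨t, ht, rfl⟩ := hy
  obtain ⟨u, hu, rfl⟩ := hz
  refine ⟨r * t + s * u, convex_Ioc 0 1 ht hu hr hs hrs, ?_⟩
  have : r = 1 - s := by linarith
  subst this
  module

/-- An abstract form of the sign rule: along an edge with at most one interface point the cut
function is positive on the side `U`. -/
lemma level_pos_of_mem_side {P : InterfaceProblem} {U : Set Plane} {ν : Plane} {c : ℝ}
    (hU : ∀ C : Set Plane, IsPreconnected C → C ⊆ P.Ω → (∀ x ∈ C, x ∉ P.Γ) → ∀ x ∈ C, x ∈ U → C ⊆ U)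
    {a b x : Plane} (hF : hull {a, b} \ ({a, b} : Finset Plane) ⊆ P.Ω)
    (hsub : (hull {a, b} ∩ P.Γ).Subsingleton)
    (ha : a ∈ closure U \ P.Γ → 0 < ⟪ν, a⟫_ℝ + c) (hb : b ∈ closure U \ P.Γ → 0 < ⟪ν, b⟫_ℝ + c)
    (hΓ : ∀ y ∈ hull {a, b}, y ∈ P.Γ → ⟪ν, y⟫_ℝ + c = 0)
    (hx : x ∈ hull {a, b} \ ({a, b} : Finset Plane)) (hxU : x ∈ U) (hxΓ : x ∉ P.Γ) :
    0 < ⟪ν, x⟫_ℝ + c := by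
  obtain ⟨τ, h0, h1, hxe⟩ := Mesh.mem_sdiff_pair hx
  have hxm := hx
  simp only [hull_pair] at hF hsub hΓ hxm
  have hxne : x ≠ a ∧ x ≠ b := by
    constructor <;> rintro rfl <;> exact hx.2 (by simp)
  -- an end that is connected to `x` off the interface lies on the positive side
  have hend : ∀ e e' : Plane, segment ℝ e e' = segment ℝ a b → (e = a ∨ e = b) →
      x ∈ segment ℝ e e' → (∀ y ∈ segment ℝ e x, y ∉ P.Γ) → 0 < ⟪ν, e⟫_ℝ + c := by
    intro e e' hee he hxe' hmiss
    have hex : e ≠ x := by rcases he with rfl | rfl; exacts [hxne.1.symm, hxne.2.symm]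
    have hsubseg : segment ℝ e x ⊆ segment ℝ a b := by
      rw [← hee]; exact (convex_segment e e').segment_subset (left_mem_segment ℝ e e') hxe'
    have hC := hU (segment ℝ e x \ {e}) (convex_segment_sdiff_left e x).isPreconnected
      (fun y hy => by
        by_cases hyab : y ∈ ({a, b} : Finset Plane)
        · simp only [Finset.mem_insert, Finset.mem_singleton] at hyab
          exfalso
          -- the other end does not lie between `e` and `x`
          obtain ⟨t, ht0, ht1, hyt⟩ : ∃ t : ℝ, 0 ≤ t ∧ t ≤ 1 ∧ y = (1 - t) • e + t • x := by
            have := hy.1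
            rw [segment_eq_image] at this
            obtain ⟨t, ht, rfl⟩ := this
            exact ⟨t, ht.1, ht.2, rfl⟩
          have hba : b - a ≠ 0 := by
            intro h
            rw [sub_eq_zero] at h
            subst h
            have : x = b := by rw [hxe]; module
            exact hxne.1 this
          have key : ∀ r : ℝ, r • (b - a) = 0 → r = 0 := fun r hr =>
            (smul_eq_zero.1 hr).resolve_right hba
          have hye : y ≠ e := hy.2
          rcases he with rfl | rfl
          · rcases hyab with h | h
            · exact hye h
            · have : (1 - t * τ) • (b - e) = 0 := by
                have : b - y = (1 - t * τ) • (b - e) := by rw [hyt, hxe]; module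
                rw [← this, h, sub_self]
              have := key _ this
              nlinarith
          · rcases hyab with h | h
            · have : (1 - t * (1 - τ)) • (e - a) = 0 := by
                have : y - a = (1 - t * (1 - τ)) • (e - a) := by rw [hyt, hxe]; module
                rw [← this, h, sub_self]
              have := key _ this
              nlinarith
            · exact hye h
        · exact hF ⟨hsubseg hy.1, by simpa using hyab⟩)
      (fun y hy => hmiss y hy.1) x ⟨right_mem_segment ℝ e x, hex.symm⟩ hxU
    have hcl : e ∈ closure U \ P.Γ :=
      ⟨closure_mono hC (left_mem_closure_sdiff_segment hex), hmiss e (left_mem_segment ℝ e x)⟩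
    rcases he with rfl | rfl
    exacts [ha hcl, hb hcl]
  have hlx : ⟪ν, x⟫_ℝ + c = (1 - τ) * (⟪ν, a⟫_ℝ + c) + τ * (⟪ν, b⟫_ℝ + c) := by
    rw [hxe, level_combo ν c a b (by ring)]
  have hpar : ∀ t : ℝ, ⟪ν, (1 - t) • a + t • b⟫_ℝ + c
      = (1 - t) * (⟪ν, a⟫_ℝ + c) + t * (⟪ν, b⟫_ℝ + c) := fun t =>
    level_combo ν c a b (by ring)
  have hsa : segment ℝ a x ⊆ segment ℝ a b :=
    (convex_segment a b).segment_subset (left_mem_segment ℝ a b) hxm.1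
  have hsb : segment ℝ b x ⊆ segment ℝ a b :=
    (convex_segment a b).segment_subset (right_mem_segment ℝ a b) hxm.1
  -- parameters of points in the two halves
  have hparA : ∀ y ∈ segment ℝ a x, ∃ t, 0 ≤ t ∧ t ≤ τ ∧ y = (1 - t) • a + t • b := by
    intro y hy
    rw [segment_eq_image] at hy
    obtain ⟨u, ⟨hu0, hu1⟩, rfl⟩ := hy
    exact ⟨u * τ, by positivity, by nlinarith, by rw [hxe]; module⟩
  have hparB : ∀ y ∈ segment ℝ b x, ∃ t, τ ≤ t ∧ t ≤ 1 ∧ y = (1 - t) • a + t • b := by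
    intro y hy
    rw [segment_eq_image] at hy
    obtain ⟨u, ⟨hu0, hu1⟩, rfl⟩ := hy
    exact ⟨1 - u * (1 - τ), by nlinarith, by nlinarith, by rw [hxe]; module⟩
  by_cases hA : ∀ y ∈ segment ℝ a x, y ∉ P.Γ
  · have hapos := hend a b rfl (Or.inl rfl) hxm.1 hA
    by_cases hB : ∀ y ∈ segment ℝ b x, y ∉ P.Γ
    · have hbpos := hend b a (segment_symm ℝ b a) (Or.inr rfl) (by rw [segment_symm]; exact hxm.1) hB
      rw [hlx]; nlinarith
    · push Not at hB
      obtain ⟨y, hy, hyΓ⟩ := hB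
      obtain ⟨t, ht0, ht1, hye⟩ := hparB y hy
      have hy0 := hΓ y (hsb hy) hyΓ
      have htτ : τ < t := by
        refine lt_of_le_of_ne ht0 ?_
        rintro rfl
        rw [← hxe] at hye
        exact hxΓ (hye ▸ hyΓ)
      rw [hye, hpar] at hy0
      rw [hlx]
      have e1 : t * ((1 - τ) * (⟪ν, a⟫_ℝ + c) + τ * (⟪ν, b⟫_ℝ + c)) = (t - τ) * (⟪ν, a⟫_ℝ + c) := by
        linear_combination τ * hy0
      have e2 : 0 < (t - τ) * (⟪ν, a⟫_ℝ + c) := mul_pos (by linarith) hapos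
      rw [← e1] at e2
      exact (mul_pos_iff_of_pos_left (by linarith)).1 e2
  · have hB : ∀ y ∈ segment ℝ b x, y ∉ P.Γ := by
      push Not at hA
      obtain ⟨y, hy, hyΓ⟩ := hA
      intro z hz hzΓ
      obtain ⟨t, ht0, ht1, hye⟩ := hparA y hy
      obtain ⟨t', ht'0, ht'1, hze⟩ := hparB z hz
      have hyz : y = z := hsub ⟨hsa hy, hyΓ⟩ ⟨hsb hz, hzΓ⟩
      have hba : b - a ≠ 0 := by
        intro h
        rw [sub_eq_zero] at h
        subst h
        have : x = b := by rw [hxe]; module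
        exact hxne.1 this
      have : (t - t') • (b - a) = 0 := by
        have h2 : y - z = (t - t') • (b - a) := by rw [hye, hze]; module
        rw [← h2, hyz, sub_self]
      have htt := (smul_eq_zero.1 this).resolve_right hba
      have : t = τ := by linarith
      rw [this, ← hxe] at hye
      exact hxΓ (hye ▸ hyΓ)
    have hbpos := hend b a (segment_symm ℝ b a) (Or.inr rfl) (by rw [segment_symm]; exact hxm.1) hB
    push Not at hA
    obtain ⟨y, hy, hyΓ⟩ := hA
    obtain ⟨t, ht0, ht1, hye⟩ := hparA y hy
    have hy0 := hΓ y (hsa hy) hyΓ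
    have htτ : t < τ := by
      refine lt_of_le_of_ne ht1 ?_
      rintro rfl
      rw [← hxe] at hye
      exact hxΓ (hye ▸ hyΓ)
    rw [hye, hpar] at hy0
    rw [hlx]
    have e1 : (1 - t) * ((1 - τ) * (⟪ν, a⟫_ℝ + c) + τ * (⟪ν, b⟫_ℝ + c)) = (τ - t) * (⟪ν, b⟫_ℝ + c) := by
      linear_combination (1 - τ) * hy0
    have e2 : 0 < (τ - t) * (⟪ν, b⟫_ℝ + c) := mul_pos (by linarith) hbpos
    rw [← e1] at e2
    exact (mul_pos_iff_of_pos_left (by linarith)).1 e2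

namespace Mesh

variable {P : InterfaceProblem} (T : Mesh P)

lemma subset_side_p (C : Set Plane) (hC : IsPreconnected C) (hΩ : C ⊆ P.Ω)
    (hΓ : ∀ x ∈ C, x ∉ P.Γ) : ∀ x ∈ C, x ∈ P.Ωp → C ⊆ P.Ωp := by
  intro x hx hxp
  rcases P.subset_side hC hΩ hΓ with h | h
  · exact h
  · exact absurd (⟨hxp, h hx⟩ : x ∈ P.Ωp ∩ P.Ωm) (fun h' => P.disjoint_Ω.le_bot h')

lemma subset_side_m (C : Set Plane) (hC : IsPreconnected C) (hΩ : C ⊆ P.Ω)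
    (hΓ : ∀ x ∈ C, x ∉ P.Γ) : ∀ x ∈ C, x ∈ P.Ωm → C ⊆ P.Ωm := by
  intro x hx hxp
  rcases P.subset_side hC hΩ hΓ with h | h
  · exact absurd (⟨h hx, hxp⟩ : x ∈ P.Ωp ∩ P.Ωm) (fun h' => P.disjoint_Ω.le_bot h')
  · exact h

lemma hull_edge_subset_frontier {K F : Finset Plane} (hK : K ∈ T.elements) (hF : F ∈ edgesOf K) :
    hull F ⊆ frontier (hull K) := by
  obtain ⟨lam, hl⟩ := T.exists_isBary hK
  have hF' := Finset.mem_powersetCard.1 hF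
  obtain ⟨z, hz, hzF⟩ : ∃ z ∈ K, z ∉ F := by
    by_contra hcon
    push Not at hcon
    have := Finset.card_le_card hcon
    rw [T.card_eq K hK, hF'.2] at this
    omega
  intro x hx
  rw [hl.mem_frontier_iff]
  obtain ⟨h1, h2⟩ := (hl.mem_hull_subset_iff hF'.1 x).1 hx
  exact ⟨h1, z, hz, h2 z hz hzF⟩

/-- A non-interface element lies on one side of the interface. -/
lemma interior_subset_side {K : Finset Plane} (hK : K ∈ T.elements) (hni : ¬ T.IsInterfaceElement K) :
    interior (hull K) ⊆ P.Ωp ∨ interior (hull K) ⊆ P.Ωm := by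
  refine P.subset_side (IsBary.isPreconnected_interior K) (T.interior_hull_subset hK) ?_
  intro x hx hxΓ
  exact hni ⟨hK, x, hx, hxΓ⟩

lemma hull_subset_closure_interior {K : Finset Plane} (hK : K ∈ T.elements) :
    hull K ⊆ closure (interior (hull K)) := by
  obtain ⟨lam, hl⟩ := T.exists_isBary hK
  exact hl.hull_subset_closure_interior (T.nonempty_of_mem hK)

lemma interior_nonempty {K : Finset Plane} (hK : K ∈ T.elements) :
    (interior (hull K)).Nonempty := by
  obtain ⟨z, hz⟩ := T.nonempty_of_mem hK
  exact closure_nonempty_iff.1 ⟨z, T.hull_subset_closure_interior hK (subset_hull hz)⟩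

lemma isInterfaceElement_of_mem {K : Finset Plane} (hK : K ∈ T.elements) {x y : Plane}
    (hx : x ∈ hull K) (hxp : x ∈ P.Ωp) (hy : y ∈ hull K) (hym : y ∈ P.Ωm) :
    T.IsInterfaceElement K := by
  by_contra hni
  rcases T.interior_subset_side hK hni with h | h
  · obtain ⟨z, hz, hz'⟩ := mem_closure_iff.1 (T.hull_subset_closure_interior hK hy) _ P.isOpen_Ωm hym
    exact P.disjoint_Ω.le_bot ⟨h hz', hz⟩
  · obtain ⟨z, hz, hz'⟩ := mem_closure_iff.1 (T.hull_subset_closure_interior hK hx) _ P.isOpen_Ωp hxp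
    exact P.disjoint_Ω.le_bot ⟨hz, h hz'⟩

/-- The two phases of a piecewise affine function on the element `K`. On an element that is not
cut, the separating function `⟪ν, x⟫ + b` is a constant. -/
structure Phase (v : Broken) (K : Finset Plane) (gp gm ν : Plane) (b : ℝ) : Prop where
  ne : ν ≠ 0 ∨ b ≠ 0
  pos : ∀ x ∈ hull K, 0 < ⟪ν, x⟫_ℝ + b → T.αt K x = P.αp ∧ grad v K x = gp
  neg : ∀ x ∈ hull K, ⟪ν, x⟫_ℝ + b < 0 → T.αt K x = P.αm ∧ grad v K x = gm
  flux : P.αp * ⟪gp, ν⟫_ℝ = P.αm * ⟪gm, ν⟫_ℝ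
  tang : ∀ e, ⟪ν, e⟫_ℝ = 0 → ⟪gp, e⟫_ℝ = ⟪gm, e⟫_ℝ
  alpha : ∀ᵐ x ∂(volume.restrict (hull K)), x ∉ T.S K → T.αt K x = P.α x
  edge_pos : ∀ F ∈ edgesOf K, hull F \ F ⊆ P.Ω → (hull F ∩ P.Γ).Subsingleton →
    ∀ x ∈ hull F \ F, x ∈ P.Ωp → 0 < ⟪ν, x⟫_ℝ + b
  edge_neg : ∀ F ∈ edgesOf K, hull F \ F ⊆ P.Ω → (hull F ∩ P.Γ).Subsingleton →
    ∀ x ∈ hull F \ F, x ∈ P.Ωm → ⟪ν, x⟫_ℝ + b < 0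
  edge_const : ∀ F ∈ edgesOf K, (∀ x ∈ hull F, x ∉ P.Γ) →
    (∀ x ∈ hull F, 0 < ⟪ν, x⟫_ℝ + b) ∨ (∀ x ∈ hull F, ⟪ν, x⟫_ℝ + b < 0)
  chord : T.IsInterfaceElement K → ν ≠ 0 ∧ ∃ s t, s < t ∧ t < s + P.len ∧
    P.γ '' Icc s t = P.Γ ∩ hull K ∧ P.Γ ∩ frontier (hull K) = {P.γ s, P.γ t} ∧
    ⟪ν, P.γ t - P.γ s⟫_ℝ = 0 ∧ P.γ s ≠ P.γ t

lemma exists_phase_nonInterface {v : Broken} (hv : T.IsIFE v) {K : Finset Plane}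
    (hK : K ∈ T.elements) (hni : ¬ T.IsInterfaceElement K) :
    ∃ gp gm ν b, T.Phase v K gp gm ν b := by
  obtain ⟨f, hf⟩ := hv.nonInterface K hK hni
  have hgrad : ∀ x ∈ hull K, grad v K x = affGrad f := fun x hx =>
    gradientWithin_eq_affGrad (convex_hull K) (T.interior_nonempty hK) hx
      (hf.eventuallyEq_of_mem self_mem_nhdsWithin)
  by_cases hp : interior (hull K) ⊆ P.Ωp
  · have hα : ∀ x, T.αt K x = P.αp := fun x => by rw [αt, if_neg hni, if_pos hp]
    refine ⟨affGrad f, affGrad f, 0, 1, ⟨by simp, fun x hx _ => ⟨hα x, hgrad x hx⟩,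
      fun x _ h => ?_, by simp, fun e _ => rfl, ?_, by simp, ?_, ?_, fun h => absurd h hni⟩⟩
    · simp at h; linarith
    · filter_upwards [ae_mem_interior K] with x hx _
      rw [hα, P.α_of_mem_Ωp (hp hx)]
    · intro F hF _ _ x hx hxm
      exfalso
      have hxK := hull_mono (Finset.mem_powersetCard.1 hF).1 hx.1
      obtain ⟨z, hz, hz'⟩ := mem_closure_iff.1 (T.hull_subset_closure_interior hK hxK) _
        P.isOpen_Ωm hxm
      exact P.disjoint_Ω.le_bot ⟨hp hz', hz⟩
    · intro F _ _; left; intro x _; simp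
  · have hm := (T.interior_subset_side hK hni).resolve_left hp
    have hα : ∀ x, T.αt K x = P.αm := fun x => by rw [αt, if_neg hni, if_neg hp]
    refine ⟨affGrad f, affGrad f, 0, -1, ⟨by simp, fun x _ h => ?_,
      fun x hx _ => ⟨hα x, hgrad x hx⟩, by simp, fun e _ => rfl, ?_, ?_, by simp, ?_,
      fun h => absurd h hni⟩⟩
    · simp at h; linarith
    · filter_upwards [ae_mem_interior K] with x hx _
      rw [hα, P.α_of_mem_Ωm (hm hx)]
    · intro F hF _ _ x hx hxm
      exfalso
      have hxK := hull_mono (Finset.mem_powersetCard.1 hF).1 hx.1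
      obtain ⟨z, hz, hz'⟩ := mem_closure_iff.1 (T.hull_subset_closure_interior hK hxK) _
        P.isOpen_Ωp hxm
      exact P.disjoint_Ω.le_bot ⟨hz, hm hz'⟩
    · intro F _ _; right; intro x _; simp

lemma IsCut.edge_const {T : Mesh P} {K : Finset Plane} {lam : Plane → Plane →ᵃ[ℝ] ℝ} {ν : Plane} {b s t : ℝ}
    (h : IsCut (P := P) K lam ν b s t) (hK : K ∈ T.elements) {F : Finset Plane}
    (hF : F ∈ edgesOf K) (hΓ : ∀ x ∈ hull F, x ∉ P.Γ) :
    (∀ x ∈ hull F, 0 < ⟪ν, x⟫_ℝ + b) ∨ (∀ x ∈ hull F, ⟪ν, x⟫_ℝ + b < 0) := by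
  have hl := h.chord.bary
  obtain ⟨a, e, c, hae, hac, hec, hFe, hKe⟩ := exists_vertices (T.card_eq K hK) hF
  have haK : a ∈ K := by rw [hKe]; simp
  have heK : e ∈ K := by rw [hKe]; simp
  have hcK : c ∈ K := by rw [hKe]; simp
  have hFK : F ⊆ K := (Finset.mem_powersetCard.1 hF).1
  have hmemF : ∀ x ∈ hull K, lam c x = 0 → x ∈ hull F := by
    intro x hx hx0
    rw [hl.mem_hull_subset_iff hFK]
    refine ⟨hx, fun z hz hzF => ?_⟩
    rw [hKe] at hz
    rw [hFe] at hzF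
    simp only [Finset.mem_insert, Finset.mem_singleton, not_or] at hz hzF
    have : z = c := by tauto
    rw [this, hx0]
  obtain ⟨ε, hε, hεΓ⟩ : ∃ ε : ℝ, 0 < ε ∧ ∀ x ∈ hull K, x ∈ P.Γ → ε ≤ lam c x := by
    have hcomp : IsCompact (hull K ∩ P.Γ) := (isCompact_hull K).inter P.isCompact_Γ
    have hne : (hull K ∩ P.Γ).Nonempty := ⟨P.γ s, h.chord.p_mem, ⟨s, rfl⟩⟩
    obtain ⟨x, hx, hmin⟩ := hcomp.exists_isMinOn hne (affine_continuous (lam c)).continuousOn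
    refine ⟨lam c x, lt_of_le_of_ne ((hl.mem_hull_iff x).1 hx.1 c hcK) ?_, fun y hy hyΓ => hmin ⟨hy, hyΓ⟩⟩
    intro h0
    exact hΓ x (hmemF x hx.1 h0.symm) hx.2
  let C : Set Plane := interior (hull K) ∩ {x | lam c x < ε}
  have hCconv : Convex ℝ C := by
    refine (convex_hull K).interior.inter ?_
    intro x hx y hy r u hr hu hru
    simp only [mem_ofPred_eq] at hx hy ⊢
    rw [affine_combo _ _ _ _ hru]
    rcases hr.eq_or_lt with h0 | h0
    · subst h0; have : u = 1 := by linarith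
      rw [this]; linarith
    · have : u = 1 - r := by linarith
      subst this
      nlinarith
  have hCcl : ∀ x ∈ hull F, x ∈ closure C := by
    intro x hx
    obtain ⟨hxK, hx0⟩ := (hl.mem_hull_subset_iff hFK x).1 hx
    have hx0 := hx0 c hcK (by rw [hFe]; simp [hac.symm, hec.symm])
    have hopen : IsOpen {x | lam c x < ε} := isOpen_lt (affine_continuous _) continuous_const
    have hxin : x ∈ {x | lam c x < ε} := by simp only [mem_ofPred_eq, hx0]; exact hε
    rw [mem_closure_iff]
    intro o ho hxo
    obtain ⟨y, hy, hyK⟩ := mem_closure_iff.1 (T.hull_subset_closure_interior hK hxK)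
      (o ∩ {x | lam c x < ε}) (ho.inter hopen) ⟨hxo, hxin⟩
    exact ⟨y, hy.1, hyK, hy.2⟩
  have hside := P.subset_side hCconv.isPreconnected
    (fun x hx => T.interior_hull_subset hK hx.1) (fun x hx hxΓ => by
      have h1 := hεΓ x (interior_subset hx.1) hxΓ
      have h2 : lam c x < ε := hx.2
      linarith)
  have haF : a ∈ hull F := subset_hull (by rw [hFe]; simp)
  have heF : e ∈ hull F := subset_hull (by rw [hFe]; simp)
  have hlev : ∀ x ∈ hull F, ∃ r : ℝ, 0 ≤ r ∧ r ≤ 1 ∧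
      ⟪ν, x⟫_ℝ + b = (1 - r) * (⟪ν, a⟫_ℝ + b) + r * (⟪ν, e⟫_ℝ + b) := by
    intro x hx
    rw [hFe, hull_pair, segment_eq_image] at hx
    obtain ⟨r, ⟨h0, h1⟩, rfl⟩ := hx
    exact ⟨r, h0, h1, level_combo ν b a e (by ring)⟩
  rcases hside with hs | hs
  · left
    have h1 := h.pos a haK ⟨closure_mono hs (hCcl a haF), hΓ a haF⟩
    have h2 := h.pos e heK ⟨closure_mono hs (hCcl e heF), hΓ e heF⟩
    intro x hx
    obtain ⟨r, h3, h4, h5⟩ := hlev x hx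
    rw [h5]
    rcases h3.eq_or_lt with h0 | h0
    · rw [← h0]; linarith
    · nlinarith [mul_pos h0 h2, mul_nonneg (sub_nonneg.2 h4) h1.le]
  · right
    have h1 := h.neg a haK ⟨closure_mono hs (hCcl a haF), hΓ a haF⟩
    have h2 := h.neg e heK ⟨closure_mono hs (hCcl e heF), hΓ e heF⟩
    intro x hx
    obtain ⟨r, h3, h4, h5⟩ := hlev x hx
    rw [h5]
    rcases h3.eq_or_lt with h0 | h0
    · rw [← h0]; linarith
    · nlinarith [mul_neg_of_pos_of_neg h0 h2, mul_nonpos_of_nonneg_of_nonpos (sub_nonneg.2 h4) h1.le]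

lemma exists_phase_interface (hcut : T.RegularCut) {v : Broken} (hv : T.IsIFE v)
    {K : Finset Plane} (hI : T.IsInterfaceElement K) : ∃ gp gm ν b, T.Phase v K gp gm ν b := by
  have hK := hI.1
  obtain ⟨lam, ν, b, s, t, h⟩ := T.exists_isCut hcut hI
  obtain ⟨⟨G, hG, hdiv⟩, ⟨fp, hfp⟩, fm, hfm⟩ := hv.interface K hI
  rw [h.subElement_pos hK] at hfp
  rw [h.subElement_neg hK] at hfm
  have hℓ : Continuous fun x : Plane => ⟪ν, x⟫_ℝ + b := by fun_prop
  have hseg : ∀ x, x ∈ hull K → ⟪ν, x⟫_ℝ + b = 0 → fp x = fm x := fun x hx h0 => by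
    rw [← hfp ⟨hx, h0.ge⟩, ← hfm ⟨hx, h0.le⟩]
  have hΓ0 : ∀ F ∈ edgesOf K, ∀ y ∈ hull F, y ∈ P.Γ → ⟪ν, y⟫_ℝ + b = 0 := fun F hF y hy hyΓ =>
    h.level_eq_zero ⟨hyΓ, T.hull_edge_subset_frontier hK hF hy⟩
  refine ⟨affGrad fp, affGrad fm, ν, b, ⟨Or.inl h.chord.ne_zero, ?_, ?_, ?_, ?_, h.ae_αt_eq hI,
    ?_, ?_, fun F hF hΓ => h.edge_const hK hF hΓ, fun _ => ⟨h.chord.ne_zero, s, t, h.lt, h.lt',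
      h.image, h.frontier, h.chord.inner_sub, h.chord.ne⟩⟩⟩
  · intro x hx h0
    refine ⟨h.αt_pos hI hx h0, gradientWithin_eq_affGrad (convex_hull K) (T.interior_nonempty hK)
      hx ?_⟩
    have := (isOpen_lt continuous_const hℓ).mem_nhds (show x ∈ {x | 0 < ⟪ν, x⟫_ℝ + b} from h0)
    filter_upwards [self_mem_nhdsWithin, mem_nhdsWithin_of_mem_nhds this] with y hy hy0
    exact hfp ⟨hy, le_of_lt hy0⟩
  · intro x hx h0
    refine ⟨h.αt_neg hI h0, gradientWithin_eq_affGrad (convex_hull K) (T.interior_nonempty hK)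
      hx ?_⟩
    have := (isOpen_lt hℓ continuous_const).mem_nhds (show x ∈ {x | ⟪ν, x⟫_ℝ + b < 0} from h0)
    filter_upwards [self_mem_nhdsWithin, mem_nhdsWithin_of_mem_nhds this] with y hy hy0
    exact hfm ⟨hy, le_of_lt hy0⟩
  · refine flux_eq_of_isHDiv isOpen_interior h.chord.ne_zero h.chord.midpoint_mem ?_ hG
      (a := T.αt K) (fun x hx h0 => h.αt_pos hI (interior_subset hx) h0)
      (fun x hx h0 => h.αt_neg hI h0) hdiv
      (fun x hx h0 => hfp ⟨interior_subset hx, h0.le⟩)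
      (fun x hx h0 => hfm ⟨interior_subset hx, h0.le⟩)
    rw [level_combo ν b _ _ (by norm_num), h.chord.p_level, h.chord.q_level]; simp
  · intro e he
    obtain ⟨r, rfl⟩ := eq_smul_of_inner_eq_zero h.chord.ne_zero
      (sub_ne_zero.2 h.chord.ne.symm) he h.chord.inner_sub
    rw [real_inner_smul_right, real_inner_smul_right, ← aff_sub, ← aff_sub,
      hseg _ h.chord.p_mem h.chord.p_level, hseg _ h.chord.q_mem h.chord.q_level]
  · intro F hF hFΩ hsub x hx hxp
    obtain ⟨a, e, c, hae, -, -, rfl, hKe⟩ := exists_vertices (T.card_eq K hK) hF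
    have haK : a ∈ K := by rw [hKe]; simp
    have heK : e ∈ K := by rw [hKe]; simp
    exact level_pos_of_mem_side subset_side_p hFΩ hsub (h.pos a haK) (h.pos e heK)
      (hΓ0 _ hF) hx hxp (P.notMem_Γ_of_mem_Ωp hxp)
  · intro F hF hFΩ hsub x hx hxm
    obtain ⟨a, e, c, hae, -, -, rfl, hKe⟩ := exists_vertices (T.card_eq K hK) hF
    have haK : a ∈ K := by rw [hKe]; simp
    have heK : e ∈ K := by rw [hKe]; simp
    have := level_pos_of_mem_side (ν := -ν) (c := -b) subset_side_m hFΩ hsub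
      (fun hz => by rw [inner_neg_left]; linarith [h.neg a haK hz])
      (fun hz => by rw [inner_neg_left]; linarith [h.neg e heK hz])
      (fun y hy hyΓ => by rw [inner_neg_left]; linarith [hΓ0 _ hF y hy hyΓ])
      hx hxm (P.notMem_Γ_of_mem_Ωm hxm)
    rw [inner_neg_left] at this
    linarith

lemma exists_phase (hcut : T.RegularCut) {v : Broken} (hv : T.IsIFE v) {K : Finset Plane}
    (hK : K ∈ T.elements) : ∃ gp gm ν b, T.Phase v K gp gm ν b := by
  by_cases hI : T.IsInterfaceElement K
  · exact T.exists_phase_interface hcut hv hI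
  · exact T.exists_phase_nonInterface hv hK hI

end Mesh

/-! ### Testing the variational problem with smooth functions -/

lemma isH1_of_contDiff (U : Set Plane) {φ : Plane → ℝ} (hφ : ContDiff ℝ ∞ φ)
    (hc : HasCompactSupport φ) : IsH1 U φ (gradient φ) where
  memLp := (hφ.continuous.memLp_of_hasCompactSupport hc).restrict U
  memLp_grad := ((continuous_gradient (hφ.of_le (by simp))).memLp_of_hasCompactSupport
    (hasCompactSupport_gradient hc)).restrict U
  weakGradient := by
    intro ψ hψ hcψ hsupp
    rw [setIntegral_eq_integral_of_forall_compl_eq_zero (fun x hx => by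
        rw [image_eq_zero_of_notMem_tsupport
          fun h => hx (hsupp (tsupport_gradient_subset ψ h)), smul_zero]),
      setIntegral_eq_integral_of_forall_compl_eq_zero (fun x hx => by
        rw [image_eq_zero_of_notMem_tsupport fun h => hx (hsupp h), zero_smul])]
    exact integral_smul_gradient (hφ.of_le (by simp)) (hψ.of_le (by simp)) hcψ

lemma hasTrace_of_contDiff (U S : Set Plane) {φ τ : Plane → ℝ} (hφ : ContDiff ℝ ∞ φ)
    (hτ : MemLp τ 2 (μH[1].restrict S)) (hS : φ =ᵐ[μH[1].restrict S] τ) :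
    HasTrace U S φ (gradient φ) τ := by
  refine ⟨hτ, fun _ => φ, fun _ => hφ, by simp, by simp, ?_⟩
  have : φ - τ =ᵐ[μH[1].restrict S] 0 := by
    filter_upwards [hS] with x hx
    simp [hx]
  simp [eLpNorm_congr_ae this]

namespace InterfaceProblem.IsSolution

variable {P : InterfaceProblem} {u : Plane → ℝ} {G : Plane → Plane}

lemma test_neumann (h : P.IsSolution u G) {φ : Plane → ℝ} (hφ : ContDiff ℝ ∞ φ)
    (hc : HasCompactSupport φ) (hD : ∀ x ∈ P.ΓD, φ x = 0)
    (hN : MemLp φ 2 (μH[1].restrict P.ΓN)) :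
    ∫ x in P.Ω, P.α x * ⟪G x, gradient φ x⟫_ℝ
      = (∫ x in P.Ω, P.f x * φ x) - ∫ x in P.ΓN, P.g x * φ x ∂μH[1] :=
  h.weak φ (gradient φ) φ (isH1_of_contDiff _ hφ hc)
    (hasTrace_of_contDiff _ _ hφ (by simp) ((ae_restrict_iff' P.measurableSet_ΓD).2
      (Eventually.of_forall fun x hx => hD x hx)))
    (hasTrace_of_contDiff _ _ hφ hN EventuallyEq.rfl)

lemma test (h : P.IsSolution u G) {φ : Plane → ℝ} (hφ : ContDiff ℝ ∞ φ)
    (hc : HasCompactSupport φ) (hs : tsupport φ ⊆ P.Ω) :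
    ∫ x in P.Ω, P.α x * ⟪G x, gradient φ x⟫_ℝ = ∫ x in P.Ω, P.f x * φ x := by
  have hz : ∀ x ∈ frontier P.Ω, φ x = 0 := fun x hx => image_eq_zero_of_notMem_tsupport
    fun h' => P.isOpen.inter_frontier_eq.subset ⟨hs h', hx⟩
  have hzD : ∀ x ∈ P.ΓD, φ x = 0 := fun x hx => hz x (by
    rw [P.frontier_eq]; exact Or.inl (subset_closure hx))
  have hzN : ∀ x ∈ P.ΓN, φ x = 0 := fun x hx => hz x (by
    rw [P.frontier_eq]; exact Or.inr (subset_closure hx))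
  have hae : φ =ᵐ[μH[1].restrict P.ΓN] 0 := (ae_restrict_iff' P.measurableSet_ΓN).2
    (Eventually.of_forall fun x hx => hzN x hx)
  rw [h.test_neumann hφ hc hzD ((memLp_congr_ae hae).2 MemLp.zero),
    setIntegral_eq_zero_of_forall_eq_zero (t := P.ΓN) (fun x hx => by rw [hzN x hx, mul_zero]),
    sub_zero]

end InterfaceProblem.IsSolution

lemma inner_integral_left {U : Set Plane} {F : Plane → Plane} (hF : IntegrableOn F U) (e : Plane) :
    ⟪e, ∫ x in U, F x⟫_ℝ = ∫ x in U, ⟪e, F x⟫_ℝ := (integral_inner hF e).symm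

/-- Weak gradients are curl free. -/
lemma IsH1.integral_inner_rot_gradient {U : Set Plane} {u : Plane → ℝ} {G : Plane → Plane}
    (h : IsH1 U u G) {φ : Plane → ℝ} (hφ : ContDiff ℝ ∞ φ) (hc : HasCompactSupport φ)
    (hs : tsupport φ ⊆ U) : ∫ x in U, ⟪G x, rot (gradient φ x)⟫_ℝ = 0 := by
  let e : Fin 2 → Plane := ![!₂[1, 0], !₂[0, 1]]
  let ψ : Fin 2 → Plane → ℝ := fun j x => fderiv ℝ φ x (e j)
  have hψ : ∀ j, ContDiff ℝ ∞ (ψ j) := fun j =>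
    (hφ.fderiv_right (by simp)).clm_apply contDiff_const
  have hsub : ∀ j, tsupport (ψ j) ⊆ tsupport φ := fun j =>
    closure_minimal (fun x hx => by
      refine tsupport_fderiv_subset ℝ (subset_tsupport _ ?_)
      intro h0
      apply hx
      show fderiv ℝ φ x (e j) = 0
      rw [h0]; rfl) (isClosed_tsupport φ)
  have hcψ : ∀ j, HasCompactSupport (ψ j) := fun j =>
    hc.of_isClosed_subset (isClosed_tsupport _) (hsub j)
  have key : ∀ j (v : Plane), ∫ x in U, u x * ⟪v, gradient (ψ j) x⟫_ℝ
      = - ∫ x in U, ψ j x * ⟪v, G x⟫_ℝ := by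
    intro j v
    have h1 := congrArg (fun w => ⟪v, w⟫_ℝ)
      (h.weakGradient (ψ j) (hψ j) (hcψ j) ((hsub j).trans hs))
    simp only [inner_neg_right] at h1
    have m1 : MemLp (gradient (ψ j)) 2 (volume.restrict U) :=
      ((continuous_gradient ((hψ j).of_le (by simp))).memLp_of_hasCompactSupport
        (hasCompactSupport_gradient (hcψ j))).restrict U
    have m2 : MemLp (ψ j) 2 (volume.restrict U) :=
      ((hψ j).continuous.memLp_of_hasCompactSupport (hcψ j)).restrict U
    have i1 : IntegrableOn (fun x => u x • gradient (ψ j) x) U :=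
      memLp_one_iff_integrable.1 (m1.smul h.memLp)
    have i2 : IntegrableOn (fun x => ψ j x • G x) U :=
      memLp_one_iff_integrable.1 (h.memLp_grad.smul m2)
    rw [inner_integral_left i1, inner_integral_left i2] at h1
    simpa only [real_inner_smul_right] using h1
  have hsymm : ∀ x, ⟪e 0, gradient (ψ 1) x⟫_ℝ = ⟪e 1, gradient (ψ 0) x⟫_ℝ := by
    intro x
    have hd : DifferentiableAt ℝ (fderiv ℝ φ) x :=
      (hφ.fderiv_right (m := ∞) (by simp)).differentiable (by simp) x
    have hfd : ∀ j v, fderiv ℝ (ψ j) x v = fderiv ℝ (fderiv ℝ φ) x v (e j) := by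
      intro j v
      show fderiv ℝ (fun x => fderiv ℝ φ x (e j)) x v = _
      rw [fderiv_clm_apply hd (differentiableAt_const _)]
      simp
    rw [real_inner_comm, ← fderiv_apply_eq_inner_gradient, real_inner_comm,
      ← fderiv_apply_eq_inner_gradient, hfd, hfd]
    exact (hφ.contDiffAt.isSymmSndFDerivAt (by
      simp only [minSmoothness_of_isRCLikeNormedField]
      exact WithTop.coe_le_coe.2 (le_top : (2 : ℕ∞) ≤ ⊤))).eq _ _
  have h0 := key 1 (e 0)
  have h1 := key 0 (e 1)
  simp_rw [hsymm] at h0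
  have h2 := h0.symm.trans h1
  have m2 : ∀ j, MemLp (ψ j) 2 (volume.restrict U) := fun j =>
    ((hψ j).continuous.memLp_of_hasCompactSupport (hcψ j)).restrict U
  have hGm : ∀ v : Plane, MemLp (fun x => ⟪v, G x⟫_ℝ) 2 (volume.restrict U) := fun v =>
    h.memLp_grad.const_inner v
  have i : ∀ j v, IntegrableOn (fun x => ψ j x * ⟪v, G x⟫_ℝ) U := fun j v =>
    (m2 j).integrable_mul (hGm v)
  have hpt : ∀ x, ⟪G x, rot (gradient φ x)⟫_ℝ = ψ 0 x * ⟪e 1, G x⟫_ℝ - ψ 1 x * ⟪e 0, G x⟫_ℝ := by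
    intro x
    have a0 : ψ 0 x = gradient φ x 0 := by
      show fderiv ℝ φ x (e 0) = _
      rw [fderiv_apply_eq_inner_gradient, inner_plane]; simp [e]
    have a1 : ψ 1 x = gradient φ x 1 := by
      show fderiv ℝ φ x (e 1) = _
      rw [fderiv_apply_eq_inner_gradient, inner_plane]; simp [e]
    rw [a0, a1, inner_plane, inner_plane, inner_plane]
    simp [e]; ring
  simp_rw [hpt]
  rw [integral_sub (i 0 _) (i 1 _)]
  linarith

/-! ### Element residuals -/

lemma memLp_smul_of_bounded {X E : Type*} [MeasurableSpace X] {μ : Measure X}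
    [NormedAddCommGroup E] [NormedSpace ℝ E] {a : X → ℝ} {w : X → E} {C : ℝ}
    (ha : AEStronglyMeasurable a μ) (hb : ∀ x, ‖a x‖ ≤ C) (hw : MemLp w 2 μ) :
    MemLp (fun x => a x • w x) 2 μ := by
  refine MemLp.of_le_mul (c := C) hw (ha.smul hw.aestronglyMeasurable)
    (Eventually.of_forall fun x => ?_)
  rw [norm_smul]
  gcongr
  exact hb x

namespace InterfaceProblem

variable (P : InterfaceProblem)

/-- The larger coefficient. -/
def αmax : ℝ := max P.αp P.αm

/-- The contrast of the coefficients. -/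
def contrast (ρ : ℝ) : ℝ := max ρ ρ⁻¹

lemma αmax_pos : 0 < P.αmax := lt_max_of_lt_left P.αp_pos

lemma ρ_pos : 0 < P.ρ := div_pos P.αp_pos P.αm_pos

lemma one_le_contrast {ρ : ℝ} (h : 0 < ρ) : 1 ≤ contrast ρ := by
  rcases le_total 1 ρ with h1 | h1
  · exact h1.trans (le_max_left _ _)
  · exact (one_le_inv_iff₀.2 ⟨h, h1⟩).trans (le_max_right _ _)

lemma αmax_le_p : P.αmax ≤ contrast P.ρ * P.αp := by
  have h1 : 1 ≤ contrast P.ρ := one_le_contrast P.ρ_pos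
  have h2 : P.ρ⁻¹ ≤ contrast P.ρ := le_max_right _ _
  refine max_le (by nlinarith [P.αp_pos]) ?_
  calc P.αm = P.ρ⁻¹ * P.αp := by
        rw [ρ]; have := P.αp_pos.ne'; field_simp
    _ ≤ _ := by gcongr; exact P.αp_pos.le

lemma αmax_le_m : P.αmax ≤ contrast P.ρ * P.αm := by
  have h1 : 1 ≤ contrast P.ρ := one_le_contrast P.ρ_pos
  have h2 : P.ρ ≤ contrast P.ρ := le_max_left _ _
  refine max_le ?_ (by nlinarith [P.αm_pos])
  calc P.αp = P.ρ * P.αm := by rw [ρ]; have := P.αm_pos.ne'; field_simp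
    _ ≤ _ := by gcongr; exact P.αm_pos.le

lemma α_le (x : Plane) : P.α x ≤ P.αmax := by
  unfold α αmax; split_ifs
  exacts [le_max_left _ _, le_max_right _ _]

lemma αmax_le_α (x : Plane) : P.αmax ≤ contrast P.ρ * P.α x := by
  unfold α; split_ifs
  exacts [P.αmax_le_p, P.αmax_le_m]

end InterfaceProblem

namespace Mesh

variable {P : InterfaceProblem} (T : Mesh P)

lemma αt_eq_or (K : Finset Plane) (x : Plane) : T.αt K x = P.αp ∨ T.αt K x = P.αm := by
  unfold αt; split_ifs <;> simp

lemma αt_pos (K : Finset Plane) (x : Plane) : 0 < T.αt K x := by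
  rcases T.αt_eq_or K x with h | h <;> rw [h]
  exacts [P.αp_pos, P.αm_pos]

lemma αt_le (K : Finset Plane) (x : Plane) : T.αt K x ≤ P.αmax := by
  rcases T.αt_eq_or K x with h | h <;> rw [h]
  exacts [le_max_left _ _, le_max_right _ _]

lemma αmax_le_αt (K : Finset Plane) (x : Plane) :
    P.αmax ≤ InterfaceProblem.contrast P.ρ * T.αt K x := by
  rcases T.αt_eq_or K x with h | h <;> rw [h]
  exacts [P.αmax_le_p, P.αmax_le_m]

/-- The common assumptions of the efficiency estimates. -/
structure IsSetting (σ : ℝ) (u : Plane → ℝ) (G : Plane → Plane) (v : Broken) : Prop where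
  σ_pos : 0 < σ
  shape : T.ShapeRegular σ
  cut : T.RegularCut
  sol : P.IsSolution u G
  ife : T.IsIFE v

/-- The right-hand side of the efficiency estimate. -/
def bound (G : Plane → Plane) (v : Broken) (K : Finset Plane) : ℝ :=
  T.err G v K + (∑ K' ∈ T.patch K, T.geo v K') + ∑ K' ∈ T.patch K, T.osc K'

/-- The energy error on one element. -/
def errOn (G : Plane → Plane) (v : Broken) (K : Finset Plane) : ℝ :=
  √(∫ x in hull K, P.α x * ‖G x - grad v K x‖ ^ 2)

lemma geo_nonneg (v : Broken) (K : Finset Plane) : 0 ≤ T.geo v K := Real.sqrt_nonneg _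

lemma osc_nonneg (K : Finset Plane) : 0 ≤ T.osc K := mul_nonneg Metric.diam_nonneg (Real.sqrt_nonneg _)

lemma err_nonneg (G : Plane → Plane) (v : Broken) (K : Finset Plane) : 0 ≤ T.err G v K :=
  Real.sqrt_nonneg _

lemma bound_nonneg (G : Plane → Plane) (v : Broken) (K : Finset Plane) : 0 ≤ T.bound G v K :=
  add_nonneg (add_nonneg (T.err_nonneg G v K) (Finset.sum_nonneg fun _ _ => T.geo_nonneg v _))
    (Finset.sum_nonneg fun _ _ => T.osc_nonneg _)

lemma errOn_le_err (G : Plane → Plane) (v : Broken) {K K' : Finset Plane} (hK : K' ∈ T.patch K) :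
    errOn (P := P) G v K' ≤ T.err G v K := by
  refine Real.sqrt_le_sqrt ?_
  exact Finset.single_le_sum (f := fun K' => ∫ x in hull K', P.α x * ‖G x - grad v K' x‖ ^ 2)
    (fun K' _ => integral_nonneg fun x => mul_nonneg (P.α_pos x).le (by positivity)) hK

lemma element_le_bound (G : Plane → Plane) (v : Broken) {K K' : Finset Plane}
    (hK : K' ∈ T.patch K) :
    errOn (P := P) G v K' + T.geo v K' + T.osc K' ≤ T.bound G v K := by
  have h1 := T.errOn_le_err G v hK
  have h2 := Finset.single_le_sum (f := fun K' => T.geo v K') (fun K' _ => T.geo_nonneg v K') hK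
  have h3 := Finset.single_le_sum (f := fun K' => T.osc K') (fun K' _ => T.osc_nonneg K') hK
  simp only [bound]
  linarith

lemma measurableSet_S (hcut : T.RegularCut) (K : Finset Plane) : MeasurableSet (T.S K) := by
  unfold S
  split_ifs with hK
  · have hsub : ∀ U : Set Plane, MeasurableSet (T.subElement U K) := by
      intro U
      obtain ⟨s, t, -, -, -, hfr, -⟩ := hcut.element K hK
      unfold subElement
      rw [hfr]
      have : (({P.γ s, P.γ t} : Set Plane) ∪ {z | z ∈ K ∧ z ∈ closure U \ P.Γ}).Finite :=
        (by simp : ({P.γ s, P.γ t} : Set Plane).Finite).union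
          (K.finite_toSet.subset fun z hz => hz.1)
      exact (this.isCompact_convexHull ℝ).isClosed.measurableSet
    have hh := (isClosed_hull K).measurableSet
    exact ((hh.inter P.isOpen_Ωp.measurableSet).diff (hsub _)).union
      ((hh.inter P.isOpen_Ωm.measurableSet).diff (hsub _))
  · exact MeasurableSet.empty

lemma S_subset (K : Finset Plane) : T.S K ⊆ hull K := by
  unfold S
  split_ifs
  · rintro x (hx | hx)
    exacts [hx.1.1, hx.1.1]
  · exact empty_subset _

lemma restrict_hull (K : Finset Plane) :
    (volume : Measure Plane).restrict (hull K) = volume.restrict (interior (hull K)) :=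
  (Measure.restrict_congr_set (interior_ae_eq_of_null_frontier (volume_frontier_hull K))).symm

lemma memLp_hull {E : Type*} [NormedAddCommGroup E] {w : Plane → E}
    (hw : MemLp w 2 (volume.restrict P.Ω)) {K : Finset Plane} (hK : K ∈ T.elements) :
    MemLp w 2 (volume.restrict (hull K)) := by
  rw [restrict_hull]
  exact hw.mono_measure (Measure.restrict_mono_set _ (T.interior_hull_subset hK))

instance isFiniteMeasure_hull (K : Finset Plane) :
    IsFiniteMeasure ((volume : Measure Plane).restrict (hull K)) :=
  ⟨by simpa using (isCompact_hull K).measure_lt_top⟩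

lemma memLp_twoPhase {E : Type*} [NormedAddCommGroup E] [MeasurableSpace E] [BorelSpace E]
    [SecondCountableTopology E] (ν : Plane) (b : ℝ) (p m : E) (K : Finset Plane) :
    MemLp (twoPhase ν b p m) 2 (volume.restrict (hull K)) := by
  refine MemLp.of_bound (measurable_twoPhase ν b p m).aestronglyMeasurable (max ‖p‖ ‖m‖)
    (Eventually.of_forall fun x => ?_)
  unfold twoPhase
  split_ifs
  exacts [le_max_left _ _, le_max_right _ _]

namespace Phase

variable {T}
variable {v : Broken} {K : Finset Plane} {gp gm ν : Plane} {b : ℝ}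

lemma ae_ne (h : T.Phase v K gp gm ν b) : ∀ᵐ x : Plane, ⟪ν, x⟫_ℝ + b ≠ 0 :=
  compl_mem_ae_iff.2 (volume_affine_eq_zero h.ne)

lemma ae_eq (h : T.Phase v K gp gm ν b) : ∀ᵐ x ∂(volume.restrict (hull K)),
    T.αt K x = twoPhase ν b P.αp P.αm x ∧ grad v K x = twoPhase ν b gp gm x ∧
      T.αt K x • grad v K x = twoPhase ν b (P.αp • gp) (P.αm • gm) x := by
  filter_upwards [ae_restrict_mem (isClosed_hull K).measurableSet, ae_restrict_of_ae h.ae_ne]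
    with x hx h0
  unfold twoPhase
  rcases lt_or_gt_of_ne h0 with h1 | h1
  · obtain ⟨e1, e2⟩ := h.neg x hx h1
    simp [h1.not_gt, e1, e2]
  · obtain ⟨e1, e2⟩ := h.pos x hx h1
    simp [h1, e1, e2]

lemma memLp_grad (h : T.Phase v K gp gm ν b) : MemLp (grad v K) 2 (volume.restrict (hull K)) :=
  (memLp_congr_ae (h.ae_eq.mono fun _ hx => hx.2.1)).2 (memLp_twoPhase _ _ _ _ _)

lemma aestronglyMeasurable_αt (h : T.Phase v K gp gm ν b) :
    AEStronglyMeasurable (T.αt K) (volume.restrict (hull K)) :=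
  (measurable_twoPhase ν b P.αp P.αm).aestronglyMeasurable.congr
    (h.ae_eq.mono fun _ hx => hx.1.symm)

lemma flux_zero (h : T.Phase v K gp gm ν b) : ⟪P.αp • gp - P.αm • gm, ν⟫_ℝ = 0 := by
  rw [inner_sub_left, real_inner_smul_left, real_inner_smul_left, h.flux, sub_self]

lemma rot_zero (h : T.Phase v K gp gm ν b) : ⟪rot gp - rot gm, ν⟫_ℝ = 0 := by
  rw [inner_sub_left, inner_rot_left, inner_rot_left, h.tang _ (inner_rot_self ν), sub_self]

end Phase

/-- The `L²` norm of the discrete flux minus the exact flux on an element. -/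
def resid (G : Plane → Plane) (v : Broken) (K : Finset Plane) : ℝ :=
  √(∫ x in hull K, ‖T.αt K x • grad v K x - P.α x • G x‖ ^ 2)

variable {σ : ℝ} {u : Plane → ℝ} {G : Plane → Plane} {v : Broken}

lemma IsSetting.memLp_G (hs : T.IsSetting σ u G v) {K : Finset Plane} (hK : K ∈ T.elements) :
    MemLp G 2 (volume.restrict (hull K)) := T.memLp_hull hs.sol.isH1.memLp_grad hK

lemma IsSetting.memLp_α_smul (hs : T.IsSetting σ u G v) {K : Finset Plane} (hK : K ∈ T.elements) :
    MemLp (fun x => P.α x • G x) 2 (volume.restrict (hull K)) := by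
  refine memLp_smul_of_bounded (C := P.αmax) P.measurable_α.aestronglyMeasurable (fun x => ?_)
    (hs.memLp_G T hK)
  rw [Real.norm_of_nonneg (P.α_pos x).le]
  exact P.α_le x

lemma IsSetting.memLp_flux (hs : T.IsSetting σ u G v) {K : Finset Plane} (hK : K ∈ T.elements) :
    MemLp (fun x => T.αt K x • grad v K x) 2 (volume.restrict (hull K)) := by
  obtain ⟨gp, gm, ν, b, hph⟩ := T.exists_phase hs.cut hs.ife hK
  exact (memLp_congr_ae (hph.ae_eq.mono fun _ hx => hx.2.2)).2 (memLp_twoPhase _ _ _ _ _)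

lemma IsSetting.resid_le (hs : T.IsSetting σ u G v) {K : Finset Plane} (hK : K ∈ T.elements) :
    T.resid G v K ≤ 2 * (√P.αmax * √(InterfaceProblem.contrast P.ρ))
      * (errOn (P := P) G v K + T.geo v K) := by
  obtain ⟨gp, gm, ν, b, hph⟩ := T.exists_phase hs.cut hs.ife hK
  set A := P.αmax with hA
  set R := InterfaceProblem.contrast P.ρ with hR
  have hA0 : 0 < A := P.αmax_pos
  have hR1 : 1 ≤ R := InterfaceProblem.one_le_contrast P.ρ_pos
  set c := √A * √R with hc
  have hc0 : 0 ≤ c := by positivity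
  have hG := hs.memLp_G T hK
  have hg := hph.memLp_grad
  let w₁ : Plane → Plane := fun x => c • (√(P.α x) • (G x - grad v K x))
  let w₂ : Plane → Plane := fun x => c • (T.S K).indicator (fun x => √(T.αt K x) • grad v K x) x
  have hsqα : ∀ x, √(P.α x) ≤ √A := fun x => Real.sqrt_le_sqrt (P.α_le x)
  have hsqαt : ∀ x, √(T.αt K x) ≤ √A := fun x => Real.sqrt_le_sqrt (T.αt_le K x)
  have m₁ : MemLp w₁ 2 (volume.restrict (hull K)) := by
    refine MemLp.const_smul (c := c) (memLp_smul_of_bounded (C := √A)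
      P.measurable_α.sqrt.aestronglyMeasurable (fun x => ?_) (hG.sub hg))
    rw [Real.norm_of_nonneg (Real.sqrt_nonneg _)]
    exact hsqα x
  have m₂' : MemLp (fun x => √(T.αt K x) • grad v K x) 2 (volume.restrict (hull K)) := by
    refine memLp_smul_of_bounded (C := √A)
      (Real.continuous_sqrt.comp_aestronglyMeasurable hph.aestronglyMeasurable_αt)
      (fun x => ?_) hg
    rw [Real.norm_of_nonneg (Real.sqrt_nonneg _)]
    exact hsqαt x
  have m₂ : MemLp w₂ 2 (volume.restrict (hull K)) :=
    (m₂'.indicator (T.measurableSet_S hs.cut K)).const_smul c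
  have hle : ∀ᵐ x ∂(volume.restrict (hull K)),
      ‖T.αt K x • grad v K x - P.α x • G x‖ ≤ ‖w₁ x‖ + ‖w₂ x‖ := by
    filter_upwards [hph.alpha] with x hx
    have e : T.αt K x • grad v K x - P.α x • G x
        = -(P.α x • (G x - grad v K x)) + (T.αt K x - P.α x) • grad v K x := by module
    rw [e]
    refine (norm_add_le _ _).trans (add_le_add ?_ ?_)
    · simp only [w₁]
      rw [norm_neg, norm_smul, norm_smul, norm_smul, Real.norm_of_nonneg (P.α_pos x).le,
        Real.norm_of_nonneg hc0, Real.norm_of_nonneg (Real.sqrt_nonneg _), ← mul_assoc]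
      gcongr
      calc P.α x = √(P.α x) * √(P.α x) := (Real.mul_self_sqrt (P.α_pos x).le).symm
        _ ≤ c * √(P.α x) := by
          gcongr
          refine (hsqα x).trans ?_
          rw [hc]
          exact le_mul_of_one_le_right (Real.sqrt_nonneg _) (Real.one_le_sqrt.2 hR1)
    · by_cases hxS : x ∈ T.S K
      · simp only [w₂]
        rw [indicator_of_mem hxS, norm_smul, norm_smul, norm_smul,
          Real.norm_of_nonneg hc0, Real.norm_of_nonneg (Real.sqrt_nonneg _), ← mul_assoc]
        gcongr
        have h1 : ‖T.αt K x - P.α x‖ ≤ A := by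
          rw [Real.norm_eq_abs, abs_le]
          constructor
          · linarith [T.αt_pos K x, P.α_le x]
          · linarith [T.αt_le K x, P.α_pos x]
        refine h1.trans ?_
        have h2 : √A ≤ √R * √(T.αt K x) := by
          rw [← Real.sqrt_mul (by linarith)]
          exact Real.sqrt_le_sqrt (T.αmax_le_αt K x)
        calc A = √A * √A := (Real.mul_self_sqrt hA0.le).symm
          _ ≤ √A * (√R * √(T.αt K x)) := by gcongr
          _ = _ := by rw [hc]; ring
      · rw [hx hxS, sub_self, zero_smul, norm_zero]; exact norm_nonneg _
  have h := sqrt_integral_norm_add_sq_le m₁ m₂ hle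
  have e₁ : √(∫ x in hull K, ‖w₁ x‖ ^ 2) = c * errOn (P := P) G v K := by
    have : ∀ x, ‖w₁ x‖ ^ 2 = c ^ 2 * (P.α x * ‖G x - grad v K x‖ ^ 2) := fun x => by
      simp only [w₁]
      rw [norm_smul, norm_smul, mul_pow, mul_pow, Real.norm_of_nonneg hc0,
        Real.norm_of_nonneg (Real.sqrt_nonneg _), Real.sq_sqrt (P.α_pos x).le]
    simp_rw [this]
    rw [integral_const_mul, Real.sqrt_mul (by positivity), Real.sqrt_sq hc0]; rfl
  have e₂ : √(∫ x in hull K, ‖w₂ x‖ ^ 2) = c * T.geo v K := by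
    have : ∀ x, ‖w₂ x‖ ^ 2
        = c ^ 2 * (T.S K).indicator (fun x => T.αt K x * ‖grad v K x‖ ^ 2) x := fun x => by
      simp only [w₂]
      rw [norm_smul, mul_pow, Real.norm_of_nonneg hc0]
      congr 1
      by_cases hxS : x ∈ T.S K
      · rw [indicator_of_mem hxS, indicator_of_mem hxS, norm_smul, mul_pow,
          Real.norm_of_nonneg (Real.sqrt_nonneg _), Real.sq_sqrt (T.αt_pos K x).le]
      · rw [indicator_of_notMem hxS, indicator_of_notMem hxS]; simp
    simp_rw [this]
    rw [integral_const_mul, Real.sqrt_mul (by positivity), Real.sqrt_sq hc0,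
      setIntegral_indicator (T.measurableSet_S hs.cut K), inter_eq_right.2 (T.S_subset K)]
    rfl
  rw [e₁, e₂] at h
  unfold resid
  linarith

lemma sqrt_grad_error_le (hs : T.IsSetting σ u G v) {K : Finset Plane} (hK : K ∈ T.elements) :
    √P.αmax * √(∫ x in hull K, ‖G x - grad v K x‖ ^ 2)
      ≤ √(InterfaceProblem.contrast P.ρ) * errOn (P := P) G v K := by
  obtain ⟨gp, gm, ν, b, hph⟩ := T.exists_phase hs.cut hs.ife hK
  have hR1 : 1 ≤ InterfaceProblem.contrast P.ρ := InterfaceProblem.one_le_contrast P.ρ_pos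
  have hm := (hs.memLp_G T hK).sub hph.memLp_grad
  have hi : IntegrableOn (fun x => ‖G x - grad v K x‖ ^ 2) (hull K) :=
    hm.integrable_norm_pow (by norm_num)
  rw [errOn, ← Real.sqrt_mul P.αmax_pos.le, ← Real.sqrt_mul (by linarith), ← integral_const_mul,
    ← integral_const_mul]
  refine Real.sqrt_le_sqrt (integral_mono (hi.const_mul _) ?_ fun x => ?_)
  · refine Integrable.const_mul ?_ _
    refine Integrable.mono' (hi.const_mul P.αmax)
      (P.measurable_α.aestronglyMeasurable.mul hi.aestronglyMeasurable)
      (Eventually.of_forall fun x => ?_)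
    rw [Real.norm_of_nonneg (mul_nonneg (P.α_pos x).le (by positivity))]
    gcongr
    exact P.α_le x
  · simp only
    rw [← mul_assoc]
    gcongr
    exact P.αmax_le_α x

end Mesh

/-- A gradient constant for bump functions. -/
def bumpConst : ℝ := exists_bump.choose

lemma bumpConst_pos : 0 < bumpConst := exists_bump.choose_spec.1

lemma exists_isBump (c : Plane) {r : ℝ} (hr : 0 < r) : ∃ φ, IsBump bumpConst c r φ :=
  exists_bump.choose_spec.2 c r hr

namespace IsBump

variable {A : ℝ} {c : Plane} {r : ℝ} {φ : Plane → ℝ}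

/-- Pairing an `L²` field with the gradient of a bump. -/
lemma abs_setIntegral_inner_le (h : IsBump A c r φ) (hA : 0 ≤ A) (hr : 0 < r) {s : Set Plane}
    {w : Plane → Plane} (hw : MemLp w 2 (volume.restrict s)) :
    |∫ x in s, ⟪w x, gradient φ x⟫_ℝ| ≤ 2 * A * √(∫ x in s, ‖w x‖ ^ 2) := by
  have := abs_setIntegral_le_of_supported hw (F := fun x => ⟪w x, gradient φ x⟫_ℝ) (B := A / r)
    (by positivity) (fun x => by
      rw [mul_comm]
      exact (abs_real_inner_le_norm _ _).trans (by gcongr; exact h.norm_gradient_le x))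
    (c := c) hr.le (fun x hx => by rw [h.gradient_eq_zero hx, inner_zero_right])
  calc _ ≤ _ := this
    _ = _ := by field_simp

lemma abs_setIntegral_mul_le (h : IsBump A c r φ) (hr : 0 < r) {s : Set Plane}
    {w : Plane → ℝ} (hw : MemLp w 2 (volume.restrict s)) :
    |∫ x in s, w x * φ x| ≤ 2 * r * √(∫ x in s, w x ^ 2) := by
  have := abs_setIntegral_le_of_supported hw (F := fun x => w x * φ x) (B := 1)
    zero_le_one (fun x => by
      rw [abs_mul, abs_of_nonneg (h.nonneg x), mul_comm, Real.norm_eq_abs]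
      exact mul_le_mul_of_nonneg_right (h.le_one x) (abs_nonneg _))
    (c := c) hr.le (fun x hx => by rw [h.eq_zero hx, mul_zero])
  simpa using this

lemma integrable_inner (h : IsBump A c r φ) {s : Set Plane}
    {w : Plane → Plane} (hw : MemLp w 2 (volume.restrict s)) :
    IntegrableOn (fun x => ⟪w x, gradient φ x⟫_ℝ) s := by
  have m : MemLp (gradient φ) 2 (volume.restrict s) :=
    ((continuous_gradient h.contDiff_one).memLp_of_hasCompactSupport
      (hasCompactSupport_gradient h.hasCompactSupport)).restrict s
  refine Integrable.mono' (hw.norm.integrable_mul m.norm)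
    (hw.aestronglyMeasurable.inner m.aestronglyMeasurable)
    (Eventually.of_forall fun x => norm_inner_le_norm _ _)

lemma integrable_mul (h : IsBump A c r φ) {s : Set Plane}
    {w : Plane → ℝ} (hw : MemLp w 2 (volume.restrict s)) :
    IntegrableOn (fun x => w x * φ x) s := by
  have m : MemLp φ 2 (volume.restrict s) :=
    (h.contDiff.continuous.memLp_of_hasCompactSupport h.hasCompactSupport).restrict s
  exact hw.integrable_mul m

lemma le_setIntegral (h : IsBump A c r φ) (hr : 0 < r) {s : Set Plane}
    (hs : Metric.closedBall c r ⊆ s) : r ^ 2 / 4 ≤ ∫ x in s, φ x := by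
  have hsub : Metric.closedBall c (r / 2) ⊆ Metric.closedBall c r :=
    Metric.closedBall_subset_closedBall (by linarith)
  have hint : Integrable φ := h.contDiff.continuous.integrable_of_hasCompactSupport h.hasCompactSupport
  calc r ^ 2 / 4 = (r / 2) ^ 2 := by ring
    _ ≤ (volume (Metric.closedBall c (r / 2))).toReal := le_volume_closedBall c (by positivity)
    _ = ∫ x in Metric.closedBall c (r / 2), φ x := by
        rw [setIntegral_congr_fun Metric.isClosed_closedBall.measurableSet
          (fun x hx => h.one x hx)]
        simp [Measure.real]
    _ ≤ ∫ x in s, φ x := setIntegral_mono_set hint.integrableOn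
        (Eventually.of_forall fun x => h.nonneg x) (hsub.trans hs).eventuallyLE

end IsBump

namespace Mesh

variable {P : InterfaceProblem} (T : Mesh P)
variable {σ : ℝ} {u : Plane → ℝ} {G : Plane → Plane} {v : Broken}

lemma setIntegral_hull_of_subset {K : Finset Plane} (hK : K ∈ T.elements) {F : Plane → ℝ}
    (h0 : ∀ x ∉ interior (hull K), F x = 0) : ∫ x in hull K, F x = ∫ x in P.Ω, F x := by
  rw [setIntegral_eq_integral_of_forall_compl_eq_zero
      (fun x hx => h0 x fun h => hx (interior_subset h)),
    setIntegral_eq_integral_of_forall_compl_eq_zero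
      (fun x hx => h0 x fun h => hx (T.interior_hull_subset hK h))]

/-- The constant in the bound for the right-hand side. -/
def loadConst (σ : ℝ) : ℝ := 2 + 64 * σ + 256 * σ ^ 2 * bumpConst

/-- The bubble function bound for the right-hand side. -/
lemma IsSetting.load_le (hs : T.IsSetting σ u G v) {K : Finset Plane} (hK : K ∈ T.elements) :
    Metric.diam (hull K) * √(∫ x in hull K, P.f x ^ 2)
      ≤ loadConst σ * (√P.αmax * √(InterfaceProblem.contrast P.ρ))
        * (errOn (P := P) G v K + T.geo v K + T.osc K) := by
  obtain ⟨gp, gm, ν, b, hph⟩ := T.exists_phase hs.cut hs.ife hK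
  obtain ⟨c, hc⟩ := hs.shape K hK
  have hσ := hs.σ_pos
  have hd := T.diam_pos hK
  set d := Metric.diam (hull K) with hdd
  set r := d / (2 * σ) with hr
  have hr0 : 0 < r := by positivity
  have hdr : d = 2 * σ * r := by rw [hr]; field_simp
  obtain ⟨φ, hφ⟩ := exists_isBump c hr0
  have hball : Metric.closedBall c r ⊆ interior (hull K) := by
    refine Subset.trans ?_ (interior_maximal (Metric.ball_subset_closedBall.trans hc)
      Metric.isOpen_ball)
    refine Metric.closedBall_subset_ball ?_
    rw [hr, div_lt_div_iff_of_pos_left hd (by positivity) hσ]; linarith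
  have hf := T.memLp_hull P.memLp_f hK
  set fK := ⨍ y in hull K, P.f y with hfK
  set N := √(∫ x in hull K, (P.f x - fK) ^ 2) with hN
  have hconst : MemLp (fun _ : Plane => fK) 2 (volume.restrict (hull K)) := memLp_const fK
  have hosc : MemLp (fun x => P.f x - fK) 2 (volume.restrict (hull K)) := hf.sub hconst
  have hint : IntegrableOn (fun x => (P.f x - fK) ^ 2) (hull K) := hosc.integrable_sq
  have hA0 : 0 < P.αmax := P.αmax_pos
  have hR1 : 1 ≤ InterfaceProblem.contrast P.ρ := InterfaceProblem.one_le_contrast P.ρ_pos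
  -- the oscillation
  have hdN : d * N ≤ √P.αmax * T.osc K := by
    have : N ≤ √P.αmax * √(∫ x in hull K, (P.α x)⁻¹ * (P.f x - fK) ^ 2) := by
      rw [hN, ← Real.sqrt_mul hA0.le, ← integral_const_mul]
      refine Real.sqrt_le_sqrt (integral_mono hint ?_ fun x => ?_)
      · refine Integrable.const_mul ?_ _
        refine Integrable.mono' (hint.const_mul (InterfaceProblem.contrast P.ρ / P.αmax))
          (P.measurable_α.inv.aestronglyMeasurable.mul hint.aestronglyMeasurable)
          (Eventually.of_forall fun x => ?_)
        rw [Real.norm_of_nonneg (mul_nonneg (inv_nonneg.2 (P.α_pos x).le) (by positivity))]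
        gcongr
        rw [inv_le_iff_one_le_mul₀ (P.α_pos x), div_mul_eq_mul_div, one_le_div hA0]
        exact P.αmax_le_α x
      · simp only
        rw [← mul_assoc]
        refine le_mul_of_one_le_left (by positivity) ?_
        rw [← div_eq_mul_inv, one_le_div (P.α_pos x)]
        exact P.α_le x
    calc d * N ≤ d * (√P.αmax * √(∫ x in hull K, (P.α x)⁻¹ * (P.f x - fK) ^ 2)) := by gcongr
      _ = √P.αmax * T.osc K := by unfold osc; ring
  -- the mean value
  have hmean : |fK| * (r ^ 2 / 4) ≤ 2 * bumpConst * T.resid G v K + 2 * r * N := by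
    have hflux := hs.memLp_flux T hK
    have hαG := hs.memLp_α_smul T hK
    have h1 : ∫ x in hull K, P.f x * φ x
        = - ∫ x in hull K, ⟪T.αt K x • grad v K x - P.α x • G x, gradient φ x⟫_ℝ := by
      have e1 := hs.sol.test hφ.contDiff hφ.hasCompactSupport
        (hφ.tsupport_subset.trans (hball.trans (T.interior_hull_subset hK)))
      rw [← T.setIntegral_hull_of_subset hK (fun x hx => by
          rw [hφ.gradient_eq_zero fun h => hx (hball h), inner_zero_right, mul_zero]),
        ← T.setIntegral_hull_of_subset hK (fun x hx => by
          rw [hφ.eq_zero fun h => hx (hball h), mul_zero])] at e1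
      have e2 : ∫ x in hull K, ⟪T.αt K x • grad v K x, gradient φ x⟫_ℝ = 0 := by
        rw [integral_congr_ae (hph.ae_eq.mono fun x hx => by rw [hx.2.2]),
          setIntegral_eq_integral_of_forall_compl_eq_zero (fun x hx => by
            rw [hφ.gradient_eq_zero fun h => hx (interior_subset (hball h)), inner_zero_right])]
        exact integral_twoPhase_inner_gradient hφ.contDiff_one hφ.hasCompactSupport hph.flux_zero
      simp_rw [inner_sub_left]
      rw [integral_sub (hφ.integrable_inner hflux) (hφ.integrable_inner hαG), e2, ← e1]
      simp_rw [real_inner_smul_left]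
      ring
    have h2 : fK * ∫ x in hull K, φ x
        = (∫ x in hull K, P.f x * φ x) - ∫ x in hull K, (P.f x - fK) * φ x := by
      rw [← integral_const_mul, ← integral_sub (hφ.integrable_mul hf) (hφ.integrable_mul hosc)]
      congr 1; funext x; ring
    have h3 := hφ.abs_setIntegral_inner_le bumpConst_pos.le hr0 (hflux.sub hαG)
    have h4 := hφ.abs_setIntegral_mul_le hr0 hosc
    have h5 := hφ.le_setIntegral hr0 (hball.trans interior_subset)
    calc |fK| * (r ^ 2 / 4) ≤ |fK| * ∫ x in hull K, φ x := by gcongr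
      _ = |fK * ∫ x in hull K, φ x| := by
          rw [abs_mul, abs_of_nonneg (a := ∫ x in hull K, φ x) (le_trans (by positivity) h5)]
      _ ≤ |∫ x in hull K, P.f x * φ x| + |∫ x in hull K, (P.f x - fK) * φ x| := by
          rw [h2]; exact abs_sub _ _
      _ ≤ _ := by
          rw [h1, abs_neg]
          exact add_le_add h3 h4
  have hvol : √(∫ x in hull K, ‖fK‖ ^ 2) ≤ |fK| * (2 * d) := by
    obtain ⟨z, hz⟩ := T.nonempty_of_mem hK
    rw [Real.sqrt_le_left (by positivity)]
    have h1 : (volume (hull K)).toReal ≤ 4 * d ^ 2 := by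
      refine le_trans (ENNReal.toReal_mono (isCompact_closedBall z d).measure_lt_top.ne
        (measure_mono fun x hx => ?_)) (volume_closedBall_le z hd.le)
      rw [mem_closedBall_iff_norm]
      exact norm_sub_le_diam hx (subset_hull hz)
    simp only [integral_const, smul_eq_mul, Measure.real, Measure.restrict_apply_univ,
      Real.norm_eq_abs, sq_abs]
    calc _ ≤ 4 * d ^ 2 * fK ^ 2 := by gcongr
      _ = (|fK| * (2 * d)) ^ 2 := by rw [mul_pow, sq_abs]; ring
  have htot := sqrt_integral_norm_add_sq_le (w := P.f) hosc hconst
    (Eventually.of_forall fun x => by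
      simpa using norm_add_le (P.f x - fK) fK)
  simp only [Real.norm_eq_abs, sq_abs] at htot hvol
  rw [← hN] at htot
  have hres := hs.resid_le T hK
  set c₀ := √P.αmax * √(InterfaceProblem.contrast P.ρ) with hc₀
  set e := errOn (P := P) G v K + T.geo v K with he
  have hc₀A : √P.αmax ≤ c₀ := le_mul_of_one_le_right (Real.sqrt_nonneg _) (Real.one_le_sqrt.2 hR1)
  have hosc0 : 0 ≤ T.osc K := T.osc_nonneg K
  have he0 : 0 ≤ e := add_nonneg (Real.sqrt_nonneg _) (T.geo_nonneg v K)
  have hdN' : d * N ≤ c₀ * T.osc K := hdN.trans (by gcongr)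
  have hb := bumpConst_pos
  have key : d ^ 2 * |fK| ≤ 16 * σ ^ 2 * (2 * bumpConst * T.resid G v K) + 16 * σ * (d * N) := by
    calc d ^ 2 * |fK| = 16 * σ ^ 2 * (|fK| * (r ^ 2 / 4)) := by rw [hdr]; ring
      _ ≤ 16 * σ ^ 2 * (2 * bumpConst * T.resid G v K + 2 * r * N) := by gcongr
      _ = _ := by rw [hdr]; ring
  have hcO : 0 ≤ c₀ * T.osc K := by positivity
  have hcE : 0 ≤ c₀ * e := by positivity
  calc d * √(∫ x in hull K, P.f x ^ 2)
      ≤ d * (2 * (N + |fK| * (2 * d))) := by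
        gcongr
        exact htot.trans (by gcongr)
    _ = 2 * (d * N) + 4 * (d ^ 2 * |fK|) := by ring
    _ ≤ 2 * (d * N) + 4 * (16 * σ ^ 2 * (2 * bumpConst * T.resid G v K) + 16 * σ * (d * N)) := by
        gcongr
    _ ≤ 2 * (c₀ * T.osc K) + 4 * (16 * σ ^ 2 * (2 * bumpConst * (2 * c₀ * e))
          + 16 * σ * (c₀ * T.osc K)) := by gcongr
    _ ≤ loadConst σ * c₀ * (e + T.osc K) := by
        unfold loadConst
        have : 0 ≤ (2 + 64 * σ) * (c₀ * e) := by positivity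
        have h' : 0 ≤ 256 * σ ^ 2 * bumpConst * (c₀ * T.osc K) := by positivity
        nlinarith

/-! ### Jumps on edges -/

lemma setIntegral_hull_eq_halfPlane {K : Finset Plane} {n x₀ : Plane} (hn : ‖n‖ = 1) {r : ℝ}
    (hnear : ∀ x, ‖x - x₀‖ ≤ r → (x ∈ hull K ↔ ⟪n, x - x₀⟫_ℝ ≤ 0)) {F : Plane → ℝ}
    (h0 : ∀ x ∉ Metric.closedBall x₀ r, F x = 0) :
    ∫ x in hull K, F x = ∫ x in {x : Plane | ⟪n, x - x₀⟫_ℝ < 0}, F x := by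
  have hm : MeasurableSet {x : Plane | ⟪n, x - x₀⟫_ℝ < 0} :=
    (isOpen_lt (by fun_prop) continuous_const).measurableSet
  rw [← integral_indicator (isClosed_hull K).measurableSet, ← integral_indicator hm]
  refine integral_congr_ae ?_
  filter_upwards [compl_mem_ae_iff.2 (volume_line hn x₀)] with x hx
  by_cases hxb : x ∈ Metric.closedBall x₀ r
  · have h1 := hnear x (by rwa [mem_closedBall_iff_norm] at hxb)
    have h2 : ⟪n, x - x₀⟫_ℝ ≠ 0 := hx
    have h3 : x ∈ hull K ↔ x ∈ {x : Plane | ⟪n, x - x₀⟫_ℝ < 0} :=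
      h1.trans ⟨fun h => lt_of_le_of_ne h h2, fun h => le_of_lt h⟩
    by_cases hxK : x ∈ hull K
    · rw [indicator_of_mem hxK, indicator_of_mem (h3.1 hxK)]
    · rw [indicator_of_notMem hxK, indicator_of_notMem fun h => hxK (h3.2 h)]
  · simp [indicator, h0 x hxb]

lemma integral_eq_add_hull {K₁ K₂ : Finset Plane} {n x₀ : Plane} (hn : ‖n‖ = 1) {r : ℝ}
    (h₁ : ∀ x, ‖x - x₀‖ ≤ r → (x ∈ hull K₁ ↔ ⟪n, x - x₀⟫_ℝ ≤ 0))
    (h₂ : ∀ x, ‖x - x₀‖ ≤ r → (x ∈ hull K₂ ↔ ⟪-n, x - x₀⟫_ℝ ≤ 0))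
    (hΩ : Metric.closedBall x₀ r ⊆ P.Ω) {F : Plane → ℝ} (hF : IntegrableOn F P.Ω)
    (h0 : ∀ x ∉ Metric.closedBall x₀ r, F x = 0) :
    ∫ x in P.Ω, F x = (∫ x in hull K₁, F x) + ∫ x in hull K₂, F x := by
  have hm : MeasurableSet {x : Plane | ⟪n, x - x₀⟫_ℝ < 0} :=
    (isOpen_lt (by fun_prop) continuous_const).measurableSet
  have h0' : ∀ x ∉ P.Ω, F x = 0 := fun x hx => h0 x fun h => hx (hΩ h)
  have hint : Integrable F := (integrableOn_iff_integrable_of_support_subset (fun x hx => by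
      by_contra hxV; exact hx (h0' x hxV))).1 hF
  rw [setIntegral_eq_integral_of_forall_compl_eq_zero h0',
    setIntegral_hull_eq_halfPlane hn h₁ h0,
    setIntegral_hull_eq_halfPlane (by rw [norm_neg, hn]) h₂ h0, ← integral_add_compl hm hint]
  congr 1
  refine setIntegral_congr_set ?_
  filter_upwards [compl_mem_ae_iff.2 (volume_line hn x₀)] with x hx
  have h2 : ⟪n, x - x₀⟫_ℝ ≠ 0 := hx
  refine propext ?_
  show ¬ (⟪n, x - x₀⟫_ℝ < 0) ↔ ⟪-n, x - x₀⟫_ℝ < 0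
  rw [inner_neg_left, not_lt]
  constructor
  · intro h; have := lt_of_le_of_ne h h2.symm; linarith
  · intro h; linarith

/-- Along the line through `x₀` with normal `n` the bump `φ` sees only the phase with coefficient
`α₀` and gradient `g` of the function on `K`. -/
structure SeesPhase (v : Broken) (K : Finset Plane) (n x₀ : Plane) (φ : Plane → ℝ) (α₀ : ℝ)
    (g : Plane) : Prop where
  flux : ∫ x in hull K, ⟪T.αt K x • grad v K x, gradient φ x⟫_ℝ
    = α₀ * ⟪g, n⟫_ℝ * ∫ s : ℝ, φ (x₀ + s • rot n)
  tang : ∫ x in hull K, ⟪rot (grad v K x), gradient φ x⟫_ℝ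
    = ⟪rot g, n⟫_ℝ * ∫ s : ℝ, φ (x₀ + s • rot n)

lemma twoPhase_comp {X Y : Type*} (f : X → Y) (ν : Plane) (b : ℝ) (p m : X) (x : Plane) :
    f (twoPhase ν b p m x) = twoPhase ν b (f p) (f m) x := by
  unfold twoPhase; split_ifs <;> rfl

lemma Phase.seesPhase_pos {T : Mesh P} {K : Finset Plane} {gp gm ν : Plane} {b : ℝ}
    (h : T.Phase v K gp gm ν b) {n x₀ : Plane} (hn : ‖n‖ = 1) {r A : ℝ}
    (hnear : ∀ x, ‖x - x₀‖ ≤ r → (x ∈ hull K ↔ ⟪n, x - x₀⟫_ℝ ≤ 0)) {φ : Plane → ℝ}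
    (hφ : IsBump A x₀ r φ)
    (hpos : ∀ s : ℝ, |s| ≤ r → 0 < ⟪ν, x₀ + s • rot n⟫_ℝ + b) :
    T.SeesPhase v K n x₀ φ P.αp gp := by
  have hs : ∀ s : ℝ, φ (x₀ + s • rot n) ≠ 0 → 0 < ⟪ν, x₀ + s • rot n⟫_ℝ + b := by
    intro s hs
    refine hpos s ?_
    by_contra hcon
    refine hs (hφ.eq_zero fun hx => hcon ?_)
    rwa [mem_closedBall_iff_norm, add_sub_cancel_left, norm_smul, norm_rot, hn, mul_one,
      Real.norm_eq_abs] at hx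
  constructor
  · rw [integral_congr_ae (h.ae_eq.mono fun x hx => by rw [hx.2.2]),
      setIntegral_hull_eq_halfPlane hn hnear
        (fun x hx => by rw [hφ.gradient_eq_zero hx, inner_zero_right]),
      integral_halfPlane_twoPhase_pos hφ.contDiff_one hφ.hasCompactSupport hn x₀ h.flux_zero hs,
      real_inner_smul_left]
  · rw [integral_congr_ae (h.ae_eq.mono fun x hx => by rw [hx.2.1, twoPhase_comp rot]),
      setIntegral_hull_eq_halfPlane hn hnear
        (fun x hx => by rw [hφ.gradient_eq_zero hx, inner_zero_right]),
      integral_halfPlane_twoPhase_pos hφ.contDiff_one hφ.hasCompactSupport hn x₀ h.rot_zero hs]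

lemma Phase.seesPhase_neg {T : Mesh P} {K : Finset Plane} {gp gm ν : Plane} {b : ℝ}
    (h : T.Phase v K gp gm ν b) {n x₀ : Plane} (hn : ‖n‖ = 1) {r A : ℝ}
    (hnear : ∀ x, ‖x - x₀‖ ≤ r → (x ∈ hull K ↔ ⟪n, x - x₀⟫_ℝ ≤ 0)) {φ : Plane → ℝ}
    (hφ : IsBump A x₀ r φ)
    (hneg : ∀ s : ℝ, |s| ≤ r → ⟪ν, x₀ + s • rot n⟫_ℝ + b < 0) :
    T.SeesPhase v K n x₀ φ P.αm gm := by
  have hs : ∀ s : ℝ, φ (x₀ + s • rot n) ≠ 0 → ⟪ν, x₀ + s • rot n⟫_ℝ + b < 0 := by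
    intro s hs
    refine hneg s ?_
    by_contra hcon
    refine hs (hφ.eq_zero fun hx => hcon ?_)
    rwa [mem_closedBall_iff_norm, add_sub_cancel_left, norm_smul, norm_rot, hn, mul_one,
      Real.norm_eq_abs] at hx
  constructor
  · rw [integral_congr_ae (h.ae_eq.mono fun x hx => by rw [hx.2.2]),
      setIntegral_hull_eq_halfPlane hn hnear
        (fun x hx => by rw [hφ.gradient_eq_zero hx, inner_zero_right]),
      integral_halfPlane_twoPhase_neg hφ.contDiff_one hφ.hasCompactSupport hn x₀ h.flux_zero hs,
      real_inner_smul_left]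
  · rw [integral_congr_ae (h.ae_eq.mono fun x hx => by rw [hx.2.1, twoPhase_comp rot]),
      setIntegral_hull_eq_halfPlane hn hnear
        (fun x hx => by rw [hφ.gradient_eq_zero hx, inner_zero_right]),
      integral_halfPlane_twoPhase_neg hφ.contDiff_one hφ.hasCompactSupport hn x₀ h.rot_zero hs]

/-- The constant in the edge estimates. -/
def jumpConst (σ ρ : ℝ) : ℝ := (12 * bumpConst + 4 * loadConst σ) * InterfaceProblem.contrast ρ

set_option maxHeartbeats 1000000 in
/-- The edge bubble estimate for the jump of one phase across an interior edge. -/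
lemma IsSetting.jump_le (hs : T.IsSetting σ u G v) {K K₁ K₂ : Finset Plane}
    (hK₁ : K₁ ∈ T.patch K) (hK₂ : K₂ ∈ T.patch K) {n x₀ : Plane} (hn : ‖n‖ = 1) {r : ℝ}
    (hr : 0 < r) (hr₁ : r ≤ Metric.diam (hull K₁)) (hr₂ : r ≤ Metric.diam (hull K₂))
    (h₁ : ∀ x, ‖x - x₀‖ ≤ r → (x ∈ hull K₁ ↔ ⟪n, x - x₀⟫_ℝ ≤ 0))
    (h₂ : ∀ x, ‖x - x₀‖ ≤ r → (x ∈ hull K₂ ↔ ⟪-n, x - x₀⟫_ℝ ≤ 0))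
    (hΩ : Metric.closedBall x₀ r ⊆ P.Ω) {φ : Plane → ℝ} (hφ : IsBump bumpConst x₀ r φ)
    {α₀ : ℝ} (hα₀ : 0 < α₀) (hα : α₀ ≤ P.αmax)
    (hα' : P.αmax ≤ InterfaceProblem.contrast P.ρ * α₀) {g₁ g₂ : Plane}
    (hg₁ : T.SeesPhase v K₁ n x₀ φ α₀ g₁) (hg₂ : T.SeesPhase v K₂ (-n) x₀ φ α₀ g₂) :
    r * (√α₀ * ‖g₁ - g₂‖) ≤ jumpConst σ P.ρ * T.bound G v K := by
  have hE₁ := T.mem_elements_of_mem_patch hK₁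
  have hE₂ := T.mem_elements_of_mem_patch hK₂
  have hb₁ := T.element_le_bound G v hK₁
  have hb₂ := T.element_le_bound G v hK₂
  have hb := bumpConst_pos
  have hR1 : 1 ≤ InterfaceProblem.contrast P.ρ := InterfaceProblem.one_le_contrast P.ρ_pos
  set R := InterfaceProblem.contrast P.ρ with hR
  set B := T.bound G v K with hB
  have hB0 : 0 ≤ B := T.bound_nonneg G v K
  set Φ := ∫ s : ℝ, φ (x₀ + s • rot n) with hΦ
  have hΦr : r ≤ Φ := hφ.le_integral_line hr hn
  have hrotneg : rot (-n) = -rot n := by ext i; fin_cases i <;> simp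
  have hΦ' : ∫ s : ℝ, φ (x₀ + s • rot (-n)) = Φ := by
    rw [hΦ, ← integral_neg_eq_self]
    congr 1; funext s; rw [hrotneg, smul_neg, neg_smul, neg_neg]
  obtain ⟨gp₁, gm₁, ν₁, b₁, ph₁⟩ := T.exists_phase hs.cut hs.ife hE₁
  obtain ⟨gp₂, gm₂, ν₂, b₂, ph₂⟩ := T.exists_phase hs.cut hs.ife hE₂
  have hφg : ∀ x ∉ Metric.closedBall x₀ r, gradient φ x = 0 := fun x hx => hφ.gradient_eq_zero hx
  have hts : tsupport φ ⊆ P.Ω := hφ.tsupport_subset.trans hΩ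
  have memα : MemLp (fun x => P.α x • G x) 2 (volume.restrict P.Ω) :=
    memLp_smul_of_bounded (C := P.αmax) P.measurable_α.aestronglyMeasurable (fun x => by
      rw [Real.norm_of_nonneg (P.α_pos x).le]; exact P.α_le x) hs.sol.isH1.memLp_grad
  set N₁ := √(∫ x in hull K₁, P.f x ^ 2)
  set N₂ := √(∫ x in hull K₂, P.f x ^ 2)
  have hfe : ∀ {K' : Finset Plane}, K' ∈ T.elements →
      errOn (P := P) G v K' + T.geo v K' + T.osc K' ≤ B → r ≤ Metric.diam (hull K') →
      r * √(∫ x in hull K', P.f x ^ 2) ≤ loadConst σ * (√P.αmax * √R) * B ∧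
        T.resid G v K' ≤ 2 * (√P.αmax * √R) * B ∧
        √P.αmax * √(∫ x in hull K', ‖G x - grad v K' x‖ ^ 2) ≤ √R * B := by
    intro K' hK' hKB hrK
    have h1 := hs.load_le T hK'
    have h2 := hs.resid_le T hK'
    have h3 := T.sqrt_grad_error_le hs hK'
    have g0 := T.geo_nonneg v K'
    have o0 := T.osc_nonneg K'
    have hσ := hs.σ_pos
    have hl0 : 0 ≤ loadConst σ := by unfold loadConst; positivity
    refine ⟨?_, ?_, ?_⟩
    · calc r * √(∫ x in hull K', P.f x ^ 2) ≤ Metric.diam (hull K') * √(∫ x in hull K', P.f x ^ 2) := by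
            gcongr
        _ ≤ _ := h1
        _ ≤ _ := by gcongr
    · exact h2.trans (by gcongr; linarith)
    · exact h3.trans (by gcongr; linarith)
  obtain ⟨f₁, r₁, e₁⟩ := hfe hE₁ hb₁ hr₁
  obtain ⟨f₂, r₂, e₂⟩ := hfe hE₂ hb₂ hr₂
  -- the normal component
  have hnorm : r * (α₀ * |⟪g₁ - g₂, n⟫_ℝ|)
      ≤ (8 * bumpConst + 4 * loadConst σ) * (√P.αmax * √R) * B := by
    have i1 := hφ.integrable_inner memα
    have i2 := hφ.integrable_mul P.memLp_f
    have t1 := hs.sol.test hφ.contDiff hφ.hasCompactSupport hts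
    have t2 : ∫ x in P.Ω, ⟪P.α x • G x, gradient φ x⟫_ℝ = ∫ x in P.Ω, P.f x * φ x := by
      rw [← t1]; simp_rw [real_inner_smul_left]
    rw [integral_eq_add_hull hn h₁ h₂ hΩ i1 (fun x hx => by rw [hφg x hx, inner_zero_right]),
      integral_eq_add_hull hn h₁ h₂ hΩ i2 (fun x hx => by rw [hφ.eq_zero hx, mul_zero])] at t2
    have fl₁ := hs.memLp_flux T hE₁
    have fl₂ := hs.memLp_flux T hE₂
    have al₁ := hs.memLp_α_smul T hE₁
    have al₂ := hs.memLp_α_smul T hE₂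
    have s₁ := hφ.abs_setIntegral_inner_le hb.le hr (fl₁.sub al₁)
    have s₂ := hφ.abs_setIntegral_inner_le hb.le hr (fl₂.sub al₂)
    simp only [Pi.sub_apply, inner_sub_left] at s₁ s₂
    rw [integral_sub (hφ.integrable_inner fl₁) (hφ.integrable_inner al₁), hg₁.flux] at s₁
    rw [integral_sub (hφ.integrable_inner fl₂) (hφ.integrable_inner al₂), hg₂.flux, hΦ'] at s₂
    have q₁ := hφ.abs_setIntegral_mul_le hr (T.memLp_hull P.memLp_f hE₁)
    have q₂ := hφ.abs_setIntegral_mul_le hr (T.memLp_hull P.memLp_f hE₂)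
    have s₁' : |_| ≤ 2 * bumpConst * T.resid G v K₁ := s₁
    have s₂' : |_| ≤ 2 * bumpConst * T.resid G v K₂ := s₂
    have hsum : α₀ * ⟪g₁ - g₂, n⟫_ℝ * Φ
        = (α₀ * ⟪g₁, n⟫_ℝ * Φ - ∫ x in hull K₁, ⟪P.α x • G x, gradient φ x⟫_ℝ)
          + (α₀ * ⟪g₂, -n⟫_ℝ * Φ - ∫ x in hull K₂, ⟪P.α x • G x, gradient φ x⟫_ℝ)
          + (∫ x in hull K₁, P.f x * φ x) + ∫ x in hull K₂, P.f x * φ x := by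
      rw [inner_sub_left, inner_neg_right]
      linear_combination t2
    calc r * (α₀ * |⟪g₁ - g₂, n⟫_ℝ|) ≤ Φ * (α₀ * |⟪g₁ - g₂, n⟫_ℝ|) := by gcongr
      _ = |α₀ * ⟪g₁ - g₂, n⟫_ℝ * Φ| := by
          rw [abs_mul, abs_mul, abs_of_pos hα₀, abs_of_pos (hr.trans_le hΦr)]; ring
      _ ≤ 2 * bumpConst * T.resid G v K₁ + 2 * bumpConst * T.resid G v K₂
          + 2 * r * N₁ + 2 * r * N₂ := by
          rw [hsum]
          exact (abs_add_le _ _).trans (add_le_add ((abs_add_le _ _).trans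
            (add_le_add ((abs_add_le _ _).trans (add_le_add s₁' s₂')) q₁)) q₂)
      _ ≤ 2 * bumpConst * (2 * (√P.αmax * √R) * B) + 2 * bumpConst * (2 * (√P.αmax * √R) * B)
          + 2 * (loadConst σ * (√P.αmax * √R) * B) + 2 * (loadConst σ * (√P.αmax * √R) * B) := by
          have := mul_le_mul_of_nonneg_left r₁ (by positivity : 0 ≤ 2 * bumpConst)
          have := mul_le_mul_of_nonneg_left r₂ (by positivity : 0 ≤ 2 * bumpConst)
          linarith
      _ = _ := by ring
  -- the tangential component
  have htang : r * (√P.αmax * |⟪g₁ - g₂, rot n⟫_ℝ|) ≤ 4 * bumpConst * √R * B := by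
    have hrotm : ∀ {w : Plane → Plane} {μ : Measure Plane}, MemLp w 2 μ →
        MemLp (fun x => rot (w x)) 2 μ := by
      intro w μ hw
      have hcont : Continuous rot := by unfold rot; fun_prop
      exact hw.of_le (hcont.comp_aestronglyMeasurable hw.aestronglyMeasurable)
        (Eventually.of_forall fun x => (norm_rot _).le)
    have mG := hrotm hs.sol.isH1.memLp_grad
    have i1 := hφ.integrable_inner mG
    have t1 := hs.sol.isH1.integral_inner_rot_gradient hφ.contDiff hφ.hasCompactSupport hts
    have t2 : ∫ x in P.Ω, ⟪rot (G x), gradient φ x⟫_ℝ = 0 := by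
      simp_rw [inner_rot_left]
      rw [integral_neg, t1, neg_zero]
    rw [integral_eq_add_hull hn h₁ h₂ hΩ i1 (fun x hx => by rw [hφg x hx, inner_zero_right])] at t2
    have fl₁ := hrotm ph₁.memLp_grad
    have fl₂ := hrotm ph₂.memLp_grad
    have al₁ := hrotm (hs.memLp_G T hE₁)
    have al₂ := hrotm (hs.memLp_G T hE₂)
    have s₁ := hφ.abs_setIntegral_inner_le hb.le hr (al₁.sub fl₁)
    have s₂ := hφ.abs_setIntegral_inner_le hb.le hr (al₂.sub fl₂)
    have hnr : ∀ x y : Plane, ‖rot x - rot y‖ = ‖x - y‖ := fun x y => by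
      rw [← norm_rot (x - y)]; congr 1
      ext i; fin_cases i <;> simp; ring
    simp only [Pi.sub_apply, inner_sub_left, hnr] at s₁ s₂
    rw [integral_sub (hφ.integrable_inner al₁) (hφ.integrable_inner fl₁), hg₁.tang] at s₁
    rw [integral_sub (hφ.integrable_inner al₂) (hφ.integrable_inner fl₂), hg₂.tang, hΦ'] at s₂
    have hsum : ⟪g₁ - g₂, rot n⟫_ℝ * Φ
        = ((∫ x in hull K₁, ⟪rot (G x), gradient φ x⟫_ℝ) - ⟪rot g₁, n⟫_ℝ * Φ)
          + ((∫ x in hull K₂, ⟪rot (G x), gradient φ x⟫_ℝ) - ⟪rot g₂, -n⟫_ℝ * Φ) := by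
      rw [inner_sub_left, inner_rot_left, inner_rot_left, hrotneg, inner_neg_right]
      linear_combination -t2
    calc r * (√P.αmax * |⟪g₁ - g₂, rot n⟫_ℝ|) ≤ Φ * (√P.αmax * |⟪g₁ - g₂, rot n⟫_ℝ|) := by gcongr
      _ = √P.αmax * |⟪g₁ - g₂, rot n⟫_ℝ * Φ| := by
          rw [abs_mul, abs_of_pos (hr.trans_le hΦr)]; ring
      _ ≤ √P.αmax * (2 * bumpConst * √(∫ x in hull K₁, ‖G x - grad v K₁ x‖ ^ 2)
          + 2 * bumpConst * √(∫ x in hull K₂, ‖G x - grad v K₂ x‖ ^ 2)) := by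
          rw [hsum]; gcongr; exact (abs_add_le _ _).trans (add_le_add s₁ s₂)
      _ = 2 * bumpConst * (√P.αmax * √(∫ x in hull K₁, ‖G x - grad v K₁ x‖ ^ 2))
          + 2 * bumpConst * (√P.αmax * √(∫ x in hull K₂, ‖G x - grad v K₂ x‖ ^ 2)) := by ring
      _ ≤ 2 * bumpConst * (√R * B) + 2 * bumpConst * (√R * B) := by gcongr
      _ = _ := by ring
  have hsα : 0 < √α₀ := Real.sqrt_pos.2 hα₀
  have hsA : √P.αmax ≤ √R * √α₀ := by
    rw [← Real.sqrt_mul (by linarith)]; exact Real.sqrt_le_sqrt hα'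
  have hsα' : √α₀ ≤ √P.αmax := Real.sqrt_le_sqrt hα
  have hRR : √R * √R = R := Real.mul_self_sqrt (by linarith)
  have hRle : √R ≤ R := by
    have := Real.one_le_sqrt.2 hR1; nlinarith
  have hσ := hs.σ_pos
  have hl0 : 0 ≤ loadConst σ := by unfold loadConst; positivity
  have h1 : r * (√α₀ * |⟪g₁ - g₂, n⟫_ℝ|) ≤ (8 * bumpConst + 4 * loadConst σ) * R * B := by
    refine le_of_mul_le_mul_left ?_ hsα
    calc √α₀ * (r * (√α₀ * |⟪g₁ - g₂, n⟫_ℝ|)) = r * ((√α₀ * √α₀) * |⟪g₁ - g₂, n⟫_ℝ|) := by ring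
      _ = r * (α₀ * |⟪g₁ - g₂, n⟫_ℝ|) := by rw [Real.mul_self_sqrt hα₀.le]
      _ ≤ _ := hnorm
      _ ≤ (8 * bumpConst + 4 * loadConst σ) * (√R * √α₀ * √R) * B := by gcongr
      _ = (8 * bumpConst + 4 * loadConst σ) * (√R * √R * √α₀) * B := by ring
      _ = _ := by rw [hRR]; ring
  have h2 : r * (√α₀ * |⟪g₁ - g₂, rot n⟫_ℝ|) ≤ 4 * bumpConst * R * B := by
    calc _ ≤ r * (√P.αmax * |⟪g₁ - g₂, rot n⟫_ℝ|) := by gcongr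
      _ ≤ _ := htang
      _ ≤ _ := by gcongr
  have h3 : ‖g₁ - g₂‖ ≤ |⟪g₁ - g₂, n⟫_ℝ| + |⟪g₁ - g₂, rot n⟫_ℝ| := by
    refine abs_le_of_sq_le_sq' ?_ (by positivity) |>.2
    rw [← inner_sq_add_inner_rot_sq hn]
    nlinarith [sq_abs ⟪g₁ - g₂, n⟫_ℝ, sq_abs ⟪g₁ - g₂, rot n⟫_ℝ, abs_nonneg ⟪g₁ - g₂, n⟫_ℝ,
      abs_nonneg ⟪g₁ - g₂, rot n⟫_ℝ, mul_nonneg (abs_nonneg ⟪g₁ - g₂, n⟫_ℝ)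
        (abs_nonneg ⟪g₁ - g₂, rot n⟫_ℝ)]
  calc r * (√α₀ * ‖g₁ - g₂‖) ≤ r * (√α₀ * (|⟪g₁ - g₂, n⟫_ℝ| + |⟪g₁ - g₂, rot n⟫_ℝ|)) := by gcongr
    _ = r * (√α₀ * |⟪g₁ - g₂, n⟫_ℝ|) + r * (√α₀ * |⟪g₁ - g₂, rot n⟫_ℝ|) := by ring
    _ ≤ _ := add_le_add h1 h2
    _ = _ := by unfold jumpConst; ring

end Mesh

/-! ### Edges cut by the interface -/

lemma exists_Ioo_subset {s t : Set ℝ} (hst : Disjoint s t) {p θ : ℝ} (hp : p ∈ Icc (0 : ℝ) 1)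
    (h1 : Ioo 0 p ⊆ s ∨ Ioo 0 p ⊆ t) (h2 : Ioo p 1 ⊆ s ∨ Ioo p 1 ⊆ t) (hθ : 0 < θ)
    (hv : 4 * θ ≤ (volume (Icc (0 : ℝ) 1 ∩ s)).toReal) :
    ∃ τ₁ τ₂ : ℝ, 0 ≤ τ₁ ∧ τ₂ ≤ 1 ∧ 2 * θ ≤ τ₂ - τ₁ ∧ Ioo τ₁ τ₂ ⊆ s := by
  have hcover : ∀ τ ∈ Icc (0 : ℝ) 1, τ ∈ Ioo 0 p ∨ τ ∈ Ioo p 1 ∨ τ ∈ ({0, p, 1} : Set ℝ) := by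
    intro τ hτ
    simp only [mem_insert_iff, mem_singleton_iff, mem_Ioo]
    by_cases e0 : τ = 0
    · simp [e0]
    by_cases e1 : τ = 1
    · simp [e1]
    have a0 := lt_of_le_of_ne hτ.1 (Ne.symm e0)
    have a1 := lt_of_le_of_ne hτ.2 e1
    rcases lt_trichotomy τ p with h | h | h
    · exact Or.inl ⟨a0, h⟩
    · exact Or.inr (Or.inr (Or.inr (Or.inl h)))
    · exact Or.inr (Or.inl ⟨h, a1⟩)
  have h0 : volume ({0, p, 1} : Set ℝ) = 0 :=
    (Set.toFinite _).measure_zero _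
  have bound : ∀ I : Set ℝ, Icc (0 : ℝ) 1 ∩ s ⊆ I ∪ {0, p, 1} → volume (Icc (0 : ℝ) 1 ∩ s) ≤ volume I := by
    intro I hI
    refine (measure_mono hI).trans ((measure_union_le _ _).trans ?_)
    rw [h0, add_zero]
  have hle : ∀ {x y : ℝ}, x ≤ y → Icc (0 : ℝ) 1 ∩ s ⊆ Ioo x y ∪ {0, p, 1} → 4 * θ ≤ y - x := by
    intro x y hxy hI
    have := ENNReal.toReal_mono (by simp) (bound _ hI)
    rw [Real.volume_Ioo, ENNReal.toReal_ofReal (by linarith)] at this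
    linarith
  have d : ∀ {τ}, τ ∈ s → τ ∉ t := fun hs ht => hst.le_bot ⟨hs, ht⟩
  rcases h1 with h1 | h1
  · rcases h2 with h2 | h2
    · have : 4 * θ ≤ 1 - 0 := hle zero_le_one (fun τ hτ => by
        rcases hcover τ hτ.1 with h | h | h
        · exact Or.inl ⟨h.1, h.2.trans_le hp.2⟩
        · exact Or.inl ⟨hp.1.trans_lt h.1, h.2⟩
        · exact Or.inr h)
      rcases le_total p (1 / 2) with hpp | hpp
      · exact ⟨p, 1, hp.1, le_rfl, by linarith, h2⟩
      · exact ⟨0, p, le_rfl, hp.2, by linarith, h1⟩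
    · have : 4 * θ ≤ p - 0 := hle hp.1 (fun τ hτ => by
        rcases hcover τ hτ.1 with h | h | h
        · exact Or.inl h
        · exact absurd (h2 h) (d hτ.2)
        · exact Or.inr h)
      exact ⟨0, p, le_rfl, hp.2, by linarith, h1⟩
  · rcases h2 with h2 | h2
    · have : 4 * θ ≤ 1 - p := hle hp.2 (fun τ hτ => by
        rcases hcover τ hτ.1 with h | h | h
        · exact absurd (h1 h) (d hτ.2)
        · exact Or.inl h
        · exact Or.inr h)
      exact ⟨p, 1, hp.1, le_rfl, by linarith, h2⟩
    · have : 4 * θ ≤ p - p := hle le_rfl (fun τ hτ => by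
        rcases hcover τ hτ.1 with h | h | h
        · exact absurd (h1 h) (d hτ.2)
        · exact absurd (h2 h) (d hτ.2)
        · exact Or.inr h)
      linarith

lemma segment_point_mem_sdiff {a b : Plane} (hab : a ≠ b) {τ : ℝ} (h0 : 0 < τ) (h1 : τ < 1) :
    (1 - τ) • a + τ • b ∈ hull {a, b} \ ({a, b} : Finset Plane) := by
  refine ⟨?_, ?_⟩
  · rw [hull_pair, segment_eq_image]; exact ⟨τ, ⟨h0.le, h1.le⟩, rfl⟩
  · have ha : (1 - τ) • a + τ • b - a = τ • (b - a) := by module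
    have hb : (1 - τ) • a + τ • b - b = (1 - τ) • (a - b) := by module
    simp only [Finset.coe_insert, Finset.coe_singleton, mem_insert_iff, mem_singleton_iff, not_or]
    constructor
    · rw [← sub_eq_zero, ha]; exact smul_ne_zero h0.ne' (sub_ne_zero.2 hab.symm)
    · rw [← sub_eq_zero, hb]; exact smul_ne_zero (by linarith) (sub_ne_zero.2 hab)

namespace InterfaceProblem

variable (P : InterfaceProblem)

/-- An edge that meets the interface at most once is divided into at most two pieces, each on one
side. -/
lemma exists_split {a b : Plane} (hΩ : hull {a, b} \ ({a, b} : Finset Plane) ⊆ P.Ω) (hab : a ≠ b)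
    (hsub : (hull {a, b} ∩ P.Γ).Subsingleton) :
    ∃ p ∈ Icc (0 : ℝ) 1,
      (Ioo 0 p ⊆ {τ : ℝ | (1 - τ) • a + τ • b ∈ P.Ωp} ∨
        Ioo 0 p ⊆ {τ : ℝ | (1 - τ) • a + τ • b ∈ P.Ωm}) ∧
      (Ioo p 1 ⊆ {τ : ℝ | (1 - τ) • a + τ • b ∈ P.Ωp} ∨
        Ioo p 1 ⊆ {τ : ℝ | (1 - τ) • a + τ • b ∈ P.Ωm}) := by
  have hcont : Continuous fun τ : ℝ => (1 - τ) • a + τ • b := by fun_prop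
  have side : ∀ x y : ℝ, 0 ≤ x → y ≤ 1 → (∀ τ ∈ Ioo x y, (1 - τ) • a + τ • b ∉ P.Γ) →
      (Ioo x y ⊆ {τ : ℝ | (1 - τ) • a + τ • b ∈ P.Ωp} ∨
        Ioo x y ⊆ {τ : ℝ | (1 - τ) • a + τ • b ∈ P.Ωm}) := by
    intro x y hx hy hΓ
    have := P.subset_side (isPreconnected_Ioo.image _ hcont.continuousOn (s := Ioo x y)) ?_ ?_
    · rcases this with h | h
      · exact Or.inl fun τ hτ => h ⟨τ, hτ, rfl⟩
      · exact Or.inr fun τ hτ => h ⟨τ, hτ, rfl⟩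
    · rintro _ ⟨τ, hτ, rfl⟩
      exact hΩ (segment_point_mem_sdiff hab (hx.trans_lt hτ.1) (hτ.2.trans_le hy))
    · rintro _ ⟨τ, hτ, rfl⟩
      exact hΓ τ hτ
  have mem : ∀ τ ∈ Icc (0 : ℝ) 1, (1 - τ) • a + τ • b ∈ hull {a, b} := fun τ hτ => by
    rw [hull_pair, segment_eq_image]; exact ⟨τ, hτ, rfl⟩
  by_cases hne : ∃ p ∈ Icc (0 : ℝ) 1, (1 - p) • a + p • b ∈ P.Γ
  · obtain ⟨p, hp, hpΓ⟩ := hne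
    have uniq : ∀ τ ∈ Icc (0 : ℝ) 1, (1 - τ) • a + τ • b ∈ P.Γ → τ = p := by
      intro τ hτ hτΓ
      have h1 := hsub ⟨mem τ hτ, hτΓ⟩ ⟨mem p hp, hpΓ⟩
      have h2 : (τ - p) • (b - a) = 0 := by
        have : (τ - p) • (b - a) = ((1 - τ) • a + τ • b) - ((1 - p) • a + p • b) := by module
        rw [this, h1, sub_self]
      rcases smul_eq_zero.1 h2 with h | h
      · linarith
      · exact absurd (sub_eq_zero.1 h) hab.symm
    refine ⟨p, hp, side 0 p le_rfl hp.2 fun τ hτ hτΓ => ?_, side p 1 hp.1 le_rfl fun τ hτ hτΓ => ?_⟩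
    · exact hτ.2.ne (uniq τ ⟨hτ.1.le, hτ.2.le.trans hp.2⟩ hτΓ)
    · exact hτ.1.ne' (uniq τ ⟨hp.1.trans hτ.1.le, hτ.2.le⟩ hτΓ)
  · push Not at hne
    exact ⟨0, by simp, side 0 0 le_rfl zero_le_one fun τ hτ => absurd (hτ.1.trans hτ.2) (lt_irrefl _),
      side 0 1 le_rfl le_rfl fun τ hτ => hne τ ⟨hτ.1.le, hτ.2.le⟩⟩

end InterfaceProblem

lemma hausdorffMeasure_edge_inter (a b : Plane) (U : Set Plane) :
    μH[1] (hull {a, b} ∩ U)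
      = ENNReal.ofReal ‖a - b‖ * volume (Icc (0 : ℝ) 1 ∩ {τ : ℝ | (1 - τ) • a + τ • b ∈ U}) := by
  have hl : ∀ τ : ℝ, AffineMap.lineMap a b τ = (1 - τ) • a + τ • b := fun τ =>
    AffineMap.lineMap_apply_module a b τ
  have : hull {a, b} ∩ U = AffineMap.lineMap a b '' (Icc (0 : ℝ) 1 ∩ {τ : ℝ | (1 - τ) • a + τ • b ∈ U}) := by
    rw [hull_pair, segment_eq_image]
    ext x
    constructor
    · rintro ⟨⟨τ, hτ, rfl⟩, hU⟩
      exact ⟨τ, ⟨hτ, hU⟩, hl τ⟩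
    · rintro ⟨τ, ⟨hτ, hU⟩, rfl⟩
      rw [hl]
      exact ⟨⟨τ, hτ, rfl⟩, hU⟩
  rw [this, hausdorffMeasure_lineMap_image, hausdorffMeasure_real, ENNReal.smul_def, smul_eq_mul]
  congr 1
  rw [← dist_eq_norm, ← edist_dist, edist_nndist]

namespace Mesh

variable {P : InterfaceProblem} (T : Mesh P)
variable {σ : ℝ} {u : Plane → ℝ} {G : Plane → Plane} {v : Broken}

lemma hausdorffMeasure_hull_edge {F : Finset Plane} (hF : F ∈ T.edges) :
    μH[1] (hull F) = ENNReal.ofReal (h F) := by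
  obtain ⟨a, b, hab, rfl, hh, -⟩ := T.exists_ends hF
  rw [hh, hull_pair, hausdorffMeasure_segment, edist_dist, dist_eq_norm]

/-- Points of the line through an edge that are close to an inner point of the edge. -/
lemma exists_line_point {a b n : Plane} (hab : a ≠ b) (hn1 : ‖n‖ = 1) (hn : ⟪n, b - a⟫_ℝ = 0)
    {τ θ s : ℝ} (hs : |s| < θ * ‖a - b‖) :
    ∃ τ' : ℝ, |τ' - τ| < θ ∧ (1 - τ) • a + τ • b + s • rot n = (1 - τ') • a + τ' • b := by
  obtain ⟨c, hc⟩ := eq_smul_of_inner_eq_zero (ν := n) (v := rot n) (w := b - a)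
    (by rw [← norm_pos_iff, hn1]; norm_num) (sub_ne_zero.2 hab.symm) (inner_rot_self n) hn
  have hc1 : |c| * ‖a - b‖ = 1 := by
    rw [norm_sub_rev, ← Real.norm_eq_abs, ← norm_smul, ← hc, norm_rot, hn1]
  refine ⟨τ + s * c, ?_, by rw [hc]; module⟩
  rw [add_sub_cancel_left]
  refine lt_of_mul_lt_mul_right ?_ (norm_nonneg (a - b))
  rwa [abs_mul, mul_assoc, hc1, mul_one]

/-- An inner point of an edge together with a neighbourhood inside one phase. -/
lemma exists_inner_point {F : Finset Plane} (hσ : 0 < σ) (hT : T.ShapeRegular σ)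
    (hF : T.IsInterior F) {a b : Plane} (hab : a ≠ b) (hFe : F = {a, b})
    (hsub : (hull F ∩ P.Γ).Subsingleton) {U : Set Plane} (hU : U = P.Ωp ∨ U = P.Ωm) {θ : ℝ}
    (hθ : 0 < θ) (hv : 4 * θ * h F ≤ (μH[1] (hull F ∩ U)).toReal) :
    ∃ τ : ℝ, θ ≤ τ ∧ τ ≤ 1 - θ ∧ ∀ s : ℝ, |s| ≤ θ * h F / (1 + σ) →
      (1 - τ) • a + τ • b + s • rot (T.n F) ∈ (hull F \ F) ∩ U := by
  have hh0 := T.h_pos hF.1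
  have hh : h F = ‖a - b‖ := by rw [hFe]; exact diam_hull_pair a b
  have hsubΩ := T.sdiff_subset hσ hT hF
  have hn1 := T.norm_n F hF.1
  have hn := T.n_normal F hF.1 a (by rw [hFe]; simp) b (by rw [hFe]; simp)
  set n := T.n F
  rw [hFe] at hsub hsubΩ
  obtain ⟨p, hp, h1, h2⟩ := P.exists_split hsubΩ hab hsub
  have hv' : 4 * θ ≤ (volume (Icc (0 : ℝ) 1 ∩ {τ : ℝ | (1 - τ) • a + τ • b ∈ U})).toReal := by
    rw [hFe, hausdorffMeasure_edge_inter, ENNReal.toReal_mul, ENNReal.toReal_ofReal (norm_nonneg _),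
      ← hFe, ← hh] at hv
    exact le_of_mul_le_mul_left (by linarith) hh0
  have hdis : Disjoint {τ : ℝ | (1 - τ) • a + τ • b ∈ P.Ωp} {τ : ℝ | (1 - τ) • a + τ • b ∈ P.Ωm} :=
    Set.disjoint_left.2 fun τ h h' => P.disjoint_Ω.le_bot ⟨h, h'⟩
  obtain ⟨τ₁, τ₂, k0, k1, k2, k3⟩ : ∃ τ₁ τ₂ : ℝ, 0 ≤ τ₁ ∧ τ₂ ≤ 1 ∧ 2 * θ ≤ τ₂ - τ₁ ∧
      Ioo τ₁ τ₂ ⊆ {τ : ℝ | (1 - τ) • a + τ • b ∈ U} := by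
    rcases hU with rfl | rfl
    · exact exists_Ioo_subset hdis hp h1 h2 hθ hv'
    · exact exists_Ioo_subset hdis.symm hp h1.symm h2.symm hθ hv'
  refine ⟨(τ₁ + τ₂) / 2, by linarith, by linarith, fun s hs => ?_⟩
  obtain ⟨τ, hτ, he⟩ := exists_line_point (τ := (τ₁ + τ₂) / 2) hab hn1 hn
    (hs.trans_lt (by rw [← hh]; exact div_lt_self (by positivity) (by linarith)))
  obtain ⟨h5, h6⟩ := abs_lt.1 hτ
  rw [he, hFe]
  exact ⟨segment_point_mem_sdiff hab (by linarith) (by linarith), k3 ⟨by linarith, by linarith⟩⟩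

lemma mem_edgesOf_K₁ {F : Finset Plane} (hF : F ∈ T.edges) : F ∈ edgesOf (T.K₁ F) := by
  obtain ⟨K, hK, hFK⟩ := Finset.mem_biUnion.1 hF
  exact Finset.mem_powersetCard.2 ⟨(T.K₁_mem F hF).2, (Finset.mem_powersetCard.1 hFK).2⟩

lemma mem_edgesOf_K₂ {F : Finset Plane} (hF : T.IsInterior F) : F ∈ edgesOf (T.K₂ F) := by
  obtain ⟨K, hK, hFK⟩ := Finset.mem_biUnion.1 hF.1
  exact Finset.mem_powersetCard.2 ⟨(T.K₂_mem F hF.1 hF.2).2.1, (Finset.mem_powersetCard.1 hFK).2⟩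

lemma h_le_diam {K F : Finset Plane} (hF : F ∈ edgesOf K) : h F ≤ Metric.diam (hull K) :=
  Metric.diam_mono (hull_mono (Finset.mem_powersetCard.1 hF).1) (isCompact_hull K).isBounded

lemma mem_patch_of_edge {K K' F : Finset Plane} (hK' : K' ∈ T.elements) (hF : F ∈ edgesOf K)
    (hF' : F ∈ edgesOf K') : K' ∈ T.patch K := by
  obtain ⟨h1, h2⟩ := Finset.mem_powersetCard.1 hF
  obtain ⟨z, hz⟩ := Finset.card_pos.1 (by rw [h2]; norm_num : 0 < F.card)
  exact Finset.mem_filter.2 ⟨hK', z, Finset.mem_inter.2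
    ⟨h1 hz, (Finset.mem_powersetCard.1 hF').1 hz⟩⟩

lemma IsSetting.edge_jump (hs : T.IsSetting σ u G v) {K F : Finset Plane} (hFK : F ∈ edgesOf K)
    (hF : T.IsInterior F) (hsub : (hull F ∩ P.Γ).Subsingleton) {gp₁ gm₁ ν₁ gp₂ gm₂ ν₂ : Plane}
    {b₁ b₂ : ℝ} (ph₁ : T.Phase v (T.K₁ F) gp₁ gm₁ ν₁ b₁) (ph₂ : T.Phase v (T.K₂ F) gp₂ gm₂ ν₂ b₂)
    {θ : ℝ} (hθ : 0 < θ) :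
    (4 * θ * h F ≤ T.hp F →
      θ * h F * (√P.αp * ‖gp₁ - gp₂‖) ≤ (1 + σ) * jumpConst σ P.ρ * T.bound G v K) ∧
    (4 * θ * h F ≤ T.hm F →
      θ * h F * (√P.αm * ‖gm₁ - gm₂‖) ≤ (1 + σ) * jumpConst σ P.ρ * T.bound G v K) := by
  obtain ⟨a, b, hab, hFe, hh, hn1, hn⟩ := T.exists_ends hF.1
  have hσ := hs.σ_pos
  have hh0 := T.h_pos hF.1
  have hE₁ := T.mem_edgesOf_K₁ hF.1
  have hE₂ := T.mem_edgesOf_K₂ hF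
  have hp₁ := T.mem_patch_of_edge (T.K₁_mem F hF.1).1 hFK hE₁
  have hp₂ := T.mem_patch_of_edge (T.K₂_mem F hF.1 hF.2).1 hFK hE₂
  have hΩ := T.sdiff_subset hσ hs.shape hF
  have hrotneg : rot (-T.n F) = -rot (T.n F) := by ext i; fin_cases i <;> simp
  set r := θ * h F / (1 + σ) with hr
  have hr0 : 0 < r := by positivity
  have hθ1 : 4 * θ * h F ≤ h F → r ≤ h F := fun h4 =>
    (div_le_self (by positivity) (by linarith)).trans (by nlinarith [mul_pos hθ hh0])
  have hfull : ∀ U : Set Plane, (μH[1] (hull F ∩ U)).toReal ≤ h F := fun U => by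
    refine ENNReal.toReal_le_of_le_ofReal hh0.le ?_
    rw [← T.hausdorffMeasure_hull_edge hF.1]
    exact measure_mono inter_subset_left
  have key : ∀ (U : Set Plane), (U = P.Ωp ∨ U = P.Ωm) → 4 * θ * h F ≤ (μH[1] (hull F ∩ U)).toReal →
      ∀ {α₀ : ℝ} {g₁ g₂ : Plane}, 0 < α₀ → α₀ ≤ P.αmax →
      P.αmax ≤ InterfaceProblem.contrast P.ρ * α₀ →
      (∀ {x₀ : Plane} {φ : Plane → ℝ}, (∀ s : ℝ, |s| ≤ r → x₀ + s • rot (T.n F) ∈ (hull F \ F) ∩ U) →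
        (∀ x, ‖x - x₀‖ ≤ r → (x ∈ hull (T.K₁ F) ↔ ⟪T.n F, x - x₀⟫_ℝ ≤ 0)) → IsBump bumpConst x₀ r φ →
        T.SeesPhase v (T.K₁ F) (T.n F) x₀ φ α₀ g₁) →
      (∀ {x₀ : Plane} {φ : Plane → ℝ}, (∀ s : ℝ, |s| ≤ r → x₀ + s • rot (T.n F) ∈ (hull F \ F) ∩ U) →
        (∀ x, ‖x - x₀‖ ≤ r → (x ∈ hull (T.K₂ F) ↔ ⟪-T.n F, x - x₀⟫_ℝ ≤ 0)) → IsBump bumpConst x₀ r φ →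
        T.SeesPhase v (T.K₂ F) (-T.n F) x₀ φ α₀ g₂) →
      θ * h F * (√α₀ * ‖g₁ - g₂‖) ≤ (1 + σ) * jumpConst σ P.ρ * T.bound G v K := by
    intro U hU hv α₀ g₁ g₂ h0 h1 h2 s₁ s₂
    obtain ⟨τ, t1, t2, hin⟩ := T.exists_inner_point hσ hs.shape hF hab hFe hsub hU hθ hv
    set x₀ := (1 - τ) • a + τ • b
    have hrad : r < 2 * (h F / σ) * θ := by
      have : r < θ * h F / σ := div_lt_div_of_pos_left (by positivity) hσ (by linarith)
      have e : 2 * (h F / σ) * θ = 2 * (θ * h F / σ) := by ring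
      have : 0 < θ * h F / σ := by positivity
      linarith
    have near := fun x (hx : ‖x - x₀‖ ≤ r) =>
      T.mem_hull_iff_near_interior_edge hσ hs.shape hF hab hFe t1 t2 (hx.trans_lt hrad)
    have hball : Metric.closedBall x₀ r ⊆ P.Ω :=
      (Metric.closedBall_subset_ball hrad).trans (T.ball_subset hσ hs.shape hF hab hFe t1 t2)
    obtain ⟨φ, hφ⟩ := exists_isBump x₀ hr0
    have hrh := hθ1 (hv.trans (hfull U))
    have := hs.jump_le T hp₁ hp₂ hn1 hr0 (hrh.trans (h_le_diam hE₁)) (hrh.trans (h_le_diam hE₂))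
      (fun x hx => (near x hx).1) (fun x hx => (near x hx).2) hball hφ h0 h1 h2
      (s₁ hin (fun x hx => (near x hx).1) hφ) (s₂ hin (fun x hx => (near x hx).2) hφ)
    calc θ * h F * (√α₀ * ‖g₁ - g₂‖) = (1 + σ) * (r * (√α₀ * ‖g₁ - g₂‖)) := by
          rw [hr]; field_simp
      _ ≤ (1 + σ) * (jumpConst σ P.ρ * T.bound G v K) := by gcongr
      _ = _ := by ring
  refine ⟨fun hv => key P.Ωp (Or.inl rfl) hv P.αp_pos (le_max_left _ _) P.αmax_le_p ?_ ?_,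
    fun hv => key P.Ωm (Or.inr rfl) hv P.αm_pos (le_max_right _ _) P.αmax_le_m ?_ ?_⟩
  · intro x₀ φ hin near hφ
    exact ph₁.seesPhase_pos hn1 near hφ fun s hs' =>
      ph₁.edge_pos F hE₁ hΩ hsub _ (hin s hs').1 (hin s hs').2
  · intro x₀ φ hin near hφ
    refine ph₂.seesPhase_pos (by rw [norm_neg, hn1]) near hφ fun s hs' => ?_
    rw [hrotneg, smul_neg, ← neg_smul]
    have := hin (-s) (by rwa [abs_neg])
    exact ph₂.edge_pos F hE₂ hΩ hsub _ this.1 this.2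
  · intro x₀ φ hin near hφ
    exact ph₁.seesPhase_neg hn1 near hφ fun s hs' =>
      ph₁.edge_neg F hE₁ hΩ hsub _ (hin s hs').1 (hin s hs').2
  · intro x₀ φ hin near hφ
    refine ph₂.seesPhase_neg (by rw [norm_neg, hn1]) near hφ fun s hs' => ?_
    rw [hrotneg, smul_neg, ← neg_smul]
    have := hin (-s) (by rwa [abs_neg])
    exact ph₂.edge_neg F hE₂ hΩ hsub _ this.1 this.2

/-! ### The norms of the jumps -/

lemma nullMeasure_sdiff {F : Finset Plane} (hΩ : hull F \ F ⊆ P.Ω)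
    (hsub : (hull F ∩ P.Γ).Subsingleton) :
    ∀ᵐ x ∂(μH[1].restrict (hull F)), x ∈ hull F \ F ∧ (x ∈ P.Ωp ∨ x ∈ P.Ωm) := by
  have := Measure.nullSingletonClass_hausdorff Plane (show (0 : ℝ) < 1 by norm_num)
  have h1 : (μH[1] : Measure Plane) (F : Set Plane) = 0 := F.finite_toSet.measure_zero _
  have h2 : (μH[1] : Measure Plane) (hull F ∩ P.Γ) = 0 := hsub.measure_zero _
  rw [ae_restrict_iff' (isClosed_hull F).measurableSet]
  filter_upwards [compl_mem_ae_iff.2 h1, compl_mem_ae_iff.2 h2] with x hx1 hx2 hx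
  exact ⟨⟨hx, hx1⟩, P.mem_side (hΩ ⟨hx, hx1⟩) fun h => hx2 ⟨hx, h⟩⟩

lemma integral_edge {F : Finset Plane} (hF : F ∈ T.edges) (hΩ : hull F \ F ⊆ P.Ω)
    (hsub : (hull F ∩ P.Γ).Subsingleton) {φ : Plane → ℝ} {cp cm : ℝ}
    (hp : ∀ x ∈ hull F \ F, x ∈ P.Ωp → φ x = cp) (hm : ∀ x ∈ hull F \ F, x ∈ P.Ωm → φ x = cm) :
    ∫ x in hull F, φ x ∂μH[1] = cp * T.hp F + cm * T.hm F := by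
  have hfin : IsFiniteMeasure ((μH[1] : Measure Plane).restrict (hull F)) := ⟨by
    rw [Measure.restrict_apply_univ, T.hausdorffMeasure_hull_edge hF]; exact ENNReal.ofReal_lt_top⟩
  have hae : φ =ᵐ[μH[1].restrict (hull F)] fun x =>
      P.Ωp.indicator (fun _ => cp) x + P.Ωm.indicator (fun _ => cm) x := by
    filter_upwards [nullMeasure_sdiff hΩ hsub] with x hx
    rcases hx.2 with h | h
    · rw [hp x hx.1 h, indicator_of_mem h, indicator_of_notMem fun h' => P.disjoint_Ω.le_bot ⟨h, h'⟩,
        add_zero]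
    · rw [hm x hx.1 h, indicator_of_mem h, indicator_of_notMem fun h' => P.disjoint_Ω.le_bot ⟨h', h⟩,
        zero_add]
  rw [integral_congr_ae hae, integral_add ((integrable_const _).indicator P.isOpen_Ωp.measurableSet)
    ((integrable_const _).indicator P.isOpen_Ωm.measurableSet),
    integral_indicator P.isOpen_Ωp.measurableSet, integral_indicator P.isOpen_Ωm.measurableSet,
    integral_const, integral_const]
  simp only [Mesh.hp, Mesh.hm, Measure.real, Measure.restrict_apply_univ, smul_eq_mul,
    Measure.restrict_apply P.isOpen_Ωp.measurableSet, Measure.restrict_apply P.isOpen_Ωm.measurableSet]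
  rw [inter_comm P.Ωp, inter_comm P.Ωm]
  ring

lemma hp_add_hm {F : Finset Plane} (hF : F ∈ T.edges) (hΩ : hull F \ F ⊆ P.Ω)
    (hsub : (hull F ∩ P.Γ).Subsingleton) : T.hp F + T.hm F = h F := by
  have := T.integral_edge hF hΩ hsub (φ := fun _ => 1) (cp := 1) (cm := 1) (fun _ _ _ => rfl)
    (fun _ _ _ => rfl)
  rw [one_mul, one_mul] at this
  rw [← this]
  simp [Measure.real, T.hausdorffMeasure_hull_edge hF, (T.h_pos hF).le]

lemma hp_nonneg (F : Finset Plane) : 0 ≤ T.hp F := ENNReal.toReal_nonneg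

lemma hm_nonneg (F : Finset Plane) : 0 ≤ T.hm F := ENNReal.toReal_nonneg

lemma tangSq_nonneg (F : Finset Plane) : 0 ≤ T.tangSq v F := by
  refine integral_nonneg fun x => mul_nonneg ?_ (sq_nonneg _)
  unfold αF
  split_ifs
  · exact (T.αt_pos _ x).le.trans (le_max_left _ _)
  · exact (T.αt_pos _ x).le

/-- The jump terms of an interior edge in terms of the jumps of the two phases. -/
lemma fluxSq_add_tangSq {F : Finset Plane} (hF : T.IsInterior F) (hΩ : hull F \ F ⊆ P.Ω)
    (hsub : (hull F ∩ P.Γ).Subsingleton) {gp₁ gm₁ ν₁ gp₂ gm₂ ν₂ : Plane}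
    {b₁ b₂ : ℝ} (ph₁ : T.Phase v (T.K₁ F) gp₁ gm₁ ν₁ b₁) (ph₂ : T.Phase v (T.K₂ F) gp₂ gm₂ ν₂ b₂) :
    T.fluxSq v F + T.tangSq v F
      = P.αp * ‖gp₁ - gp₂‖ ^ 2 * T.hp F + P.αm * ‖gm₁ - gm₂‖ ^ 2 * T.hm F := by
  have hE₁ := T.mem_edgesOf_K₁ hF.1
  have hE₂ := T.mem_edgesOf_K₂ hF
  have hn1 := T.norm_n F hF.1
  have ht : T.t F = rot (T.n F) := by ext i; fin_cases i <;> simp [Mesh.t]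
  have vp : ∀ x ∈ hull F \ F, x ∈ P.Ωp → (T.αt (T.K₁ F) x = P.αp ∧ grad v (T.K₁ F) x = gp₁) ∧
      (T.αt (T.K₂ F) x = P.αp ∧ grad v (T.K₂ F) x = gp₂) := fun x hx hp =>
    ⟨ph₁.pos x (hull_mono (Finset.mem_powersetCard.1 hE₁).1 hx.1) (ph₁.edge_pos F hE₁ hΩ hsub x hx hp),
      ph₂.pos x (hull_mono (Finset.mem_powersetCard.1 hE₂).1 hx.1) (ph₂.edge_pos F hE₂ hΩ hsub x hx hp)⟩
  have vm : ∀ x ∈ hull F \ F, x ∈ P.Ωm → (T.αt (T.K₁ F) x = P.αm ∧ grad v (T.K₁ F) x = gm₁) ∧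
      (T.αt (T.K₂ F) x = P.αm ∧ grad v (T.K₂ F) x = gm₂) := fun x hx hp =>
    ⟨ph₁.neg x (hull_mono (Finset.mem_powersetCard.1 hE₁).1 hx.1) (ph₁.edge_neg F hE₁ hΩ hsub x hx hp),
      ph₂.neg x (hull_mono (Finset.mem_powersetCard.1 hE₂).1 hx.1) (ph₂.edge_neg F hE₂ hΩ hsub x hx hp)⟩
  have h1 : T.fluxSq v F = P.αp * ⟪gp₁ - gp₂, T.n F⟫_ℝ ^ 2 * T.hp F
      + P.αm * ⟪gm₁ - gm₂, T.n F⟫_ℝ ^ 2 * T.hm F := by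
    have hp0 := P.αp_pos.ne'
    have hm0 := P.αm_pos.ne'
    refine T.integral_edge hF.1 hΩ hsub (fun x hx hs => ?_) (fun x hx hs => ?_)
    · obtain ⟨⟨e1, e2⟩, e3, e4⟩ := vp x hx hs
      simp only [αF, jn, if_pos hF, e1, e2, e3, e4, max_self, real_inner_smul_left, inner_sub_left]
      field_simp
    · obtain ⟨⟨e1, e2⟩, e3, e4⟩ := vm x hx hs
      simp only [αF, jn, if_pos hF, e1, e2, e3, e4, max_self, real_inner_smul_left, inner_sub_left]
      field_simp
  have h2 : T.tangSq v F = P.αp * ⟪gp₁ - gp₂, rot (T.n F)⟫_ℝ ^ 2 * T.hp F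
      + P.αm * ⟪gm₁ - gm₂, rot (T.n F)⟫_ℝ ^ 2 * T.hm F := by
    refine T.integral_edge hF.1 hΩ hsub (fun x hx hs => ?_) (fun x hx hs => ?_)
    · obtain ⟨⟨e1, e2⟩, e3, e4⟩ := vp x hx hs
      simp only [αF, jt, if_pos hF, e1, e2, e3, e4, max_self, ht, inner_sub_left]
    · obtain ⟨⟨e1, e2⟩, e3, e4⟩ := vm x hx hs
      simp only [αF, jt, if_pos hF, e1, e2, e3, e4, max_self, ht, inner_sub_left]
  rw [h1, h2, ← inner_sq_add_inner_rot_sq hn1 (gp₁ - gp₂), ← inner_sq_add_inner_rot_sq hn1 (gm₁ - gm₂)]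
  ring

/-- The constant in the bound for one edge. -/
def edgeConst (σ ρ : ℝ) : ℝ := (1 + σ) * jumpConst σ ρ

/-- An edge that is not cut into small pieces. -/
lemma IsSetting.edge_le (hs : T.IsSetting σ u G v) {K F : Finset Plane} (hFK : F ∈ edgesOf K)
    (hF : T.IsInterior F) (hsub : (hull F ∩ P.Γ).Subsingleton) {θ : ℝ} (hθ : 0 < θ)
    (hp : T.hp F = 0 ∨ 4 * θ * h F ≤ T.hp F) (hm : T.hm F = 0 ∨ 4 * θ * h F ≤ T.hm F) :
    h F / 2 * T.fluxSq v F + h F / 2 * T.tangSq v F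
      ≤ (edgeConst σ P.ρ / θ * T.bound G v K) ^ 2 := by
  have hσ := hs.σ_pos
  have hh0 := T.h_pos hF.1
  have hΩ := T.sdiff_subset hσ hs.shape hF
  obtain ⟨gp₁, gm₁, ν₁, b₁, ph₁⟩ := T.exists_phase hs.cut hs.ife (T.K₁_mem F hF.1).1
  obtain ⟨gp₂, gm₂, ν₂, b₂, ph₂⟩ := T.exists_phase hs.cut hs.ife (T.K₂_mem F hF.1 hF.2).1
  obtain ⟨jp, jm⟩ := hs.edge_jump T hFK hF hsub ph₁ ph₂ hθ
  have hsum := T.hp_add_hm hF.1 hΩ hsub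
  have hp0 := T.hp_nonneg F
  have hm0 := T.hm_nonneg F
  have aux : ∀ {α₀ d l : ℝ}, 0 < α₀ → 0 ≤ d → 0 ≤ l → l ≤ h F → (l = 0 ∨ 4 * θ * h F ≤ l) →
      (4 * θ * h F ≤ l → θ * h F * (√α₀ * d) ≤ (1 + σ) * jumpConst σ P.ρ * T.bound G v K) →
      h F * (α₀ * d ^ 2 * l) ≤ (edgeConst σ P.ρ / θ * T.bound G v K) ^ 2 := by
    intro α₀ d l hα hd hl hlh hor hj
    rcases hor with h0 | h0
    · rw [h0]; simp only [mul_zero]; positivity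
    · have h1 : h F * (√α₀ * d) ≤ edgeConst σ P.ρ / θ * T.bound G v K := by
        rw [div_mul_eq_mul_div, le_div_iff₀ hθ]
        unfold edgeConst
        linarith [hj h0]
      calc h F * (α₀ * d ^ 2 * l) ≤ h F * (α₀ * d ^ 2 * h F) := by gcongr
        _ = (h F * (√α₀ * d)) ^ 2 := by
          rw [mul_pow, mul_pow, Real.sq_sqrt hα.le]; ring
        _ ≤ _ := pow_le_pow_left₀ (by positivity) h1 2
  have e1 := aux P.αp_pos (norm_nonneg (gp₁ - gp₂)) hp0 (by linarith) hp jp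
  have e2 := aux P.αm_pos (norm_nonneg (gm₁ - gm₂)) hm0 (by linarith) hm jm
  rw [← mul_add, T.fluxSq_add_tangSq hF hΩ hsub ph₁ ph₂]
  linarith

/-! ### Edges of interface elements -/

lemma IsInterfaceEdge.isInterior {T : Mesh P} {F : Finset Plane} (hF : T.IsInterfaceEdge F) :
    T.IsInterior F := by
  obtain ⟨x, hx, hxΓ⟩ := hF.2.1
  exact ⟨hF.1, fun h => P.notMem_Γ_of_mem_frontier (h hx) hxΓ⟩

lemma IsInterfaceEdge.subsingleton {T : Mesh P} (hcut : T.RegularCut) {F : Finset Plane}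
    (hF : T.IsInterfaceEdge F) : (hull F ∩ P.Γ).Subsingleton := by
  by_contra h
  exact hF.2.2 (hcut.edge F hF.1 (Set.not_subsingleton_iff.1 h))

/-- An edge of an interface element that is not an interface edge does not meet the interface. -/
lemma notMem_Γ_of_not_isInterfaceEdge (hcut : T.RegularCut) {K F : Finset Plane}
    (hK : T.IsInterfaceElement K) (hF : F ∈ edgesOf K) (hni : ¬ T.IsInterfaceEdge F) :
    ∀ x ∈ hull F, x ∉ P.Γ := by
  intro x hx hxΓ
  have hFE : F ∈ T.edges := Finset.mem_biUnion.2 ⟨K, hK.1, hF⟩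
  have hsub : hull F ⊆ P.Γ := by
    by_contra h
    exact hni ⟨hFE, ⟨x, hx, hxΓ⟩, h⟩
  obtain ⟨s, t, -, -, -, hfr, -⟩ := hcut.element K hK
  have hfin : (hull F).Finite := ((Set.finite_singleton (P.γ t)).insert (P.γ s)).subset fun y hy =>
    hfr ▸ ⟨hsub hy, T.hull_edge_subset_frontier hK.1 hF hy⟩
  have := Measure.nullSingletonClass_hausdorff Plane (show (0 : ℝ) < 1 by norm_num)
  have h0 : (μH[1] : Measure Plane) (hull F) = 0 := hfin.measure_zero _
  rw [T.hausdorffMeasure_hull_edge hFE, ENNReal.ofReal_eq_zero] at h0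
  exact absurd (T.h_pos hFE) (not_lt.2 h0)

/-- The bound for uncut interior edges. -/
lemma IsSetting.uncut_edge_le (hs : T.IsSetting σ u G v) {K F : Finset Plane}
    (hK : T.IsInterfaceElement K) (hFK : F ∈ edgesOf K) (hF : T.IsInterior F)
    (hni : ¬ T.IsInterfaceEdge F) :
    h F / 2 * T.fluxSq v F ≤ (4 * edgeConst σ P.ρ * T.bound G v K) ^ 2 := by
  have hΓ := T.notMem_Γ_of_not_isInterfaceEdge hs.cut hK hFK hni
  have hsub : (hull F ∩ P.Γ).Subsingleton := fun x hx => absurd hx.2 (hΓ x hx.1)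
  have hh0 := T.h_pos hF.1
  have hΩ := T.sdiff_subset hs.σ_pos hs.shape hF
  have hsum := T.hp_add_hm hF.1 hΩ hsub
  have hor : T.hp F = 0 ∨ T.hm F = 0 := by
    obtain ⟨a, b, hab, hFe, -⟩ := T.exists_ends hF.1
    have := Measure.nullSingletonClass_hausdorff Plane (show (0 : ℝ) < 1 by norm_num)
    have hF0 : (μH[1] : Measure Plane) (F : Set Plane) = 0 := F.finite_toSet.measure_zero _
    have hcont : Continuous fun τ : ℝ => (1 - τ) • a + τ • b := by fun_prop
    have hmem : ∀ x ∈ hull F \ F, x ∈ (fun τ : ℝ => (1 - τ) • a + τ • b) '' Ioo 0 1 := by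
      intro x hx
      rw [hFe] at hx
      obtain ⟨τ, h0, h1, rfl⟩ := mem_sdiff_pair hx
      exact ⟨τ, ⟨h0, h1⟩, rfl⟩
    have hmem' : (fun τ : ℝ => (1 - τ) • a + τ • b) '' Ioo 0 1 ⊆ hull F \ F := by
      rintro _ ⟨τ, hτ, rfl⟩
      rw [hFe]
      exact segment_point_mem_sdiff hab hτ.1 hτ.2
    rcases P.subset_side (isPreconnected_Ioo.image _ hcont.continuousOn) (hmem'.trans hΩ)
      (fun x hx => hΓ x (hmem' hx).1) with h | h
    · right
      rw [Mesh.hm, measure_mono_null (fun x hx => ?_) hF0, ENNReal.toReal_zero]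
      by_contra hxF
      exact P.disjoint_Ω.le_bot ⟨h (hmem x ⟨hx.1, hxF⟩), hx.2⟩
    · left
      rw [Mesh.hp, measure_mono_null (fun x hx => ?_) hF0, ENNReal.toReal_zero]
      by_contra hxF
      exact P.disjoint_Ω.le_bot ⟨hx.2, h (hmem x ⟨hx.1, hxF⟩)⟩
  have hor' : (T.hp F = 0 ∨ 4 * (1 / 4) * h F ≤ T.hp F) ∧ (T.hm F = 0 ∨ 4 * (1 / 4) * h F ≤ T.hm F) := by
    rcases hor with h0 | h0
    · exact ⟨Or.inl h0, Or.inr (by linarith)⟩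
    · exact ⟨Or.inr (by linarith), Or.inl h0⟩
  have := hs.edge_le T hFK hF hsub (θ := 1 / 4) (by norm_num) hor'.1 hor'.2
  have e : edgeConst σ P.ρ / (1 / 4) = 4 * edgeConst σ P.ρ := by ring
  rw [e] at this
  have ht := mul_nonneg (by positivity : (0 : ℝ) ≤ h F / 2) (T.tangSq_nonneg (v := v) F)
  linarith

/-- The bound for interface edges that are cut in a moderate ratio. -/
lemma IsSetting.edge_le_of_ratio (hs : T.IsSetting σ u G v) {K F : Finset Plane}
    (hFK : F ∈ edgesOf K) (hF : T.IsInterfaceEdge F) {lam Lam : ℝ} (hlam : 0 < lam)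
    (h1 : lam ≤ T.hp F / T.hm F) (h2 : T.hp F / T.hm F ≤ Lam) :
    h F / 2 * T.fluxSq v F + h F / 2 * T.tangSq v F
      ≤ (edgeConst σ P.ρ / (min (lam / (1 + lam)) (1 / (1 + Lam)) / 4) * T.bound G v K) ^ 2 := by
  have hI := hF.isInterior
  have hsub := hF.subsingleton hs.cut
  have hsum := T.hp_add_hm hF.1 (T.sdiff_subset hs.σ_pos hs.shape hI) hsub
  have hh0 := T.h_pos hF.1
  have hm0 : 0 < T.hm F := by
    refine lt_of_le_of_ne (T.hm_nonneg F) fun h => ?_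
    rw [← h, div_zero] at h1
    linarith
  have hLam : 0 < Lam := by linarith
  rw [le_div_iff₀ hm0] at h1
  rw [div_le_iff₀ hm0] at h2
  set θ := min (lam / (1 + lam)) (1 / (1 + Lam)) / 4 with hθ
  have hθ0 : 0 < θ := by
    have : 0 < min (lam / (1 + lam)) (1 / (1 + Lam)) := lt_min (by positivity) (by positivity)
    positivity
  refine hs.edge_le T hFK hI hsub hθ0 (Or.inr ?_) (Or.inr ?_)
  · have : 4 * θ ≤ lam / (1 + lam) := by rw [hθ]; linarith [min_le_left (lam / (1 + lam)) (1 / (1 + Lam))]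
    calc 4 * θ * h F ≤ lam / (1 + lam) * h F := by gcongr
      _ ≤ T.hp F := by
        rw [div_mul_eq_mul_div, div_le_iff₀ (by positivity)]
        nlinarith
  · have : 4 * θ ≤ 1 / (1 + Lam) := by rw [hθ]; linarith [min_le_right (lam / (1 + lam)) (1 / (1 + Lam))]
    calc 4 * θ * h F ≤ 1 / (1 + Lam) * h F := by gcongr
      _ ≤ T.hm F := by
        rw [div_mul_eq_mul_div, div_le_iff₀ (by positivity)]
        nlinarith

end Mesh

/-! ### Chords of the interface -/

/-- The normalization of a vector. -/
def unitOf (w : Plane) : Plane := ‖w‖⁻¹ • w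

lemma norm_unitOf {w : Plane} (hw : w ≠ 0) : ‖unitOf w‖ = 1 := by
  rw [unitOf, norm_smul, norm_inv, norm_norm, inv_mul_cancel₀ (norm_ne_zero_iff.2 hw)]

lemma unitOf_smul (w : Plane) {c : ℝ} (hc : 0 < c) : unitOf (c • w) = unitOf w := by
  rw [unitOf, unitOf, norm_smul, Real.norm_of_nonneg hc.le, smul_smul, mul_inv]
  congr 1
  field_simp

lemma norm_unitOf_sub_le {w τ : Plane} (hτ : ‖τ‖ = 1) (hw : w ≠ 0) : ‖unitOf w - τ‖ ≤ 2 * ‖w - τ‖ := by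
  have h1 : ‖unitOf w - w‖ ≤ ‖w - τ‖ := by
    have : unitOf w - w = (1 - ‖w‖) • unitOf w := by
      rw [sub_smul, one_smul, unitOf, smul_smul, mul_inv_cancel₀ (norm_ne_zero_iff.2 hw), one_smul]
    rw [this, norm_smul, norm_unitOf hw, mul_one, Real.norm_eq_abs, ← hτ, norm_sub_rev]
    exact abs_norm_sub_norm_le _ _
  calc ‖unitOf w - τ‖ = ‖(unitOf w - w) + (w - τ)‖ := by congr 1; abel
    _ ≤ _ := (norm_add_le _ _).trans (by linarith)

namespace InterfaceProblem

variable (P : InterfaceProblem)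

lemma deriv_γ_eq {x y : ℝ} (h : P.γ x = P.γ y) : deriv P.γ x = deriv P.γ y := by
  have hper : Function.Periodic (deriv P.γ) P.len := by
    intro z
    have : (fun w => P.γ (w + P.len)) = P.γ := funext P.γ_periodic
    conv_rhs => rw [← this, deriv_comp_add_const]
  have e : ∀ z, ∃ z' ∈ Ico (0 : ℝ) P.len, P.γ z = P.γ z' ∧ deriv P.γ z = deriv P.γ z' := fun z => by
    refine ⟨toIcoMod P.len_pos 0 z, by simpa using toIcoMod_mem_Ico P.len_pos 0 z, ?_, ?_⟩
    · rw [toIcoMod]; exact (P.γ_periodic.sub_zsmul_eq _).symm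
    · rw [toIcoMod]; exact (hper.sub_zsmul_eq _).symm
  obtain ⟨x', hx', h1, h2⟩ := e x
  obtain ⟨y', hy', h3, h4⟩ := e y
  rw [h2, h4, P.γ_injOn hx' hy' (by rw [← h1, ← h3, h])]

/-- The direction of a chord differs from the tangent by the curvature times the extent of the
arc. -/
lemma norm_unitOf_chord_sub_le {κ : ℝ} (hκ : ∀ s, ‖deriv (deriv P.γ) s‖ ≤ κ) {s t H : ℝ} (hst : s < t)
    (hne : P.γ s ≠ P.γ t) (hH : ∀ τ ∈ Icc s t, ‖P.γ τ - P.γ s‖ ≤ H) {r : ℝ} (hr : r ∈ Icc s t) :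
    ‖unitOf (P.γ t - P.γ s) - deriv P.γ r‖ ≤ 8 * κ * H := by
  have hκ0 : 0 ≤ κ := (norm_nonneg _).trans (hκ 0)
  have hne' : P.γ t - P.γ s ≠ 0 := sub_ne_zero.2 hne.symm
  have hd1 : Differentiable ℝ P.γ := P.γ_contDiff.differentiable (by norm_num)
  have hd2 : Differentiable ℝ (deriv P.γ) :=
    (P.γ_contDiff.deriv' (n := 1)).differentiable (by norm_num)
  have hlip : ∀ x y, ‖deriv P.γ x - deriv P.γ y‖ ≤ κ * |x - y| := fun x y => by
    simpa using convex_univ.norm_image_sub_le_of_norm_deriv_le (fun z _ => hd2 z) (fun z _ => hκ z)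
      (mem_univ y) (mem_univ x)
  have htay : ∀ x ≥ s, ∀ y ∈ Icc s x, ‖P.γ x - P.γ s - (x - s) • deriv P.γ y‖ ≤ κ * (x - s) * (x - s) := by
    intro x hx y hy
    have := (convex_Icc s x).norm_image_sub_le_of_norm_deriv_le
      (f := fun z => P.γ z - z • deriv P.γ y) (C := κ * (x - s))
      (fun z _ => by fun_prop) (fun z hz => by
        have hz' : HasDerivAt (fun z => P.γ z - z • deriv P.γ y) (deriv P.γ z - (1 : ℝ) • deriv P.γ y) z :=
          (hd1 z).hasDerivAt.sub ((hasDerivAt_id z).smul_const _)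
        rw [hz'.deriv, one_smul]
        refine (hlip z y).trans ?_
        gcongr
        rw [abs_le]; constructor <;> linarith [hz.1, hz.2, hy.1, hy.2])
      (left_mem_Icc.2 hx) (right_mem_Icc.2 hx)
    rw [Real.norm_of_nonneg (sub_nonneg.2 hx)] at this
    have e : P.γ x - P.γ s - (x - s) • deriv P.γ y
        = P.γ x - x • deriv P.γ y - (P.γ s - s • deriv P.γ y) := by module
    rw [e]
    exact this
  have hH0 : 0 ≤ H := (norm_nonneg _).trans (hH s (left_mem_Icc.2 hst.le))
  by_cases hsmall : 1 / 4 ≤ κ * H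
  · calc ‖unitOf (P.γ t - P.γ s) - deriv P.γ r‖ ≤ ‖unitOf (P.γ t - P.γ s)‖ + ‖deriv P.γ r‖ :=
          norm_sub_le _ _
      _ = 2 := by rw [norm_unitOf hne', P.γ_unitSpeed]; norm_num
      _ ≤ _ := by linarith
  push Not at hsmall
  have hlow : ∀ x ∈ Icc s t, κ * (x - s) ≤ 1 / 2 → x - s ≤ 2 * H := by
    intro x hx hx2
    have h1 := htay x hx.1 s (left_mem_Icc.2 hx.1)
    have h2 := hH x hx
    have h3 : ‖(x - s) • deriv P.γ s‖ = x - s := by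
      rw [norm_smul, P.γ_unitSpeed, mul_one, Real.norm_of_nonneg (sub_nonneg.2 hx.1)]
    have h4 : ‖(x - s) • deriv P.γ s‖ ≤ ‖P.γ x - P.γ s‖ + ‖P.γ x - P.γ s - (x - s) • deriv P.γ s‖ := by
      have := norm_sub_le (P.γ x - P.γ s) (P.γ x - P.γ s - (x - s) • deriv P.γ s)
      rwa [sub_sub_cancel] at this
    have h5 : κ * (x - s) * (x - s) ≤ 1 / 2 * (x - s) :=
      mul_le_mul_of_nonneg_right hx2 (sub_nonneg.2 hx.1)
    linarith
  have hlen : t - s ≤ 2 * H := by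
    refine hlow t (right_mem_Icc.2 hst.le) ?_
    by_contra hcon
    push Not at hcon
    have hκp : 0 < κ := by
      rcases hκ0.eq_or_lt with h | h
      · rw [← h] at hcon; norm_num at hcon
      · exact h
    have hx : s + 1 / (2 * κ) ∈ Icc s t := by
      refine ⟨by have : 0 < 1 / (2 * κ) := by positivity
                 linarith, ?_⟩
      have : 1 / (2 * κ) ≤ t - s := by
        rw [div_le_iff₀ (by positivity)]; linarith
      linarith
    have := hlow _ hx (by rw [add_sub_cancel_left]; field_simp; rfl)
    rw [add_sub_cancel_left, div_le_iff₀ (by positivity)] at this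
    linarith
  have hts : 0 < t - s := sub_pos.2 hst
  set w := (t - s)⁻¹ • (P.γ t - P.γ s) with hw
  have hwne : w ≠ 0 := smul_ne_zero (inv_ne_zero hts.ne') hne'
  have hwr : ‖w - deriv P.γ r‖ ≤ κ * (t - s) := by
    have e : w - deriv P.γ r = (t - s)⁻¹ • (P.γ t - P.γ s - (t - s) • deriv P.γ r) := by
      rw [smul_sub _ _ ((t - s) • _), smul_smul, inv_mul_cancel₀ hts.ne', one_smul]
    rw [e, norm_smul, norm_inv, Real.norm_of_nonneg hts.le, inv_mul_le_iff₀ hts]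
    exact (htay t hst.le r hr).trans_eq (by ring)
  rw [← unitOf_smul _ (inv_pos.2 hts)]
  calc _ ≤ 2 * ‖w - deriv P.γ r‖ := norm_unitOf_sub_le (P.γ_unitSpeed r) hwne
    _ ≤ 2 * (κ * (2 * H)) := by gcongr; exact hwr.trans (by gcongr)
    _ ≤ _ := by nlinarith [mul_nonneg hκ0 hH0]

end InterfaceProblem

/-! ### The relation of the two phases -/

lemma eq_of_flux_tang {ν w p m : Plane} {ρ : ℝ} (hν : ν ≠ 0) (hw : w ≠ 0) (hνw : ⟪ν, w⟫_ℝ = 0)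
    (hflux : ⟪m, ν⟫_ℝ = ρ * ⟪p, ν⟫_ℝ) (htang : ⟪p, w⟫_ℝ = ⟪m, w⟫_ℝ) :
    m = ρ • p + ((1 - ρ) * ⟪p, unitOf w⟫_ℝ) • unitOf w := by
  have he : ⟪ν, unitOf w⟫_ℝ = 0 := by rw [unitOf, real_inner_smul_right, hνw, mul_zero]
  have hee : ⟪unitOf w, unitOf w⟫_ℝ = 1 := by
    rw [real_inner_self_eq_norm_sq, norm_unitOf hw]; norm_num
  have hme : ⟪m, unitOf w⟫_ℝ = ⟪p, unitOf w⟫_ℝ := by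
    rw [unitOf, real_inner_smul_right, real_inner_smul_right, htang]
  have hne : unitOf w ≠ 0 := by rw [← norm_pos_iff, norm_unitOf hw]; norm_num
  rw [← sub_eq_zero]
  set z := m - (ρ • p + ((1 - ρ) * ⟪p, unitOf w⟫_ℝ) • unitOf w) with hz
  have h1 : ⟪ν, z⟫_ℝ = 0 := by
    rw [hz, inner_sub_right, inner_add_right, real_inner_smul_right, real_inner_smul_right, he,
      real_inner_comm, hflux, real_inner_comm p ν]
    ring
  have h2 : ⟪z, unitOf w⟫_ℝ = 0 := by
    rw [hz, inner_sub_left, inner_add_left, real_inner_smul_left, real_inner_smul_left, hee, hme]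
    ring
  obtain ⟨c, hc⟩ := eq_smul_of_inner_eq_zero hν hne h1 he
  rw [hc, real_inner_smul_left, hee, mul_one] at h2
  rw [hc, h2, zero_smul]

lemma norm_transfer_le {e p : Plane} (he : ‖e‖ = 1) {ρ R : ℝ} (hρ : 0 < ρ) (hR : ρ ≤ R) (h1 : 1 ≤ R) :
    ‖ρ • p + ((1 - ρ) * ⟪p, e⟫_ℝ) • e‖ ≤ 2 * R * ‖p‖ := by
  have h2 : |1 - ρ| ≤ R := abs_le.2 ⟨by linarith, by linarith⟩
  have h3 : |⟪p, e⟫_ℝ| ≤ ‖p‖ := (abs_real_inner_le_norm p e).trans (by rw [he, mul_one])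
  calc _ ≤ ‖ρ • p‖ + ‖((1 - ρ) * ⟪p, e⟫_ℝ) • e‖ := norm_add_le _ _
    _ = ρ * ‖p‖ + |1 - ρ| * |⟪p, e⟫_ℝ| := by
        rw [norm_smul, norm_smul, he, mul_one, Real.norm_of_nonneg hρ.le, Real.norm_eq_abs, abs_mul]
    _ ≤ R * ‖p‖ + R * ‖p‖ := by gcongr
    _ = _ := by ring

lemma norm_transfer_sub_le {e₁ e₂ p₁ p₂ : Plane} (he₁ : ‖e₁‖ = 1) (he₂ : ‖e₂‖ = 1) {ρ R : ℝ}
    (hρ : 0 < ρ) (hR : ρ ≤ R) (h1 : 1 ≤ R) :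
    ‖(ρ • p₁ + ((1 - ρ) * ⟪p₁, e₁⟫_ℝ) • e₁) - (ρ • p₂ + ((1 - ρ) * ⟪p₂, e₂⟫_ℝ) • e₂)‖
      ≤ 2 * R * ‖p₁ - p₂‖ + 2 * R * (‖p₂‖ * ‖e₁ - e₂‖) := by
  have h2 : |1 - ρ| ≤ R := abs_le.2 ⟨by linarith, by linarith⟩
  have e : (ρ • p₁ + ((1 - ρ) * ⟪p₁, e₁⟫_ℝ) • e₁) - (ρ • p₂ + ((1 - ρ) * ⟪p₂, e₂⟫_ℝ) • e₂)
      = (ρ • (p₁ - p₂) + ((1 - ρ) * ⟪p₁ - p₂, e₁⟫_ℝ) • e₁)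
        + (1 - ρ) • (⟪p₂, e₁ - e₂⟫_ℝ • e₁ + ⟪p₂, e₂⟫_ℝ • (e₁ - e₂)) := by
    rw [inner_sub_left, inner_sub_right]; module
  have h3 : ‖⟪p₂, e₁ - e₂⟫_ℝ • e₁ + ⟪p₂, e₂⟫_ℝ • (e₁ - e₂)‖ ≤ 2 * (‖p₂‖ * ‖e₁ - e₂‖) := by
    refine (norm_add_le _ _).trans ?_
    rw [norm_smul, norm_smul, he₁, mul_one]
    have a1 : ‖⟪p₂, e₁ - e₂⟫_ℝ‖ ≤ ‖p₂‖ * ‖e₁ - e₂‖ := norm_inner_le_norm _ _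
    have a2 : ‖⟪p₂, e₂⟫_ℝ‖ ≤ ‖p₂‖ := (norm_inner_le_norm p₂ e₂).trans (by rw [he₂, mul_one])
    have := mul_le_mul_of_nonneg_right a2 (norm_nonneg (e₁ - e₂))
    linarith
  rw [e]
  refine (norm_add_le _ _).trans (add_le_add (norm_transfer_le he₁ hρ hR h1) ?_)
  rw [norm_smul, Real.norm_eq_abs]
  calc |1 - ρ| * _ ≤ R * (2 * (‖p₂‖ * ‖e₁ - e₂‖)) := by gcongr
    _ = _ := by ring

/-- The jump of the phase on the smaller piece of an edge. -/
lemma small_phase_le {e₁ e₂ p₁ p₂ : Plane} (he₁ : ‖e₁‖ = 1) (he₂ : ‖e₂‖ = 1) {ρ R : ℝ}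
    (hρ : 0 < ρ) (hR : ρ ≤ R) (h1 : 1 ≤ R) {h s κ σ αb αs A E B M Gc : ℝ} (hh : 0 < h) (hs0 : 0 ≤ s)
    (hsh : s ≤ h) (hB : 0 ≤ B) (hM : 0 ≤ M) (hGc : 0 ≤ Gc)
    (hαs : √αs ≤ √A) (hαb : √A ≤ R * √αb)
    (hd : ‖e₁ - e₂‖ ≤ 8 * κ * (σ * h)) (hbig : h * (√αb * ‖p₁ - p₂‖) ≤ E * B)
    (hg : h * (√A * ‖p₂‖) ≤ Gc * (B + M)) :
    s * (√αs * ‖(ρ • p₁ + ((1 - ρ) * ⟪p₁, e₁⟫_ℝ) • e₁) - (ρ • p₂ + ((1 - ρ) * ⟪p₂, e₂⟫_ℝ) • e₂)‖)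
      ≤ (2 * R ^ 2 * E + 4 * R * Gc) * B + 16 * R * Gc * σ * (κ * M * s) := by
  have hd2 : ‖e₁ - e₂‖ ≤ 2 := (norm_sub_le _ _).trans (by rw [he₁, he₂]; norm_num)
  have hR0 : 0 < R := by linarith
  set δ := ‖e₁ - e₂‖
  set q := √A * ‖p₂‖
  have hq0 : 0 ≤ q := by positivity
  have hδ0 : 0 ≤ δ := norm_nonneg _
  have hX : s * (√A * ‖p₁ - p₂‖) ≤ R * (E * B) := by
    calc s * (√A * ‖p₁ - p₂‖) ≤ h * ((R * √αb) * ‖p₁ - p₂‖) := by gcongr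
      _ = R * (h * (√αb * ‖p₁ - p₂‖)) := by ring
      _ ≤ _ := by gcongr
  have hY : s * (q * δ) ≤ Gc * (2 * B + 8 * σ * (κ * M * s)) := by
    refine le_of_mul_le_mul_left ?_ hh
    calc h * (s * (q * δ)) = (h * q) * (s * δ) := by ring
      _ ≤ (Gc * (B + M)) * (s * δ) := by gcongr
      _ = Gc * (B * (s * δ) + M * s * δ) := by ring
      _ ≤ Gc * (B * (h * 2) + M * s * (8 * κ * (σ * h))) := by gcongr
      _ = _ := by ring
  calc _ ≤ s * (√A * (2 * R * ‖p₁ - p₂‖ + 2 * R * (‖p₂‖ * δ))) := by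
        gcongr
        exact norm_transfer_sub_le he₁ he₂ hρ hR h1
    _ = 2 * R * (s * (√A * ‖p₁ - p₂‖)) + 2 * R * (s * (q * δ)) := by ring
    _ ≤ 2 * R * (R * (E * B)) + 2 * R * (Gc * (2 * B + 8 * σ * (κ * M * s))) := by gcongr
    _ = _ := by ring

namespace Mesh

variable {P : InterfaceProblem} (T : Mesh P)
variable {σ : ℝ} {u : Plane → ℝ} {G : Plane → Plane} {v : Broken}

lemma ρ_le_contrast (P : InterfaceProblem) : P.ρ ≤ InterfaceProblem.contrast P.ρ ∧
    P.ρ⁻¹ ≤ InterfaceProblem.contrast P.ρ := ⟨le_max_left _ _, le_max_right _ _⟩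

variable {T} in
lemma Phase.eq_transfer {K : Finset Plane} {gp gm ν w : Plane} {b : ℝ} (ph : T.Phase v K gp gm ν b)
    (hν : ν ≠ 0) (hw : w ≠ 0) (hνw : ⟪ν, w⟫_ℝ = 0) :
    gm = P.ρ • gp + ((1 - P.ρ) * ⟪gp, unitOf w⟫_ℝ) • unitOf w ∧
      gp = P.ρ⁻¹ • gm + ((1 - P.ρ⁻¹) * ⟪gm, unitOf w⟫_ℝ) • unitOf w := by
  have hp := P.αp_pos.ne'
  have hm := P.αm_pos.ne'
  have hf := ph.flux
  have ht := ph.tang w hνw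
  constructor
  · refine eq_of_flux_tang hν hw hνw ?_ ht
    rw [InterfaceProblem.ρ]; field_simp; linarith
  · refine eq_of_flux_tang hν hw hνw ?_ ht.symm
    rw [InterfaceProblem.ρ]; field_simp; linarith

lemma diam_le_of_edge (hσ : 0 < σ) (hT : T.ShapeRegular σ) {K F : Finset Plane} (hK : K ∈ T.elements)
    (hF : F ∈ edgesOf K) : Metric.diam (hull K) ≤ σ / 2 * h F := by
  obtain ⟨lam, hl⟩ := T.exists_isBary hK
  obtain ⟨d, hd⟩ := hT K hK
  obtain ⟨a, b, hab, hFe, hh, -⟩ := T.exists_ends (Finset.mem_biUnion.2 ⟨K, hK, hF⟩)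
  have hFK := (Finset.mem_powersetCard.1 hF).1
  have := hl.two_mul_le_norm hab (hFK (by rw [hFe]; simp)) (hFK (by rw [hFe]; simp))
    (div_pos (T.diam_pos hK) hσ) hd
  rw [← hh] at this
  rw [mul_div_assoc', div_le_iff₀ hσ] at this
  linarith

/-- The gradient of the discrete solution on an element. -/
lemma IsSetting.diam_mul_grad_le (hs : T.IsSetting σ u G v) {M : ℝ}
    (hM : √(∫ x in P.Ω, P.α x * ‖G x‖ ^ 2) ≤ M) {K : Finset Plane} (hK : K ∈ T.elements)
    {g : Plane} {R' : ℝ} (hR' : 0 < R')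
    (hg : ∀ᵐ x ∂(volume.restrict (hull K)), ‖g‖ ≤ R' * ‖grad v K x‖) :
    Metric.diam (hull K) * (√P.αmax * ‖g‖)
      ≤ 2 * σ * R' * √(InterfaceProblem.contrast P.ρ) * (errOn (P := P) G v K + M) := by
  obtain ⟨gp, gm, ν, b, ph⟩ := T.exists_phase hs.cut hs.ife hK
  have hσ := hs.σ_pos
  have hR1 : 1 ≤ InterfaceProblem.contrast P.ρ := InterfaceProblem.one_le_contrast P.ρ_pos
  set R := InterfaceProblem.contrast P.ρ
  set H := Metric.diam (hull K)
  have hH := T.diam_pos hK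
  obtain ⟨c, hc⟩ := hs.shape K hK
  have hmG := hs.memLp_G T hK
  have hmg := ph.memLp_grad
  have hfinK : volume (hull K) < ⊤ := (isCompact_hull K).measure_lt_top
  have hig : IntegrableOn (fun x => ‖grad v K x‖ ^ 2) (hull K) := hmg.integrable_norm_pow (by norm_num)
  have hvol : (H / σ) ^ 2 ≤ (volume (hull K)).toReal :=
    (le_volume_closedBall c (by positivity)).trans (ENNReal.toReal_mono hfinK.ne (measure_mono hc))
  have h1 : H / σ * ‖g‖ ≤ R' * √(∫ x in hull K, ‖grad v K x‖ ^ 2) := by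
    have h2 : (H / σ * ‖g‖) ^ 2 ≤ R' ^ 2 * ∫ x in hull K, ‖grad v K x‖ ^ 2 := by
      calc (H / σ * ‖g‖) ^ 2 = (H / σ) ^ 2 * ‖g‖ ^ 2 := by ring
        _ ≤ (volume (hull K)).toReal * ‖g‖ ^ 2 := by gcongr
        _ = ∫ x in hull K, ‖g‖ ^ 2 := by simp [Measure.real]
        _ ≤ ∫ x in hull K, R' ^ 2 * ‖grad v K x‖ ^ 2 := by
            refine integral_mono_ae (integrable_const_iff.2 (Or.inr ⟨by simpa using hfinK⟩))
              (hig.const_mul _) (hg.mono fun x hx => ?_)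
            simp only
            rw [← mul_pow]; gcongr
        _ = _ := integral_const_mul _ _
    have := Real.sqrt_le_sqrt h2
    rwa [Real.sqrt_sq (by positivity), Real.sqrt_mul (by positivity), Real.sqrt_sq hR'.le] at this
  have h2 := sqrt_integral_norm_add_sq_le (w := grad v K) (hmG.sub hmg) hmG
    (Eventually.of_forall fun x => by
      have := norm_sub_le (G x) (G x - grad v K x)
      rw [sub_sub_cancel] at this
      rw [Pi.sub_apply]; linarith)
  simp only [Pi.sub_apply] at h2
  have h3 := T.sqrt_grad_error_le hs hK
  have h4 : √P.αmax * √(∫ x in hull K, ‖G x‖ ^ 2) ≤ √R * M := by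
    have hiG : IntegrableOn (fun x => ‖G x‖ ^ 2) P.Ω :=
      hs.sol.isH1.memLp_grad.integrable_norm_pow (by norm_num)
    have hiα : IntegrableOn (fun x => P.α x * ‖G x‖ ^ 2) P.Ω := by
      refine Integrable.mono' (hiG.const_mul P.αmax)
        (P.measurable_α.aestronglyMeasurable.mul hiG.aestronglyMeasurable)
        (Eventually.of_forall fun x => ?_)
      rw [Real.norm_of_nonneg (mul_nonneg (P.α_pos x).le (by positivity))]
      gcongr
      exact P.α_le x
    refine le_trans ?_ (mul_le_mul_of_nonneg_left hM (Real.sqrt_nonneg _))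
    rw [← Real.sqrt_mul P.αmax_pos.le, ← Real.sqrt_mul (by linarith), ← integral_const_mul,
      ← integral_const_mul]
    refine Real.sqrt_le_sqrt ?_
    rw [restrict_hull K]
    refine (setIntegral_mono_set (hiG.const_mul _) (Eventually.of_forall fun x =>
      mul_nonneg P.αmax_pos.le (by positivity)) (T.interior_hull_subset hK).eventuallyLE).trans ?_
    refine integral_mono (hiG.const_mul _) (hiα.const_mul _) fun x => ?_
    simp only
    rw [← mul_assoc]
    gcongr
    exact P.αmax_le_α x
  calc H * (√P.αmax * ‖g‖) = σ * √P.αmax * (H / σ * ‖g‖) := by field_simp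
    _ ≤ σ * √P.αmax * (R' * (2 * (√(∫ x in hull K, ‖G x - grad v K x‖ ^ 2)
        + √(∫ x in hull K, ‖G x‖ ^ 2)))) := by
      refine mul_le_mul_of_nonneg_left (h1.trans ?_) (by positivity)
      exact mul_le_mul_of_nonneg_left h2 hR'.le
    _ = 2 * σ * R' * (√P.αmax * √(∫ x in hull K, ‖G x - grad v K x‖ ^ 2)
        + √P.αmax * √(∫ x in hull K, ‖G x‖ ^ 2)) := by ring
    _ ≤ 2 * σ * R' * (√R * errOn (P := P) G v K + √R * M) := by gcongr
    _ = _ := by ring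

/-- The data of an interface element next to an interface edge. -/
lemma exists_direction {κ : ℝ} (hκ : ∀ s, ‖deriv (deriv P.γ) s‖ ≤ κ) {K F : Finset Plane}
    (hK : T.IsInterfaceElement K) (hF : F ∈ edgesOf K) {gp gm ν : Plane} {b : ℝ}
    (ph : T.Phase v K gp gm ν b) {z : ℝ} (hz : P.γ z ∈ hull F) :
    ∃ e : Plane, ‖e‖ = 1 ∧ ‖e - deriv P.γ z‖ ≤ 8 * κ * Metric.diam (hull K) ∧
      gm = P.ρ • gp + ((1 - P.ρ) * ⟪gp, e⟫_ℝ) • e ∧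
      gp = P.ρ⁻¹ • gm + ((1 - P.ρ⁻¹) * ⟪gm, e⟫_ℝ) • e := by
  obtain ⟨hν, s, t, hst, -, him, hfr, hperp, hne⟩ := ph.chord hK
  have hw : P.γ t - P.γ s ≠ 0 := sub_ne_zero.2 hne.symm
  obtain ⟨e1, e2⟩ := ph.eq_transfer hν hw hperp
  refine ⟨unitOf (P.γ t - P.γ s), norm_unitOf hw, ?_, e1, e2⟩
  have hzmem : P.γ z ∈ P.Γ ∩ frontier (hull K) :=
    ⟨⟨z, rfl⟩, T.hull_edge_subset_frontier hK.1 hF hz⟩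
  have hin : ∀ τ ∈ Icc s t, P.γ τ ∈ hull K := fun τ hτ =>
    (him.subset ⟨τ, hτ, rfl⟩).2
  obtain ⟨r, hr, hrz⟩ : ∃ r ∈ Icc s t, P.γ z = P.γ r := by
    rw [hfr] at hzmem
    rcases hzmem with h | h
    · exact ⟨s, left_mem_Icc.2 hst.le, h⟩
    · exact ⟨t, right_mem_Icc.2 hst.le, h⟩
  rw [P.deriv_γ_eq hrz]
  exact P.norm_unitOf_chord_sub_le hκ hst hne (fun τ hτ =>
    norm_sub_le_diam (hin τ hτ) (hin s (left_mem_Icc.2 hst.le))) hr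

/-- The constant in the bound for arbitrarily cut edges. -/
def cutConst (σ ρ : ℝ) : ℝ :=
  16 * InterfaceProblem.contrast ρ ^ 2 * edgeConst σ ρ
    + (4 * InterfaceProblem.contrast ρ + 16 * InterfaceProblem.contrast ρ * σ)
      * (4 * σ * InterfaceProblem.contrast ρ ^ 2) + 8 * edgeConst σ ρ

lemma jumpConst_nonneg {σ : ℝ} (hσ : 0 < σ) (P : InterfaceProblem) : 0 ≤ jumpConst σ P.ρ := by
  have := bumpConst_pos
  have h1 := InterfaceProblem.one_le_contrast P.ρ_pos
  unfold jumpConst loadConst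
  positivity

lemma edgeConst_nonneg {σ : ℝ} (hσ : 0 < σ) (P : InterfaceProblem) : 0 ≤ edgeConst σ P.ρ :=
  mul_nonneg (by linarith) (jumpConst_nonneg hσ P)

/-- The bound for interface edges, whatever the cut. -/
lemma IsSetting.interface_edge_le (hs : T.IsSetting σ u G v) {κ M : ℝ}
    (hκ : ∀ s, ‖deriv (deriv P.γ) s‖ ≤ κ) (hM : √(∫ x in P.Ω, P.α x * ‖G x‖ ^ 2) ≤ M)
    {K F : Finset Plane} (hFK : F ∈ edgesOf K) (hF : T.IsInterfaceEdge F) :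
    h F / 2 * T.fluxSq v F + h F / 2 * T.tangSq v F
      ≤ (cutConst σ P.ρ * (T.bound G v K + κ * M * (√(h F) * min √(T.hm F) √(T.hp F)))) ^ 2 := by
  have hσ := hs.σ_pos
  have hκ0 : 0 ≤ κ := (norm_nonneg _).trans (hκ 0)
  have hM0 : 0 ≤ M := (Real.sqrt_nonneg _).trans hM
  have hI := hF.isInterior
  have hsub := hF.subsingleton hs.cut
  have hh0 := T.h_pos hF.1
  have hΩ := T.sdiff_subset hσ hs.shape hI
  have hK₁ := (T.K₁_mem F hF.1).1
  have hK₂ := (T.K₂_mem F hF.1 hI.2).1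
  have hE₁ := T.mem_edgesOf_K₁ hF.1
  have hE₂ := T.mem_edgesOf_K₂ hI
  obtain ⟨gp₁, gm₁, ν₁, b₁, ph₁⟩ := T.exists_phase hs.cut hs.ife hK₁
  obtain ⟨gp₂, gm₂, ν₂, b₂, ph₂⟩ := T.exists_phase hs.cut hs.ife hK₂
  obtain ⟨jp, jm⟩ := hs.edge_jump T hFK hI hsub ph₁ ph₂ (θ := 1 / 8) (by norm_num)
  have hsum := T.hp_add_hm hF.1 hΩ hsub
  have hp0 := T.hp_nonneg F
  have hm0 := T.hm_nonneg F
  have hB := T.bound_nonneg G v K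
  have hR1 := InterfaceProblem.one_le_contrast P.ρ_pos
  have hE0 := edgeConst_nonneg hσ P
  rw [← mul_add, T.fluxSq_add_tangSq hI hΩ hsub ph₁ ph₂]
  set B := T.bound G v K
  set R := InterfaceProblem.contrast P.ρ with hR
  set E := edgeConst σ P.ρ with hE
  set Gc := 4 * σ * R ^ 2 with hGc
  have hGc0 : 0 ≤ Gc := by positivity
  -- the two pieces
  have big : ∀ {α₀ d l : ℝ}, 0 < α₀ → 0 ≤ d → 0 ≤ l → l ≤ h F → h F * (√α₀ * d) ≤ 8 * E * B →
      h F * (α₀ * d ^ 2 * l) ≤ (8 * E * B) ^ 2 := by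
    intro α₀ d l hα hd hl hlh hj
    calc h F * (α₀ * d ^ 2 * l) ≤ h F * (α₀ * d ^ 2 * h F) := by gcongr
      _ = (h F * (√α₀ * d)) ^ 2 := by rw [mul_pow, mul_pow, Real.sq_sqrt hα.le]; ring
      _ ≤ _ := pow_le_pow_left₀ (by positivity) hj 2
  have small : ∀ {α₀ d l : ℝ}, 0 < α₀ → 0 ≤ d → 0 ≤ l →
      √(h F) * √l * (√α₀ * d)
        ≤ (2 * R ^ 2 * (8 * E) + 4 * R * Gc) * B + 16 * R * Gc * σ * (κ * M * (√(h F) * √l)) →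
      h F * (α₀ * d ^ 2 * l)
        ≤ ((2 * R ^ 2 * (8 * E) + 4 * R * Gc) * B + 16 * R * Gc * σ * (κ * M * (√(h F) * √l))) ^ 2 := by
    intro α₀ d l hα hd hl hj
    calc h F * (α₀ * d ^ 2 * l) = (√(h F) * √l * (√α₀ * d)) ^ 2 := by
          rw [mul_pow, mul_pow, mul_pow, Real.sq_sqrt hα.le, Real.sq_sqrt hh0.le, Real.sq_sqrt hl]; ring
      _ ≤ _ := pow_le_pow_left₀ (by positivity) hj 2
  have fin : ∀ {x y S : ℝ}, 0 ≤ S → x ≤ (8 * E * B) ^ 2 →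
      y ≤ ((2 * R ^ 2 * (8 * E) + 4 * R * Gc) * B + 16 * R * Gc * σ * (κ * M * S)) ^ 2 →
      1 / 2 * (x + y) ≤ (cutConst σ P.ρ * (B + κ * M * S)) ^ 2 := by
    intro x y S hS hx hy
    have hS' : 0 ≤ κ * M * S := by positivity
    have hc : cutConst σ P.ρ = 16 * R ^ 2 * E + (4 * R + 16 * R * σ) * Gc + 8 * E := rfl
    have a1 : (8 * E * B) ^ 2 ≤ (cutConst σ P.ρ * (B + κ * M * S)) ^ 2 := by
      refine pow_le_pow_left₀ (by positivity) ?_ 2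
      rw [hc]
      calc 8 * E * B ≤ (16 * R ^ 2 * E + (4 * R + 16 * R * σ) * Gc + 8 * E) * B := by
            gcongr
            have : 0 ≤ 16 * R ^ 2 * E + (4 * R + 16 * R * σ) * Gc := by positivity
            linarith
        _ ≤ _ := by gcongr; linarith
    have a2 : ((2 * R ^ 2 * (8 * E) + 4 * R * Gc) * B + 16 * R * Gc * σ * (κ * M * S)) ^ 2
        ≤ (cutConst σ P.ρ * (B + κ * M * S)) ^ 2 := by
      refine pow_le_pow_left₀ (by positivity) ?_ 2
      rw [hc, mul_add]
      have k1 : 0 ≤ 16 * R * σ * Gc + 8 * E := by positivity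
      have k2 : 0 ≤ 16 * R ^ 2 * E + 4 * R * Gc + 8 * E := by positivity
      refine add_le_add ?_ ?_
      · refine mul_le_mul_of_nonneg_right ?_ hB
        linarith
      · refine mul_le_mul_of_nonneg_right ?_ hS'
        linarith
    linarith
  -- both phases on the small piece are linked to those on the big piece
  have link : 0 < T.hp F → 0 < T.hm F → ∃ e₁ e₂ : Plane, ‖e₁‖ = 1 ∧ ‖e₂‖ = 1 ∧
      ‖e₁ - e₂‖ ≤ 8 * κ * (σ * h F) ∧
      gm₁ = P.ρ • gp₁ + ((1 - P.ρ) * ⟪gp₁, e₁⟫_ℝ) • e₁ ∧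
      gp₁ = P.ρ⁻¹ • gm₁ + ((1 - P.ρ⁻¹) * ⟪gm₁, e₁⟫_ℝ) • e₁ ∧
      gm₂ = P.ρ • gp₂ + ((1 - P.ρ) * ⟪gp₂, e₂⟫_ℝ) • e₂ ∧
      gp₂ = P.ρ⁻¹ • gm₂ + ((1 - P.ρ⁻¹) * ⟪gm₂, e₂⟫_ℝ) • e₂ := by
    intro hp hm
    have ne : ∀ {U : Set Plane}, 0 < (μH[1] (hull F ∩ U)).toReal → (hull F ∩ U).Nonempty := by
      intro U hU
      by_contra h0
      rw [not_nonempty_iff_eq_empty] at h0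
      rw [h0, measure_empty, ENNReal.toReal_zero] at hU
      exact lt_irrefl _ hU
    obtain ⟨x, hx, hxp⟩ := ne hp
    obtain ⟨y, hy, hym⟩ := ne hm
    have m₁ := hull_mono (Finset.mem_powersetCard.1 hE₁).1
    have m₂ := hull_mono (Finset.mem_powersetCard.1 hE₂).1
    have i₁ := T.isInterfaceElement_of_mem hK₁ (m₁ hx) hxp (m₁ hy) hym
    have i₂ := T.isInterfaceElement_of_mem hK₂ (m₂ hx) hxp (m₂ hy) hym
    obtain ⟨_, hz, z, rfl⟩ := hF.2.1
    obtain ⟨e₁, n₁, d₁, q₁, r₁⟩ := T.exists_direction hκ i₁ hE₁ ph₁ hz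
    obtain ⟨e₂, n₂, d₂, q₂, r₂⟩ := T.exists_direction hκ i₂ hE₂ ph₂ hz
    refine ⟨e₁, e₂, n₁, n₂, ?_, q₁, r₁, q₂, r₂⟩
    have D₁ := T.diam_le_of_edge hσ hs.shape hK₁ hE₁
    have D₂ := T.diam_le_of_edge hσ hs.shape hK₂ hE₂
    calc ‖e₁ - e₂‖ = ‖(e₁ - deriv P.γ z) - (e₂ - deriv P.γ z)‖ := by congr 1; abel
      _ ≤ 8 * κ * Metric.diam (hull (T.K₁ F)) + 8 * κ * Metric.diam (hull (T.K₂ F)) :=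
          (norm_sub_le _ _).trans (add_le_add d₁ d₂)
      _ ≤ 8 * κ * (σ / 2 * h F) + 8 * κ * (σ / 2 * h F) := by gcongr
      _ = _ := by ring
  have hp₂ := T.mem_patch_of_edge hK₂ hFK hE₂
  have hgrad : ∀ {g : Plane}, (∀ᵐ x ∂(volume.restrict (hull (T.K₂ F))), ‖g‖ ≤ 2 * R * ‖grad v (T.K₂ F) x‖) →
      h F * (√P.αmax * ‖g‖) ≤ Gc * (B + M) := by
    intro g hg
    have h1 := hs.diam_mul_grad_le T hM hK₂ (by positivity : 0 < 2 * R) hg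
    have h2 := T.element_le_bound G v hp₂
    have h3 := T.geo_nonneg v (T.K₂ F)
    have h4 := T.osc_nonneg (T.K₂ F)
    have h5 : errOn (P := P) G v (T.K₂ F) ≤ B := by linarith
    have hRle : √R ≤ R := by
      have := Real.one_le_sqrt.2 hR1
      have := Real.mul_self_sqrt (show 0 ≤ R by linarith)
      nlinarith
    have he0 : 0 ≤ errOn (P := P) G v (T.K₂ F) := Real.sqrt_nonneg _
    calc h F * (√P.αmax * ‖g‖) ≤ Metric.diam (hull (T.K₂ F)) * (√P.αmax * ‖g‖) := by
          gcongr; exact h_le_diam hE₂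
      _ ≤ _ := h1
      _ ≤ 2 * σ * (2 * R) * R * (B + M) := by gcongr
      _ = _ := by rw [hGc]; ring
  have hgp₂ : ∀ᵐ x ∂(volume.restrict (hull (T.K₂ F))), grad v (T.K₂ F) x = gp₂ ∨ grad v (T.K₂ F) x = gm₂ := by
    refine ph₂.ae_eq.mono fun x hx => ?_
    rw [hx.2.1]; unfold twoPhase; split_ifs <;> simp
  have twoR : ∀ w : Plane, ‖w‖ ≤ 2 * R * ‖w‖ := fun w =>
    le_mul_of_one_le_left (norm_nonneg _) (by linarith)
  have hsqA : ∀ {α₀ : ℝ}, 0 < α₀ → P.αmax ≤ R * α₀ → √P.αmax ≤ R * √α₀ := by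
    intro α₀ h0 h1
    refine (Real.sqrt_le_sqrt h1).trans ?_
    rw [Real.sqrt_mul (by linarith)]
    gcongr
    have := Real.one_le_sqrt.2 hR1
    have := Real.mul_self_sqrt (show 0 ≤ R by linarith)
    nlinarith
  have sqle : ∀ {l : ℝ}, 0 ≤ l → l ≤ h F → √(h F) * √l ≤ h F := by
    intro l hl hlh
    calc √(h F) * √l ≤ √(h F) * √(h F) := by gcongr
      _ = h F := Real.mul_self_sqrt hh0.le
  obtain ⟨hρR, hρR'⟩ := ρ_le_contrast P
  rcases le_total (T.hm F) (T.hp F) with hle | hle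
  · have hbig := jp (by linarith)
    have hbig' : h F * (√P.αp * ‖gp₁ - gp₂‖) ≤ 8 * E * B := by
      have : (1 + σ) * jumpConst σ P.ρ * B = E * B := rfl
      linarith
    rw [min_eq_left (Real.sqrt_le_sqrt hle)]
    have s1 := big P.αp_pos (norm_nonneg _) hp0 (by linarith) hbig'
    have s2 : h F * (P.αm * ‖gm₁ - gm₂‖ ^ 2 * T.hm F) ≤ ((2 * R ^ 2 * (8 * E) + 4 * R * Gc) * B
        + 16 * R * Gc * σ * (κ * M * (√(h F) * √(T.hm F)))) ^ 2 := by
      rcases hm0.eq_or_lt with h0 | h0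
      · rw [← h0]; simp only [mul_zero]; positivity
      · obtain ⟨e₁, e₂, n₁, n₂, hd, q₁, r₁, q₂, r₂⟩ := link (h0.trans_le hle) h0
        refine small P.αm_pos (norm_nonneg _) hm0 ?_
        have := small_phase_le n₁ n₂ P.ρ_pos hρR hR1 (αs := P.αm) (αb := P.αp) (A := P.αmax)
          (E := 8 * E) hh0
          (mul_nonneg (Real.sqrt_nonneg _) (Real.sqrt_nonneg _)) (sqle hm0 (by linarith)) hB hM0
          hGc0 (Real.sqrt_le_sqrt (le_max_right _ _)) (hsqA P.αp_pos P.αmax_le_p) hd hbig'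
          (hgrad (g := gp₂) (hgp₂.mono fun x hx => by
            rcases hx with hx | hx
            · rw [hx]; exact twoR _
            · rw [hx, r₂]; exact norm_transfer_le n₂ (inv_pos.2 P.ρ_pos) hρR' hR1))
        rwa [← q₁, ← q₂] at this
    have := fin (mul_nonneg (Real.sqrt_nonneg _) (Real.sqrt_nonneg _)) s1 s2
    linarith
  · have hbig := jm (by linarith)
    have hbig' : h F * (√P.αm * ‖gm₁ - gm₂‖) ≤ 8 * E * B := by
      have : (1 + σ) * jumpConst σ P.ρ * B = E * B := rfl
      linarith
    rw [min_eq_right (Real.sqrt_le_sqrt hle)]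
    have s1 := big P.αm_pos (norm_nonneg _) hm0 (by linarith) hbig'
    have s2 : h F * (P.αp * ‖gp₁ - gp₂‖ ^ 2 * T.hp F) ≤ ((2 * R ^ 2 * (8 * E) + 4 * R * Gc) * B
        + 16 * R * Gc * σ * (κ * M * (√(h F) * √(T.hp F)))) ^ 2 := by
      rcases hp0.eq_or_lt with h0 | h0
      · rw [← h0]; simp only [mul_zero]; positivity
      · obtain ⟨e₁, e₂, n₁, n₂, hd, q₁, r₁, q₂, r₂⟩ := link h0 (h0.trans_le hle)
        refine small P.αp_pos (norm_nonneg _) hp0 ?_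
        have := small_phase_le n₁ n₂ (inv_pos.2 P.ρ_pos) hρR' hR1 (αs := P.αp) (αb := P.αm)
          (A := P.αmax) (E := 8 * E) hh0
          (mul_nonneg (Real.sqrt_nonneg _) (Real.sqrt_nonneg _)) (sqle hp0 (by linarith)) hB hM0
          hGc0 (Real.sqrt_le_sqrt (le_max_left _ _)) (hsqA P.αm_pos P.αmax_le_m) hd hbig'
          (hgrad (g := gm₂) (hgp₂.mono fun x hx => by
            rcases hx with hx | hx
            · rw [hx, q₂]; exact norm_transfer_le n₂ P.ρ_pos hρR hR1
            · rw [hx]; exact twoR _))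
        rwa [← r₁, ← r₂] at this
    have := fin (mul_nonneg (Real.sqrt_nonneg _) (Real.sqrt_nonneg _)) s1 s2
    linarith

end Mesh

namespace Mesh

variable {P : InterfaceProblem} (T : Mesh P)
variable {σ : ℝ} {u : Plane → ℝ} {G : Plane → Plane} {v : Broken}

/-! ### Edges on the Neumann boundary -/

lemma near_edge_faces (hσ : 0 < σ) (hT : T.ShapeRegular σ) {K : Finset Plane}
    (hK : K ∈ T.elements) {a b : Plane} (hab : a ≠ b) (hF : ({a, b} : Finset Plane) ⊆ K)
    {n : Plane} (hn1 : ‖n‖ = 1) (hn : ⟪n, b - a⟫_ℝ = 0) (hout : ∀ z ∈ K, ⟪n, z - a⟫_ℝ ≤ 0)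
    {τ θ : ℝ} (h1 : θ ≤ τ) (h2 : τ ≤ 1 - θ) {x : Plane}
    (hx : ‖x - ((1 - τ) • a + τ • b)‖ < 2 * (‖a - b‖ / σ) * θ) :
    (∀ K' ⊆ K, x ∈ hull K' → {a, b} ⊆ K') ∧
      (x ∈ frontier (hull K) → x ∈ hull {a, b} \ ({a, b} : Finset Plane)) := by
  obtain ⟨lam, hl⟩ := T.exists_isBary hK
  obtain ⟨d, hd⟩ := hT K hK
  obtain ⟨c, hac, hbc, hKe⟩ := third_vertex (T.card_eq K hK) hab hF
  have hd' : Metric.closedBall d (‖a - b‖ / σ) ⊆ hull K := by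
    refine (Metric.closedBall_subset_closedBall ?_).trans hd
    gcongr
    exact norm_sub_le_diam (subset_hull (hF (by simp))) (subset_hull (hF (by simp)))
  have hR : 0 < ‖a - b‖ / σ := div_pos (norm_pos_iff.2 (sub_ne_zero.2 hab)) hσ
  have e : ∀ z, lam z ((1 - τ) • a + τ • b) = (1 - τ) * lam z a + τ * lam z b := fun z =>
    affine_combo _ _ _ _ (by ring)
  subst hKe
  obtain ⟨pa, pb, -⟩ := hl.mem_hull_iff_of_mem_ball hab hac hbc hn1 hn (hout c (by simp)) (θ := θ)
    (by rw [e, hl.ne c (by simp) a (by simp) hac.symm, hl.ne c (by simp) b (by simp) hbc.symm]; simp)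
    hR hd'
    (by rw [e, hl.self a (by simp), hl.ne a (by simp) b (by simp) hab]; linarith)
    (by rw [e, hl.self b (by simp), hl.ne b (by simp) a (by simp) hab.symm]; linarith) hx
  constructor
  · intro K' hK' hxK z hz
    by_contra hz'
    have h0 := ((hl.mem_hull_subset_iff hK' x).1 hxK).2 z (hF hz) hz'
    simp only [Finset.mem_insert, Finset.mem_singleton] at hz
    rcases hz with rfl | rfl <;> linarith
  · intro hxf
    obtain ⟨hxK, z, hz, hz0⟩ := (hl.mem_frontier_iff x).1 hxf
    have hzc : z = c := by
      simp only [Finset.mem_insert, Finset.mem_singleton] at hz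
      rcases hz with rfl | rfl | rfl
      · linarith
      · linarith
      · rfl
    rw [hzc] at hz0
    refine ⟨(hl.mem_hull_subset_iff hF x).2 ⟨hxK, fun w hw hwF => ?_⟩, fun hxF => ?_⟩
    · simp only [Finset.mem_insert, Finset.mem_singleton, not_or] at hw hwF
      have : w = c := by tauto
      rw [this, hz0]
    · simp only [Finset.coe_insert, Finset.coe_singleton, mem_insert_iff, mem_singleton_iff] at hxF
      rcases hxF with rfl | rfl
      · rw [hl.ne b (by simp) x (by simp) hab.symm] at pb; exact lt_irrefl _ pb
      · rw [hl.ne a (by simp) x (by simp) hab] at pa; exact lt_irrefl _ pa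

/-- A boundary edge belongs to one element only. -/
lemma eq_of_boundary_edge (hσ : 0 < σ) (hT : T.ShapeRegular σ) {K₁ K₂ : Finset Plane}
    (hK₁ : K₁ ∈ T.elements) (hK₂ : K₂ ∈ T.elements) {a b : Plane} (hab : a ≠ b)
    (hF₁ : ({a, b} : Finset Plane) ⊆ K₁) (hF₂ : ({a, b} : Finset Plane) ⊆ K₂) {n : Plane}
    (hn1 : ‖n‖ = 1) (hn : ⟪n, b - a⟫_ℝ = 0) (hout : ∀ z ∈ K₁, ⟪n, z - a⟫_ℝ ≤ 0)
    (hbd : hull {a, b} ⊆ frontier P.Ω) : K₂ = K₁ := by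
  by_contra hne
  have hopp := T.opposite_side hσ hT hK₁ hK₂ hne hab hF₁ hF₂ hn1 hn hout
  set x₀ : Plane := (1 - (1 / 2 : ℝ)) • a + (1 / 2 : ℝ) • b
  have hd : 0 < ‖a - b‖ := norm_pos_iff.2 (sub_ne_zero.2 hab)
  have hsub : Metric.ball x₀ (2 * (‖a - b‖ / σ) * (1 / 2)) ⊆ closure P.Ω := by
    intro x hx
    rw [mem_ball_iff_norm] at hx
    have e1 := T.mem_hull_iff_near_edge hσ hT hK₁ hab hF₁ hn1 hn hout (θ := 1 / 2) le_rfl (by norm_num) hx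
    have e2 := T.mem_hull_iff_near_edge hσ hT hK₂ hab hF₂ (by rw [norm_neg, hn1])
      (by rw [inner_neg_left, hn, neg_zero]) hopp (θ := 1 / 2) le_rfl (by norm_num) hx
    rw [inner_neg_left] at e2
    rcases le_total ⟪n, x - x₀⟫_ℝ 0 with h | h
    · exact T.hull_subset_closure hK₁ (e1.2 h)
    · exact T.hull_subset_closure hK₂ (e2.2 (neg_nonpos.2 h))
  have hin : x₀ ∈ P.Ω := P.interior_closure_subset
    (interior_maximal hsub Metric.isOpen_ball (Metric.mem_ball_self (by positivity)))
  have hfr : x₀ ∈ frontier P.Ω := hbd (segment_point_mem_sdiff hab (by norm_num) (by norm_num)).1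
  exact P.isOpen.inter_frontier_eq.subset ⟨hin, hfr⟩

/-- Near a boundary edge of `K` a test function can be cut off outside `K`. -/
lemma exists_local_test {K : Finset Plane} {x₀ : Plane} {r A : ℝ} {φ : Plane → ℝ}
    (hφ : IsBump A x₀ r φ)
    (hdis : ∀ K' ∈ T.elements, K' ≠ K → ∀ x ∈ Metric.closedBall x₀ r, x ∈ hull K → x ∉ hull K') :
    ∃ ψ : Plane → ℝ, ContDiff ℝ ∞ ψ ∧ HasCompactSupport ψ ∧ (∀ x, |ψ x| ≤ 1) ∧
      (∀ x ∈ hull K, ψ x = φ x) ∧ (∀ x ∉ Metric.closedBall x₀ r, ψ x = 0) ∧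
      ∀ K' ∈ T.elements, K' ≠ K → ∀ x ∈ hull K', ψ x = 0 := by
  set s : Set Plane := ⋃ K' ∈ T.elements.filter (· ≠ K), Metric.closedBall x₀ r ∩ hull K'
  have hs : IsClosed s := Set.Finite.isClosed_biUnion (Finset.finite_toSet _)
    fun K' _ => Metric.isClosed_closedBall.inter (isClosed_hull K')
  have ht : IsClosed (Metric.closedBall x₀ r ∩ hull K) :=
    Metric.isClosed_closedBall.inter (isClosed_hull K)
  have hst : Disjoint s (Metric.closedBall x₀ r ∩ hull K) := by
    rw [Set.disjoint_left]
    intro x hx hx2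
    simp only [s, mem_iUnion, Finset.mem_filter] at hx
    obtain ⟨K', ⟨hK', hne⟩, hx1⟩ := hx
    exact hdis K' hK' hne x hx2.1 hx2.2 hx1.2
  obtain ⟨χ, hχ0, hχ1, hχ⟩ := exists_contMDiffMap_zero_one_of_isClosed (n := ⊤)
    (modelWithCornersSelf ℝ Plane) hs ht hst
  have hχs : ContDiff ℝ ∞ χ := χ.contMDiff.contDiff
  have hz : ∀ x ∉ Metric.closedBall x₀ r, χ x * φ x = 0 := fun x hx => by rw [hφ.eq_zero hx, mul_zero]
  refine ⟨fun x => χ x * φ x, hχs.mul hφ.contDiff, hφ.hasCompactSupport.mul_left, fun x => ?_,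
    fun x hx => ?_, hz, fun K' hK' hne x hx => ?_⟩
  · rw [abs_mul, abs_of_nonneg (hχ x).1, abs_of_nonneg (hφ.nonneg x)]
    exact mul_le_one₀ (hχ x).2 (hφ.nonneg x) (hφ.le_one x)
  · by_cases hxb : x ∈ Metric.closedBall x₀ r
    · have : χ x = 1 := hχ1 ⟨hxb, hx⟩
      simp only [this, one_mul]
    · simp only [hφ.eq_zero hxb, mul_zero]
  · by_cases hxb : x ∈ Metric.closedBall x₀ r
    · have : χ x = 0 := hχ0 (mem_biUnion (Finset.mem_coe.2 (Finset.mem_filter.2 ⟨hK', hne⟩)) ⟨hxb, hx⟩)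
      simp only [this, zero_mul]
    · exact hz x hxb

lemma exists_mem_hull {x : Plane} (hx : x ∈ closure P.Ω) : ∃ K ∈ T.elements, x ∈ hull K := by
  rw [← T.cover] at hx
  simpa using hx

/-- Integrals over the domain of a test function that is cut off outside `K`. -/
lemma integral_of_local_test {K : Finset Plane} (hK : K ∈ T.elements) {φ ψ : Plane → ℝ}
    (hψK : ∀ x ∈ hull K, ψ x = φ x)
    (hψ0 : ∀ K' ∈ T.elements, K' ≠ K → ∀ x ∈ hull K', ψ x = 0) (w : Plane → Plane) (f : Plane → ℝ) :
    (∫ x in P.Ω, ⟪w x, gradient ψ x⟫_ℝ = ∫ x in hull K, ⟪w x, gradient φ x⟫_ℝ) ∧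
      ∫ x in P.Ω, f x * ψ x = ∫ x in hull K, f x * φ x := by
  have hfr : ∀ᵐ x ∂(volume : Measure Plane), ∀ K' ∈ T.elements, x ∉ frontier (hull K') := by
    rw [Finset.eventually_all]
    exact fun K' _ => compl_mem_ae_iff.2 (volume_frontier_hull K')
  have hgrad : ∀ {f g : Plane → ℝ} {K' : Finset Plane} {x : Plane}, x ∈ interior (hull K') →
      (∀ y ∈ hull K', f y = g y) → gradient f x = gradient g x := by
    intro f g K' x hx hfg
    refine Filter.EventuallyEq.gradient_eq ?_
    filter_upwards [isOpen_interior.mem_nhds hx] with y hy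
    exact hfg y (interior_subset hy)
  have main : ∀ {F₁ F₂ : Plane → ℝ}, (∀ x ∈ interior (hull K), F₁ x = F₂ x) →
      (∀ K' ∈ T.elements, K' ≠ K → ∀ x ∈ interior (hull K'), F₁ x = 0) →
      ∫ x in P.Ω, F₁ x = ∫ x in hull K, F₂ x := by
    intro F₁ F₂ h1 h2
    have hae : F₁ =ᵐ[volume.restrict P.Ω] (interior (hull K)).indicator F₂ := by
      filter_upwards [ae_restrict_mem P.measurableSet_Ω, ae_restrict_of_ae hfr] with x hx hxf
      by_cases hxK : x ∈ interior (hull K)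
      · rw [indicator_of_mem hxK, h1 x hxK]
      · rw [indicator_of_notMem hxK]
        obtain ⟨K', hK', hxK'⟩ := T.exists_mem_hull (subset_closure hx)
        have hin : x ∈ interior (hull K') := by
          by_contra hcon
          exact hxf K' hK' ⟨subset_closure hxK', hcon⟩
        exact h2 K' hK' (by rintro rfl; exact hxK hin) x hin
    rw [integral_congr_ae hae, setIntegral_indicator isOpen_interior.measurableSet,
      inter_eq_right.2 (T.interior_hull_subset hK), restrict_hull]
  constructor
  · refine main (fun x hx => by rw [hgrad hx hψK]) (fun K' hK' hne x hx => ?_)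
    rw [hgrad (g := fun _ => 0) hx (hψ0 K' hK' hne)]
    have : gradient (fun _ : Plane => (0 : ℝ)) x = 0 := by simp [gradient]
    rw [this, inner_zero_right]
  · exact main (fun x hx => by rw [hψK x (interior_subset hx)])
      (fun K' hK' hne x hx => by rw [hψ0 K' hK' hne x (interior_subset hx), mul_zero])

/-- The constant in the estimate for Neumann edges. -/
def neumannConst (σ ρ : ℝ) : ℝ :=
  (2 + 2 * σ) * ((4 * bumpConst + 2 * loadConst σ) * InterfaceProblem.contrast ρ)

/-- The bound for the edges on the Neumann boundary. -/
lemma IsSetting.neumann_le (hs : T.IsSetting σ u G v) {K F : Finset Plane} (hFK : F ∈ edgesOf K)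
    (hF : T.IsNeumann F) {c : ℝ} (hc : ∀ᵐ x ∂(μH[1] : Measure Plane).restrict (hull F), P.g x = c) :
    h F * T.fluxSq v F ≤ (neumannConst σ P.ρ * T.bound G v K) ^ 2 := by
  have hσ := hs.σ_pos
  obtain ⟨hFE, hFfr, hFN⟩ := hF
  have hh0 := T.h_pos hFE
  have hK₁ := (T.K₁_mem F hFE).1
  have hE₁ := T.mem_edgesOf_K₁ hFE
  have hFK₁ := (T.K₁_mem F hFE).2
  have hp₁ := T.mem_patch_of_edge hK₁ hFK hE₁
  have hni : ¬ T.IsInterior F := fun h' => h'.2 hFfr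
  obtain ⟨a, b, hab, hFe, hh, hn1, hn⟩ := T.exists_ends hFE
  have hout := T.n_outward F hFE a (by rw [hFe]; simp)
  obtain ⟨gp, gm, ν, b₁, ph⟩ := T.exists_phase hs.cut hs.ife hK₁
  have hm₁ := hull_mono (Finset.mem_powersetCard.1 hE₁).1
  set n := T.n F with hnF
  set x₀ : Plane := (1 - (1 / 2 : ℝ)) • a + (1 / 2 : ℝ) • b with hx₀
  set r := h F / (2 + 2 * σ) with hr
  have hr0 : 0 < r := by positivity
  have hr2 : r < 1 / 2 * ‖a - b‖ := by
    rw [← hh, hr, div_lt_iff₀ (by positivity)]; nlinarith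
  have hrσ : r < 2 * (‖a - b‖ / σ) * (1 / 2) := by
    have : r < h F / σ := div_lt_div_of_pos_left hh0 hσ (by linarith)
    rw [← hh]; linarith
  have hrd : r ≤ Metric.diam (hull (T.K₁ F)) :=
    (div_le_self hh0.le (by linarith)).trans (h_le_diam hE₁)
  have hFK₁' : ({a, b} : Finset Plane) ⊆ T.K₁ F := hFe ▸ hFK₁
  have hnear : ∀ x, ‖x - x₀‖ ≤ r → (x ∈ hull (T.K₁ F) ↔ ⟪n, x - x₀⟫_ℝ ≤ 0) := fun x hx =>
    T.mem_hull_iff_near_edge hσ hs.shape hK₁ hab hFK₁' hn1 hn hout (θ := 1 / 2) le_rfl (by norm_num)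
      (hx.trans_lt hrσ)
  have hfaces := fun x (hx : ‖x - x₀‖ ≤ r) =>
    T.near_edge_faces hσ hs.shape hK₁ hab hFK₁' hn1 hn hout (θ := 1 / 2) le_rfl (by norm_num)
      (hx.trans_lt hrσ)
  have hline : ∀ s : ℝ, |s| ≤ r → x₀ + s • rot n ∈ hull F \ F := by
    intro s hs'
    obtain ⟨τ, hτ, he⟩ := exists_line_point (τ := 1 / 2) hab hn1 hn (hs'.trans_lt hr2)
    obtain ⟨h5, h6⟩ := abs_lt.1 hτ
    rw [he, hFe]
    exact segment_point_mem_sdiff hab (by linarith) (by linarith)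
  obtain ⟨φ, hφ⟩ := exists_isBump x₀ hr0
  have hφline : ∀ s : ℝ, x₀ + s • rot n ∉ hull F \ F → φ (x₀ + s • rot n) = 0 := by
    intro s hs'
    refine hφ.eq_zero fun hx => hs' (hline s ?_)
    rwa [mem_closedBall_iff_norm, add_sub_cancel_left, norm_smul, norm_rot, hn1, mul_one,
      Real.norm_eq_abs] at hx
  -- the phase on the edge
  obtain ⟨α₀, g, hα₀, hα, hα', hval, hsee⟩ : ∃ (α₀ : ℝ) (g : Plane), 0 < α₀ ∧ α₀ ≤ P.αmax ∧
      P.αmax ≤ InterfaceProblem.contrast P.ρ * α₀ ∧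
      (∀ x ∈ hull F, T.αt (T.K₁ F) x = α₀ ∧ grad v (T.K₁ F) x = g) ∧
      T.SeesPhase v (T.K₁ F) n x₀ φ α₀ g := by
    rcases ph.edge_const F hE₁ (fun x hx => P.notMem_Γ_of_mem_frontier (hFfr hx)) with h' | h'
    · exact ⟨P.αp, gp, P.αp_pos, le_max_left _ _, P.αmax_le_p,
        fun x hx => ph.pos x (hm₁ hx) (h' x hx),
        ph.seesPhase_pos hn1 hnear hφ fun s hs' => h' _ (hline s hs').1⟩
    · exact ⟨P.αm, gm, P.αm_pos, le_max_right _ _, P.αmax_le_m,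
        fun x hx => ph.neg x (hm₁ hx) (h' x hx),
        ph.seesPhase_neg hn1 hnear hφ fun s hs' => h' _ (hline s hs').1⟩
  -- the test function
  obtain ⟨ψ, hψs, hψc, hψ1, hψK, hψball, hψ0⟩ := T.exists_local_test hφ (K := T.K₁ F)
    (fun K' hK' hne x hx hxK hxK' => hne (by
      have hx' : x ∈ hull (T.K₁ F ∩ K') := by
        rw [← T.conforming _ hK₁ _ hK']; exact ⟨hxK, hxK'⟩
      have := (hfaces x (by rwa [mem_closedBall_iff_norm] at hx)).1 _ Finset.inter_subset_left hx'
      exact T.eq_of_boundary_edge hσ hs.shape hK₁ hK' hab hFK₁' (this.trans Finset.inter_subset_right)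
        hn1 hn hout (hFe ▸ hFfr)))
  have hψbd : ∀ x ∈ frontier P.Ω, x ∉ hull F \ F → ψ x = 0 := by
    intro x hx hxF
    by_contra hne
    have hxb : x ∈ Metric.closedBall x₀ r := by
      by_contra hxb; exact hne (hψball x hxb)
    obtain ⟨K', hK', hxK'⟩ := T.exists_mem_hull (frontier_subset_closure hx)
    have hKK : K' = T.K₁ F := by
      by_contra h'; exact hne (hψ0 K' hK' h' x hxK')
    rw [hKK] at hxK'
    have hxfr : x ∈ frontier (hull (T.K₁ F)) := ⟨subset_closure hxK', fun hin =>
      P.isOpen.inter_frontier_eq.subset ⟨T.interior_hull_subset hK₁ hin, hx⟩⟩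
    have := (hfaces x (by rwa [mem_closedBall_iff_norm] at hxb)).2 hxfr
    rw [hFe] at hxF
    exact hxF this
  have hD : ∀ x ∈ P.ΓD, ψ x = 0 := fun x hx =>
    hψbd x (by rw [P.frontier_eq]; exact Or.inl (subset_closure hx))
      fun h' => P.disjoint_boundary.le_bot ⟨hx, hFN h'⟩
  have hNz : ∀ x ∈ P.ΓN, x ∉ hull F \ F → ψ x = 0 := fun x hx =>
    hψbd x (by rw [P.frontier_eq]; exact Or.inr (subset_closure hx))
  have hmF : MeasurableSet (hull F \ F) :=
    (isClosed_hull F).measurableSet.diff F.finite_toSet.measurableSet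
  have hfin : IsFiniteMeasure ((μH[1] : Measure Plane).restrict (hull F \ F)) := ⟨by
    rw [Measure.restrict_apply_univ]
    exact (measure_mono Set.sdiff_subset).trans_lt
      (by rw [T.hausdorffMeasure_hull_edge hFE]; exact ENNReal.ofReal_lt_top)⟩
  have hN : MemLp ψ 2 (μH[1].restrict P.ΓN) := by
    have hb : MemLp ψ 2 ((μH[1] : Measure Plane).restrict (hull F \ F)) :=
      MemLp.of_bound hψs.continuous.aestronglyMeasurable 1 (Eventually.of_forall hψ1)
    have hi : MemLp ((hull F \ (F : Set Plane)).indicator ψ) 2 (μH[1] : Measure Plane) :=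
      (memLp_indicator_iff_restrict hmF).2 hb
    refine (memLp_congr_ae ?_).1 (hi.restrict P.ΓN)
    filter_upwards [ae_restrict_mem P.measurableSet_ΓN] with x hx
    by_cases hxF : x ∈ hull F \ F
    · rw [indicator_of_mem hxF]
    · rw [indicator_of_notMem hxF, hNz x hx hxF]
  have hFnull : ((hull F \ (F : Set Plane) : Set Plane)) =ᵐ[μH[1]] hull F := by
    have := Measure.nullSingletonClass_hausdorff Plane (show (0 : ℝ) < 1 by norm_num)
    exact sdiff_null_ae_eq_self (F.finite_toSet.measure_zero _)
  set Φ := ∫ s : ℝ, φ (x₀ + s • rot n) with hΦ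
  have hΦr : r ≤ Φ := hφ.le_integral_line hr0 hn1
  have hΦ0 : 0 < Φ := hr0.trans_le hΦr
  have htrace : ∫ x in P.ΓN, P.g x * ψ x ∂μH[1] = c * Φ := by
    have e1 : ∫ x in P.ΓN, P.g x * ψ x ∂μH[1]
        = ∫ x in P.ΓN, (hull F \ (F : Set Plane)).indicator (fun x => P.g x * ψ x) x ∂μH[1] := by
      refine setIntegral_congr_fun P.measurableSet_ΓN fun x hx => ?_
      by_cases hxF : x ∈ hull F \ F
      · simp only [indicator_of_mem hxF]
      · simp only [indicator_of_notMem hxF, hNz x hx hxF, mul_zero]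
    have hsl : ∀ x ∈ hull F \ F, ⟪n, x - x₀⟫_ℝ = 0 := by
      intro x hx
      rw [hFe] at hx
      obtain ⟨τ, -, -, rfl⟩ := mem_sdiff_pair hx
      have : (1 - τ) • a + τ • b - x₀ = (τ - 1 / 2) • (b - a) := by rw [hx₀]; module
      rw [this, real_inner_smul_right, hn, mul_zero]
    rw [e1, setIntegral_indicator hmF, inter_eq_right.2 hFN, hΦ,
      ← setIntegral_hausdorff_eq_integral_line hn1 x₀ hsl hφline, ← integral_const_mul]
    rw [Measure.restrict_congr_set hFnull]
    refine integral_congr_ae ?_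
    filter_upwards [hc, ae_restrict_mem (isClosed_hull F).measurableSet] with x hx hxF
    rw [hx, hψK x (hm₁ hxF)]
  have htest := hs.sol.test_neumann hψs hψc hD hN
  simp_rw [← real_inner_smul_left] at htest
  rw [(T.integral_of_local_test hK₁ hψK hψ0 _ P.f).1, (T.integral_of_local_test hK₁ hψK hψ0 G P.f).2,
    htrace] at htest
  -- the estimate
  have hb := bumpConst_pos
  have hR1 : 1 ≤ InterfaceProblem.contrast P.ρ := InterfaceProblem.one_le_contrast P.ρ_pos
  set R := InterfaceProblem.contrast P.ρ with hR
  have hKB := T.element_le_bound G v hp₁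
  set B := T.bound G v K with hB
  have hB0 : 0 ≤ B := T.bound_nonneg G v K
  have hl0 : 0 ≤ loadConst σ := by unfold loadConst; positivity
  have hfl := hs.memLp_flux T hK₁
  have hal := hs.memLp_α_smul T hK₁
  have s₁ := hφ.abs_setIntegral_inner_le hb.le hr0 (hfl.sub hal)
  simp only [Pi.sub_apply, inner_sub_left] at s₁
  rw [integral_sub (hφ.integrable_inner hfl) (hφ.integrable_inner hal), hsee.flux] at s₁
  have s₁' : |_| ≤ 2 * bumpConst * T.resid G v (T.K₁ F) := s₁
  have q₁ := hφ.abs_setIntegral_mul_le hr0 (T.memLp_hull P.memLp_f hK₁)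
  set N := √(∫ x in hull (T.K₁ F), P.f x ^ 2)
  have g0 := T.geo_nonneg v (T.K₁ F)
  have o0 := T.osc_nonneg (T.K₁ F)
  have hres : T.resid G v (T.K₁ F) ≤ 2 * (√P.αmax * √R) * B :=
    (hs.resid_le T hK₁).trans (by gcongr; linarith)
  have hload : r * N ≤ loadConst σ * (√P.αmax * √R) * B := by
    calc r * N ≤ Metric.diam (hull (T.K₁ F)) * N := by gcongr
      _ ≤ _ := hs.load_le T hK₁
      _ ≤ _ := by gcongr
  set J := α₀ * ⟪g, n⟫_ℝ + c with hJ
  have hJr : r * |J| ≤ (4 * bumpConst + 2 * loadConst σ) * (√P.αmax * √R) * B := by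
    have e : J * Φ = (α₀ * ⟪g, n⟫_ℝ * Φ - ∫ x in hull (T.K₁ F), ⟪P.α x • G x, gradient φ x⟫_ℝ)
        + ∫ x in hull (T.K₁ F), P.f x * φ x := by
      rw [htest, hJ]; ring
    calc r * |J| ≤ Φ * |J| := by gcongr
      _ = |J * Φ| := by rw [abs_mul, abs_of_pos hΦ0, mul_comm]
      _ ≤ 2 * bumpConst * T.resid G v (T.K₁ F) + 2 * r * N := by
          rw [e]; exact (abs_add_le _ _).trans (add_le_add s₁' q₁)
      _ ≤ 2 * bumpConst * (2 * (√P.αmax * √R) * B) + 2 * (loadConst σ * (√P.αmax * √R) * B) := by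
          have := mul_le_mul_of_nonneg_left hres (by positivity : 0 ≤ 2 * bumpConst)
          linarith
      _ = _ := by ring
  have hflux : T.fluxSq v F = α₀⁻¹ * J ^ 2 * h F := by
    have e : ∀ᵐ x ∂(μH[1] : Measure Plane).restrict (hull F),
        (T.αF F x)⁻¹ * T.jn v F x ^ 2 = α₀⁻¹ * J ^ 2 := by
      filter_upwards [hc, ae_restrict_mem (isClosed_hull F).measurableSet] with x hx hxF
      obtain ⟨e1, e2⟩ := hval x hxF
      rw [αF, jn, if_neg hni, if_neg hni, if_pos ⟨hFE, hFfr, hFN⟩, e1, e2, hx, real_inner_smul_left]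
    rw [fluxSq, integral_congr_ae e, integral_const, smul_eq_mul, mul_comm]
    simp [Measure.real, T.hausdorffMeasure_hull_edge hFE, hh0.le]
  have hsα : 0 < √α₀ := Real.sqrt_pos.2 hα₀
  have hfin' : h F * ((√α₀)⁻¹ * |J|) ≤ neumannConst σ P.ρ * B := by
    have hsA : √P.αmax ≤ √R * √α₀ := by
      rw [← Real.sqrt_mul (by linarith)]; exact Real.sqrt_le_sqrt hα'
    have hhr : h F = (2 + 2 * σ) * r := by rw [hr]; field_simp
    have hRR : √R * √R = R := Real.mul_self_sqrt (by linarith)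
    calc h F * ((√α₀)⁻¹ * |J|) = (2 + 2 * σ) * (√α₀)⁻¹ * (r * |J|) := by rw [hhr]; ring
      _ ≤ (2 + 2 * σ) * (√α₀)⁻¹ * ((4 * bumpConst + 2 * loadConst σ) * (√R * √α₀ * √R) * B) := by
          refine mul_le_mul_of_nonneg_left (hJr.trans ?_) (by positivity)
          gcongr
      _ = (2 + 2 * σ) * ((4 * bumpConst + 2 * loadConst σ) * (√R * √R)) * B * ((√α₀)⁻¹ * √α₀) := by ring
      _ = _ := by rw [inv_mul_cancel₀ hsα.ne', hRR, mul_one]; rfl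
  rw [hflux]
  calc h F * (α₀⁻¹ * J ^ 2 * h F) = (h F * ((√α₀)⁻¹ * |J|)) ^ 2 := by
        rw [mul_pow, mul_pow, inv_pow, Real.sq_sqrt hα₀.le, sq_abs]; ring
    _ ≤ _ := pow_le_pow_left₀ (by positivity) hfin' 2

end Mesh

namespace Mesh

variable {P : InterfaceProblem} (T : Mesh P)
variable {σ : ℝ} {u : Plane → ℝ} {G : Plane → Plane} {v : Broken}

/-! ### The efficiency of the indicator -/

lemma sum_edges_le {K : Finset Plane} (hK : K ∈ T.elements) {p : Finset Plane → Prop}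
    [DecidablePred p] {f : Finset Plane → ℝ} {X : ℝ} (hf : ∀ F ∈ edgesOf K, p F → f F ≤ X ^ 2) :
    ∑ F ∈ edgesOf K with p F, f F ≤ 3 * X ^ 2 := by
  have hcard : ((edgesOf K).filter p).card ≤ 3 := by
    refine (Finset.card_filter_le _ _).trans ?_
    rw [edgesOf, Finset.card_powersetCard, T.card_eq K hK]
    decide
  refine (Finset.sum_le_card_nsmul _ _ (X ^ 2) fun F hF => ?_).trans ?_
  · obtain ⟨h1, h2⟩ := Finset.mem_filter.1 hF
    exact hf F h1 h2
  · rw [nsmul_eq_mul]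
    have : (((edgesOf K).filter p).card : ℝ) ≤ 3 := by exact_mod_cast hcard
    gcongr

/-- The indicator in terms of bounds for the edge terms. -/
lemma η_le {K : Finset Plane} (hK : K ∈ T.elements) {X Y Z : ℝ} (hX : 0 ≤ X) (hY : 0 ≤ Y)
    (hZ : 0 ≤ Z)
    (h1 : ∀ F ∈ edgesOf K, T.IsInterfaceEdge F →
      h F / 2 * T.fluxSq v F + h F / 2 * T.tangSq v F ≤ X ^ 2)
    (h2 : ∀ F ∈ edgesOf K, T.IsInterior F ∧ ¬ T.IsInterfaceEdge F → h F / 2 * T.fluxSq v F ≤ Y ^ 2)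
    (h3 : ∀ F ∈ edgesOf K, T.IsNeumann F → h F * T.fluxSq v F ≤ Z ^ 2) :
    T.η v K ≤ 2 * X + T.geo v K + 2 * Y + 2 * Z := by
  have hg := T.geo_nonneg v K
  refine Real.sqrt_le_iff.2 ⟨by positivity, ?_⟩
  have a1 := T.sum_edges_le hK h1
  have a2 := T.sum_edges_le hK h2
  have a3 := T.sum_edges_le hK h3
  calc _ ≤ 3 * X ^ 2 + T.geo v K ^ 2 + 3 * Y ^ 2 + 3 * Z ^ 2 := by gcongr
    _ ≤ _ := by
      have : 0 ≤ X * T.geo v K + X * Y + X * Z + T.geo v K * Y + T.geo v K * Z + Y * Z := by positivity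
      nlinarith [mul_nonneg hX hg, mul_nonneg hX hY, mul_nonneg hX hZ, mul_nonneg hg hY,
        mul_nonneg hg hZ, mul_nonneg hY hZ, sq_nonneg X, sq_nonneg Y, sq_nonneg Z]

/-- The constant for moderately cut edges. -/
def efficiencyConst₁ (σ ρ lam Lam : ℝ) : ℝ :=
  2 * |edgeConst σ ρ / (min (lam / (1 + lam)) (1 / (1 + Lam)) / 4)| + 1
    + 2 * |4 * edgeConst σ ρ| + 2 * |neumannConst σ ρ|

/-- The constant for arbitrarily cut edges. -/
def efficiencyConst₂ (σ ρ κ M : ℝ) : ℝ :=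
  2 * (|cutConst σ ρ| * (1 + |κ * M|)) + 1 + 2 * |4 * edgeConst σ ρ| + 2 * |neumannConst σ ρ|

lemma efficiencyConst₁_pos (σ ρ lam Lam : ℝ) : 0 < efficiencyConst₁ σ ρ lam Lam := by
  unfold efficiencyConst₁; positivity

lemma efficiencyConst₂_pos (σ ρ κ M : ℝ) : 0 < efficiencyConst₂ σ ρ κ M := by
  unfold efficiencyConst₂; positivity

lemma geo_le_bound (G : Plane → Plane) (v : Broken) {K : Finset Plane} (hK : K ∈ T.elements) :
    T.geo v K ≤ T.bound G v K := by
  have hp : K ∈ T.patch K :=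
    Finset.mem_filter.2 ⟨hK, by rw [Finset.inter_self]; exact T.nonempty_of_mem hK⟩
  have h1 := T.element_le_bound G v hp
  have h2 : 0 ≤ errOn (P := P) G v K := Real.sqrt_nonneg _
  have h3 := T.osc_nonneg K
  linarith

lemma sq_le_sq_abs_mul {x c B : ℝ} (h : x ≤ (c * B) ^ 2) : x ≤ (|c| * B) ^ 2 := by
  rwa [mul_pow, sq_abs, ← mul_pow]

lemma IsSetting.η_le_of_ratioBound (hs : T.IsSetting σ u G v) {K : Finset Plane}
    (hK : T.IsInterfaceElement K)
    (hg : ∀ F ∈ edgesOf K, T.IsNeumann F →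
      ∃ c : ℝ, ∀ᵐ x ∂(μH[1] : Measure Plane).restrict (hull F), P.g x = c)
    {lam Lam : ℝ} (hlam : 0 < lam) (hr : T.RatioBound lam Lam K) :
    T.η v K ≤ efficiencyConst₁ σ P.ρ lam Lam * T.bound G v K := by
  have hB := T.bound_nonneg G v K
  have hgeo := T.geo_le_bound G v hK.1
  refine (T.η_le hK.1 (X := |edgeConst σ P.ρ / (min (lam / (1 + lam)) (1 / (1 + Lam)) / 4)|
      * T.bound G v K) (Y := |4 * edgeConst σ P.ρ| * T.bound G v K)
      (Z := |neumannConst σ P.ρ| * T.bound G v K) (by positivity) (by positivity) (by positivity)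
      (fun F hF hI => ?_) (fun F hF hI => ?_) fun F hF hN => ?_).trans ?_
  · exact sq_le_sq_abs_mul (hs.edge_le_of_ratio T hF hI hlam (hr F hF hI).1 (hr F hF hI).2)
  · exact sq_le_sq_abs_mul (hs.uncut_edge_le T hK hF hI.1 hI.2)
  · obtain ⟨c, hc⟩ := hg F hF hN
    exact sq_le_sq_abs_mul (hs.neumann_le T hF hN hc)
  · unfold efficiencyConst₁
    linarith

lemma small_nonneg (K : Finset Plane) : 0 ≤ T.small K :=
  Finset.sum_nonneg fun _ _ => mul_nonneg (Real.sqrt_nonneg _)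
    (le_min (Real.sqrt_nonneg _) (Real.sqrt_nonneg _))

lemma IsSetting.η_le_add_small (hs : T.IsSetting σ u G v) {K : Finset Plane}
    (hK : T.IsInterfaceElement K)
    (hg : ∀ F ∈ edgesOf K, T.IsNeumann F →
      ∃ c : ℝ, ∀ᵐ x ∂(μH[1] : Measure Plane).restrict (hull F), P.g x = c)
    {κ M : ℝ} (hκ : ∀ s, ‖deriv (deriv P.γ) s‖ ≤ κ)
    (hM : √(∫ x in P.Ω, P.α x * ‖G x‖ ^ 2) ≤ M) :
    T.η v K ≤ efficiencyConst₂ σ P.ρ κ M * (T.bound G v K + T.small K) := by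
  have hB := T.bound_nonneg G v K
  have hS := T.small_nonneg K
  have hgeo := T.geo_le_bound G v hK.1
  have hκ0 : 0 ≤ κ := (norm_nonneg _).trans (hκ 0)
  have hM0 : 0 ≤ M := (Real.sqrt_nonneg _).trans hM
  have hmono : ∀ {c : ℝ}, 0 ≤ c → (c * T.bound G v K) ^ 2 ≤ (c * (T.bound G v K + T.small K)) ^ 2 :=
    fun hc => pow_le_pow_left₀ (mul_nonneg hc hB) (mul_le_mul_of_nonneg_left (by linarith) hc) 2
  refine (T.η_le hK.1 (X := |cutConst σ P.ρ| * (1 + |κ * M|) * (T.bound G v K + T.small K))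
      (Y := |4 * edgeConst σ P.ρ| * (T.bound G v K + T.small K))
      (Z := |neumannConst σ P.ρ| * (T.bound G v K + T.small K))
      (by positivity) (by positivity) (by positivity)
      (fun F hF hI => ?_) (fun F hF hI => ?_) fun F hF hN => ?_).trans ?_
  · refine (sq_le_sq_abs_mul (hs.interface_edge_le T hκ hM hF hI)).trans ?_
    have hle : √(h F) * min √(T.hm F) √(T.hp F) ≤ T.small K :=
      Finset.single_le_sum (f := fun F => √(h F) * min √(T.hm F) √(T.hp F))
        (fun F' _ => mul_nonneg (Real.sqrt_nonneg _) (le_min (Real.sqrt_nonneg _) (Real.sqrt_nonneg _)))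
        (Finset.mem_filter.2 ⟨hF, hI⟩)
    have h0 : 0 ≤ √(h F) * min √(T.hm F) √(T.hp F) :=
      mul_nonneg (Real.sqrt_nonneg _) (le_min (Real.sqrt_nonneg _) (Real.sqrt_nonneg _))
    refine pow_le_pow_left₀ (by positivity) ?_ 2
    rw [mul_assoc |cutConst σ P.ρ|]
    refine mul_le_mul_of_nonneg_left ?_ (abs_nonneg _)
    rw [abs_of_nonneg (mul_nonneg hκ0 hM0)]
    have h1 := mul_le_mul_of_nonneg_left hle (mul_nonneg hκ0 hM0)
    have h2 : 0 ≤ κ * M * T.bound G v K := by positivity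
    linarith
  · exact (sq_le_sq_abs_mul (hs.uncut_edge_le T hK hF hI.1 hI.2)).trans (hmono (abs_nonneg _))
  · obtain ⟨c, hc⟩ := hg F hF hN
    exact (sq_le_sq_abs_mul (hs.neumann_le T hF hN hc)).trans (hmono (abs_nonneg _))
  · unfold efficiencyConst₂
    linarith

end Mesh

end IFEM

end

theorem mainTheorem2 :
    ∃ C₁ C₂ : ℝ → ℝ → ℝ → ℝ → ℝ,
      (∀ a b c d, 0 < C₁ a b c d) ∧ (∀ a b c d, 0 < C₂ a b c d) ∧
      ∀ (P : IFEM.InterfaceProblem) (T : IFEM.Mesh P) (σ lam Lam κ M ε γ : ℝ)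
        (u : IFEM.Plane → ℝ) (G : IFEM.Plane → IFEM.Plane) (uT : IFEM.Mesh.Broken)
        (K : Finset IFEM.Plane),
        0 < σ → T.ShapeRegular σ → T.RegularCut →
        (∀ s, ‖deriv (deriv P.γ) s‖ ≤ κ) →
        P.IsSolution u G →
        √(∫ x in P.Ω, P.α x * ‖G x‖ ^ 2) ≤ M →
        (ε = -1 ∨ ε = 0 ∨ ε = 1) → 0 < γ →
        T.IsIFESolution ε γ uT →
        T.IsInterfaceElement K →
        (∀ F ∈ IFEM.Mesh.edgesOf K, T.IsNeumann F →
          ∃ c : ℝ, ∀ᵐ x ∂(MeasureTheory.Measure.hausdorffMeasure 1).restrict (IFEM.hull F),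
            P.g x = c) →
        0 < lam →
        (T.RatioBound lam Lam K →
          T.η uT K ≤ C₁ σ P.ρ lam Lam *
            (T.err G uT K + (∑ K' ∈ T.patch K, T.geo uT K') + ∑ K' ∈ T.patch K, T.osc K')) ∧
        T.η uT K ≤ C₂ σ P.ρ κ M *
          (T.err G uT K + (∑ K' ∈ T.patch K, T.geo uT K') + T.small K
            + ∑ K' ∈ T.patch K, T.osc K') ∧
        (T.RatioBound lam Lam K →
          T.η uT K ≤ min (C₁ σ P.ρ lam Lam) (C₂ σ P.ρ κ M) *
            (T.err G uT K + T.δ (C₁ σ P.ρ lam Lam) (C₂ σ P.ρ κ M) uT K)) := by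
  refine ⟨IFEM.Mesh.efficiencyConst₁, IFEM.Mesh.efficiencyConst₂, IFEM.Mesh.efficiencyConst₁_pos,
    IFEM.Mesh.efficiencyConst₂_pos, ?_⟩
  intro P T σ lam Lam κ M ε γ u G uT K hσ hshape hcut hκ hsol hM _ _ huT hK hg hlam
  have hs : T.IsSetting σ u G uT := ⟨hσ, hshape, hcut, hsol, huT.1.1⟩
  have h1 : T.RatioBound lam Lam K → T.η uT K ≤ IFEM.Mesh.efficiencyConst₁ σ P.ρ lam Lam *
      (T.err G uT K + (∑ K' ∈ T.patch K, T.geo uT K') + ∑ K' ∈ T.patch K, T.osc K') :=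
    fun hr => hs.η_le_of_ratioBound T hK hg hlam hr
  have h2 : T.η uT K ≤ IFEM.Mesh.efficiencyConst₂ σ P.ρ κ M *
      (T.err G uT K + (∑ K' ∈ T.patch K, T.geo uT K') + T.small K
        + ∑ K' ∈ T.patch K, T.osc K') := by
    refine (hs.η_le_add_small T hK hg hκ hM).trans_eq ?_
    unfold IFEM.Mesh.bound
    ring
  refine ⟨h1, h2, fun hr => ?_⟩
  unfold IFEM.Mesh.δ
  split_ifs with hC
  · rw [min_eq_right hC, ← add_assoc, ← add_assoc]
    exact h2
  · rw [min_eq_left (not_le.1 hC).le, add_zero, ← add_assoc]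
    exact h1 hr
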